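/- Let $N_j$ $(j\ge1)$ be independent Poisson random variables with $\mathbb E N_j=1/j$, and let $S_{ji}$ $(i,j\ge1)$ be independent random variables, independent of $(N_j)_{j\ge1}$, with $S_{ji}$ having the Gamma$(j,1)$ distribution (the sum of $j$ independent standard exponentials). For $n\ge 1$ put $$S_n=\sum_{j=1}^n\sum_{i=1}^{N_j}S_{ji},\qquad T_n=\sum_{j=1}^n jN_j,\qquad V_n=\frac{S_n-T_n}{\sqrt n},\qquad W_n=\frac{T_n}{n}.$$ Let $h$ be analytic on the half plane $\{z\in\mathbb C:\operatorname{Re} z>0\}$ and real-valued on $(0,\infty)$, with $h''(1)\ne0$ and such that, for real $t$, $|h(1-it)|=O(t^2)$ and $|h''(1-it)|=O(1)$ as $|t|\to\infty$. For $n\ge2$ define $$U_n=\frac{1}{\sqrt{\tfrac34h''(1)^2\log n}}\Biggl\{\sum_{j=1}^n\sum_{i=1}^{N_j}\Bigl[\bigl(h(j/S_{ji})-h(1)\bigr)S_{ji}+h'(1)(S_{ji}-j)\Bigr]-\tfrac12h''(1)\log n\Biggr\}.$$ **Theorem.** For every $n\ge2$ the conditional law of $U_n$ given $(V_n,W_n)=(0,1)$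 (equivalently, given $S_n=T_n=n$) exists and is unique, and as $n\to\infty$ these conditional laws converge weakly to the standard normal distribution $N(0,1)$. Here, since $\{(V_n,W_n)=(0,1)\}$ has probability zero while $\{W_n=1\}$ does not, the conditional law given $(V_n,W_n)=(0,1)$ means $\kappa_n((0,1),\cdot)$, where $\kappa_n$ is a regular conditional distribution of $U_n$ given $(V_n,W_n)$ for which $v\mapsto\kappa_n((v,1),\cdot)$ is weakly continuous at $v=0$. -/

import Mathlib

open MeasureTheory ProbabilityTheory Filter Topology Asymptotics

noncomputable section

namespace Grenander

/-- The conditions on the integrand `h`: it is analytic on the open right half plane and real on the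
positive half line, `h''(1) ≠ 0`, and on the line `Re z = 1` one has `h(1 - it) = O(t²)` and
`h''(1 - it) = O(1)` as `|t| → ∞`. (The filter `cocompact ℝ` describes `|t| → ∞`.) -/
structure IsAdmissible (h : ℂ → ℂ) : Prop where
  analytic : DifferentiableOn ℂ h {z : ℂ | 0 < z.re}
  real_on_pos : ∀ x : ℝ, 0 < x → (h (x : ℂ)).im = 0
  deriv_two_ne_zero : deriv (deriv h) 1 ≠ 0
  growth : (fun t : ℝ => h (1 - Complex.I * t)) =O[cocompact ℝ] fun t : ℝ => t ^ 2
  growth_deriv_two :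
    (fun t : ℝ => deriv (deriv h) (1 - Complex.I * t)) =O[cocompact ℝ] fun _ : ℝ => (1 : ℝ)

/-- The random variables `N j`, `S j i` with `i, j ≥ 1`: the `N j` are independent, `N j` is Poisson
with mean `1 / j`; the `S j i` are independent of each other, `S j i` is Gamma with shape `j` and
rate `1`; and the family `S` is independent of the family `N`. Nothing is required at index `0`. -/
structure IsPoissonGamma {Ω : Type*} [MeasurableSpace Ω] (P : Measure Ω)
    (N : ℕ → Ω → ℕ) (S : ℕ → ℕ → Ω → ℝ) : Prop where
  measurable_N : ∀ j, 1 ≤ j → Measurable (N j)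
  measurable_S : ∀ j i, 1 ≤ j → 1 ≤ i → Measurable (S j i)
  law_N : ∀ j, 1 ≤ j → P.map (N j) = poissonMeasure (1 / (j : NNReal))
  law_S : ∀ j i, 1 ≤ j → 1 ≤ i → P.map (S j i) = gammaMeasure (j : ℝ) 1
  indep_N : iIndepFun (fun (j : ℕ) => N (j + 1)) P
  indep_S : iIndepFun (fun (p : ℕ × ℕ) => S (p.1 + 1) (p.2 + 1)) P
  indep_N_S : IndepFun (fun ω (j : ℕ) => N (j + 1) ω)
    (fun ω (p : ℕ × ℕ) => S (p.1 + 1) (p.2 + 1) ω) P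

section Statistics

variable {Ω : Type*} (N : ℕ → Ω → ℕ) (S : ℕ → ℕ → Ω → ℝ)

/-- `S_n = ∑_{j ≤ n} ∑_{i ≤ N_j} S_{ji}`. -/
def sumS (n : ℕ) (ω : Ω) : ℝ :=
  ∑ j ∈ Finset.Icc 1 n, ∑ i ∈ Finset.Icc 1 (N j ω), S j i ω

/-- `T_n = ∑_{j ≤ n} j N_j`. -/
def sumT (n : ℕ) (ω : Ω) : ℕ :=
  ∑ j ∈ Finset.Icc 1 n, j * N j ω

/-- `V_n = n^{-1/2} (S_n - T_n)`. -/
def V (n : ℕ) (ω : Ω) : ℝ :=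
  (sumS N S n ω - (sumT N n ω : ℝ)) / √(n : ℝ)

/-- `W_n = T_n / n`. -/
def W (n : ℕ) (ω : Ω) : ℝ :=
  (sumT N n ω : ℝ) / (n : ℝ)

/-- The standardized statistic `U_n`. Real parts only turn the real numbers `h(j / S_{ji})`, `h(1)`,
`h'(1)` and `h''(1)` into elements of `ℝ`. -/
def U (h : ℂ → ℂ) (n : ℕ) (ω : Ω) : ℝ :=
  ((∑ j ∈ Finset.Icc 1 n, ∑ i ∈ Finset.Icc 1 (N j ω),
        (((h (((j : ℝ) / S j i ω : ℝ) : ℂ)).re - (h 1).re) * S j i ω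
          + (deriv h 1).re * (S j i ω - (j : ℝ))))
      - 1 / 2 * (deriv (deriv h) 1).re * Real.log (n : ℝ))
    / √(3 / 4 * (deriv (deriv h) 1).re ^ 2 * Real.log (n : ℝ))

end Statistics

/-- `ν` is the conditional law of `X` given `(Y, Z) = (y, z)`: there is a regular conditional
distribution `κ` of `X` given `(Y, Z)` such that `y' ↦ κ (y', z)` is continuous at `y` for weak
convergence, and `ν = κ (y, z)`. The continuity is what gives the value of `κ` at a single point a
meaning when the event `(Y, Z) = (y, z)` has probability zero; it is used for a variable `Z` that
takes the value `z` with positive probability. -/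
def IsCondLawAt {Ω : Type*} [MeasurableSpace Ω] (P : Measure Ω) (X Y Z : Ω → ℝ) (y z : ℝ)
    (ν : ProbabilityMeasure ℝ) : Prop :=
  ∃ (κ : Kernel (ℝ × ℝ) ℝ) (_ : IsMarkovKernel κ),
    P.map (fun ω => ((Y ω, Z ω), X ω)) = (P.map fun ω => (Y ω, Z ω)) ⊗ₘ κ ∧
    ContinuousAt (Y := ProbabilityMeasure ℝ) (fun y' : ℝ => ⟨κ (y', z), inferInstance⟩) y ∧
    (ν : Measure ℝ) = κ (y, z)

end Grenander

end

namespace Grenander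

/-! Given `T_n = n`, the counts `N_j` are distributed as the cycle counts of a uniform permutation
of `n` points (Cauchy's formula), and the gamma variables stay independent of them. This is `model
n`. Under it the sum `S_n` of all block lengths is Gamma(`n`) and independent of the counts and the
normalized lengths (`map_total_shape`). Hence a version of the conditional law given `S_n = c`, `T_n
= n` is the law under `model n` of the statistic with every length multiplied by `c / S_n`. This
version is weakly continuous in `c > 0`. Any other regular conditional distribution agrees with it
for almost every `c`, so continuity at `c = n` fixes its value there. The null event thus
disappears: what remains is a limit theorem for `standardStat h n` under `model n`.

Put `b = h''(1)`. A Taylor expansion of `h` at `1` turns a summand into `b / 2 * (s - j)^2 / j` plus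
a residual of order `|s - j|^3 / j^2`; the linear term cancels against `h'(1) (s - j)`. The
truncated mean of a residual is `O(j^{-1/2})`, while the expected number of blocks of size `j` is `1
/ j`. These bounds are summable, so the residuals are negligible on the scale `√(log n)`. The
rescaling by `l = n / S_n = 1 + O(n^{-1/2})` in probability is harmless because its first order
effect cancels (`abs_scaledStat_sub_le`, `tendsto_integral_min_one_scaledStat`).

The quadratic part is a sum over cycles of variables `Q_j` with mean `1` and second moment `3 + 6 /
j`. Replace each characteristic function by `θ = 1 + i u - 3 u^2 / 2`. The generating function of
the number of cycles, `∏ (θ + k) / (k + 1)` over `k < n`, then gives approximately `exp ((θ - 1)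
H_n)`. With `u = t / √(3 log n)` and centering at `log n` this tends to `exp (-t^2 / 2)`;
multiplication by `b / 2` produces the variance `3 b^2 log n / 4`. -/

/-! ### Cycle counts of a uniform permutation. -/

/-- The functions `ν : Fin n → ℕ` with `∑ (j + 1) ν_j = m`. -/
def parts (n m : ℕ) : Finset (Fin n → ℕ) :=
  (Fintype.piFinset fun _ : Fin n => Finset.range (m + 1)).filter
    fun ν => ∑ j : Fin n, ((j : ℕ) + 1) * ν j = m

theorem le_of_sum_eq {n m : ℕ} {ν : Fin n → ℕ} (h : ∑ j : Fin n, ((j : ℕ) + 1) * ν j = m) (j : Fin n) :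
    ((j : ℕ) + 1) * ν j ≤ m := by
  rw [← h]
  exact Finset.single_le_sum (f := fun j : Fin n => ((j : ℕ) + 1) * ν j)
    (fun _ _ => Nat.zero_le _) (Finset.mem_univ j)

theorem mem_parts {n m : ℕ} {ν : Fin n → ℕ} :
    ν ∈ parts n m ↔ ∑ j : Fin n, ((j : ℕ) + 1) * ν j = m := by
  simp only [parts, Finset.mem_filter, Fintype.mem_piFinset, Finset.mem_range, and_iff_right_iff_imp]
  intro h j
  have := le_of_sum_eq h j
  nlinarith [Nat.zero_le (ν j), Nat.zero_le ((j : ℕ) * ν j)]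

/-- The weight `∏ (j + 1)^{-ν_j} / ν_j!`, which for `∑ (j + 1) ν_j = n` is the probability that a
uniform permutation of `n` points has `ν_j` cycles of length `j + 1` for all `j`. -/
noncomputable def weight {n : ℕ} (ν : Fin n → ℕ) : ℝ :=
  ∏ j : Fin n, (1 / ((j : ℝ) + 1)) ^ ν j / (ν j).factorial

theorem weight_nonneg {n : ℕ} (ν : Fin n → ℕ) : 0 ≤ weight ν :=
  Finset.prod_nonneg fun _ _ => by positivity

theorem weight_add_single {n : ℕ} (ν : Fin n → ℕ) (j : Fin n) :
    weight (ν + Pi.single j 1) * ((ν j : ℝ) + 1) = weight ν * (1 / ((j : ℝ) + 1)) := by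
  unfold weight
  rw [← Finset.mul_prod_erase _ _ (Finset.mem_univ j), ← Finset.mul_prod_erase _ _ (Finset.mem_univ j)]
  have : ∏ i ∈ Finset.univ.erase j, (1 / ((i : ℝ) + 1)) ^ (ν + Pi.single j 1 : Fin n → ℕ) i /
        ((ν + Pi.single j 1 : Fin n → ℕ) i).factorial
      = ∏ i ∈ Finset.univ.erase j, (1 / ((i : ℝ) + 1)) ^ ν i / (ν i).factorial := by
    refine Finset.prod_congr rfl fun i hi => ?_
    simp [Finset.ne_of_mem_erase hi]
  rw [this]
  simp only [Pi.add_apply, Pi.single_eq_same, Nat.factorial_succ, pow_succ]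
  push_cast
  have h1 : ((ν j).factorial : ℝ) ≠ 0 := by positivity
  have h2 : ((ν j : ℝ) + 1) ≠ 0 := by positivity
  field_simp

theorem sum_add_single {n : ℕ} (ν : Fin n → ℕ) (j : Fin n) :
    ∑ i : Fin n, ((i : ℕ) + 1) * (ν + Pi.single j 1 : Fin n → ℕ) i = ∑ i : Fin n, ((i : ℕ) + 1) * ν i + ((j : ℕ) + 1) := by
  simp [mul_add, Finset.sum_add_distrib, Pi.single_apply]

/-- Size-biasing: multiplying the weight by `ν_j` amounts to adding one block of size `j + 1`. -/
theorem sum_weight_mul_apply {n : ℕ} (m : ℕ) (j : Fin n) (F : (Fin n → ℕ) → ℂ) :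
    ∑ ν ∈ parts n (m + (j + 1)), (weight ν : ℂ) * ν j * F ν
      = 1 / ((j : ℂ) + 1) * ∑ ν ∈ parts n m, (weight ν : ℂ) * F (ν + Pi.single j 1) := by
  rw [Finset.mul_sum]
  symm
  refine Finset.sum_bij_ne_zero (fun ν _ _ => ν + Pi.single j 1) ?_ ?_ ?_ ?_
  · intro ν hν _
    rw [mem_parts] at hν ⊢
    rw [sum_add_single, hν]
  · intro ν _ _ μ _ _ h
    simpa using h
  · intro μ hμ hne
    have hpos : μ j ≠ 0 := by
      rintro h0
      simp [h0] at hne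
    have hμ' : μ - Pi.single j 1 + Pi.single j 1 = μ := by
      ext i
      by_cases hi : i = j
      · subst hi
        simp only [Pi.add_apply, Pi.sub_apply, Pi.single_eq_same]
        omega
      · simp [hi]
    rw [mem_parts] at hμ
    have hs := sum_add_single (μ - Pi.single j 1) j
    rw [hμ', hμ] at hs
    refine ⟨μ - Pi.single j 1, mem_parts.2 (by omega), ?_, hμ'⟩
    have hw := weight_add_single (μ - Pi.single j 1) j
    rw [hμ'] at hw
    have hw' : (weight (μ - Pi.single j 1) : ℂ) * (1 / ((j : ℂ) + 1)) = weight μ * μ j := by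
      have e : (((μ - Pi.single j 1 : Fin n → ℕ) j : ℕ) : ℝ) + 1 = μ j := by
        have : (μ - Pi.single j 1 : Fin n → ℕ) j + 1 = μ j := by simp; omega
        exact_mod_cast this
      rw [e] at hw
      have := congrArg (fun x : ℝ => (x : ℂ)) hw
      push_cast at this
      rw [this]
    have e : (1 / ((j : ℂ) + 1)) * ((weight (μ - Pi.single j 1) : ℂ) * F μ)
        = weight μ * μ j * F μ := by
      rw [← hw']
      ring
    rw [hμ', e]
    exact hne
  · intro ν _ _
    have hw := congrArg (fun x : ℝ => (x : ℂ)) (weight_add_single ν j)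
    push_cast at hw
    simp only [Pi.add_apply, Pi.single_eq_same]
    push_cast
    rw [hw]
    ring

theorem apply_eq_zero_of_lt {n m : ℕ} {ν : Fin n → ℕ} (hν : ν ∈ parts n m) {j : Fin n}
    (hj : m < (j : ℕ) + 1) : ν j = 0 := by
  by_contra h
  have := le_of_sum_eq (mem_parts.1 hν) j
  have : 1 ≤ ν j := Nat.one_le_iff_ne_zero.2 h
  nlinarith

/-- Write the factor `m` as `∑ (j + 1) ν_j` and size-bias each `ν_j`: removing one block of size `j
+ 1` leaves a configuration of total `m - 1 - j` and takes out one factor `θ`. The condition `m ≤ n`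
ensures that every size up to `m` occurs among the indices. -/
theorem sum_weight_recursion {n m : ℕ} (hm : m ≤ n) (θ : ℂ) :
    (m : ℂ) * ∑ ν ∈ parts n m, (weight ν : ℂ) * θ ^ (∑ j, ν j)
      = θ * ∑ k ∈ Finset.range m, ∑ ν ∈ parts n k, (weight ν : ℂ) * θ ^ (∑ j, ν j) := by
  set A : ℕ → ℂ := fun k => ∑ ν ∈ parts n k, (weight ν : ℂ) * θ ^ (∑ j, ν j) with hA
  have h1 : (m : ℂ) * A m = ∑ j : Fin n, ((j : ℂ) + 1) *
      ∑ ν ∈ parts n m, (weight ν : ℂ) * ν j * θ ^ (∑ j, ν j) := by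
    simp only [hA, Finset.mul_sum]
    rw [Finset.sum_comm]
    refine Finset.sum_congr rfl fun ν hν => ?_
    have := congrArg (fun x : ℕ => (x : ℂ)) (mem_parts.1 hν)
    push_cast at this
    rw [← this, Finset.sum_mul]
    refine Finset.sum_congr rfl fun j _ => by ring
  have h2 : ∀ j : Fin n, ((j : ℂ) + 1) * ∑ ν ∈ parts n m, (weight ν : ℂ) * ν j * θ ^ (∑ j, ν j)
      = if (j : ℕ) < m then θ * A (m - 1 - j) else 0 := by
    intro j
    split_ifs with hj
    · obtain ⟨k, rfl⟩ : ∃ k, m = k + ((j : ℕ) + 1) := ⟨m - (j + 1), by omega⟩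
      rw [sum_weight_mul_apply k j, ← mul_assoc, mul_one_div_cancel (Nat.cast_add_one_ne_zero _),
        one_mul]
      have : k + ((j : ℕ) + 1) - 1 - j = k := by omega
      rw [this, hA, Finset.mul_sum]
      refine Finset.sum_congr rfl fun ν _ => ?_
      have : ∑ i : Fin n, (ν + Pi.single j 1 : Fin n → ℕ) i = ∑ i, ν i + 1 := by
        simp [Finset.sum_add_distrib]
      rw [this, pow_succ]
      ring
    · rw [Finset.sum_eq_zero, mul_zero]
      intro ν hν
      rw [apply_eq_zero_of_lt hν (by omega)]
      simp
  change (m : ℂ) * A m = θ * ∑ k ∈ Finset.range m, A k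
  rw [h1, Finset.sum_congr rfl fun j _ => h2 j,
    Fin.sum_univ_eq_sum_range (fun j => if j < m then θ * A (m - 1 - j) else 0) n,
    ← Finset.sum_filter]
  have : (Finset.range n).filter (· < m) = Finset.range m := by
    ext; simp; omega
  rw [this, ← Finset.mul_sum, Finset.sum_range_reflect]

/-- The generating function of the number of cycles of a uniform permutation. -/
theorem sum_weight_mul_pow {n m : ℕ} (hm : m ≤ n) (θ : ℂ) :
    ∑ ν ∈ parts n m, (weight ν : ℂ) * θ ^ (∑ j, ν j)
      = ∏ k ∈ Finset.range m, (θ + k) / (k + 1) := by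
  induction m with
  | zero =>
    have : parts n 0 = {0} := by
      ext ν
      simp [mem_parts, funext_iff]
    simp [this, weight]
  | succ m ih =>
    -- The recursions at `m + 1` and `m` share the sum over `k < m`; eliminating it multiplies the
    -- value at `m` by `(θ + m) / (m + 1)`.
    have h1 := sum_weight_recursion hm θ
    have h2 := sum_weight_recursion (Nat.le_of_succ_le hm) θ
    rw [Finset.sum_range_succ, mul_add, ← h2, ih (by omega)] at h1
    rw [Finset.prod_range_succ]
    have : ((m : ℂ) + 1) ≠ 0 := by exact_mod_cast Nat.succ_ne_zero m
    push_cast at h1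
    field_simp
    rw [mul_comm, h1]
    ring

theorem sum_weight {n m : ℕ} (hm : m ≤ n) : ∑ ν ∈ parts n m, weight ν = 1 := by
  have := sum_weight_mul_pow hm 1
  rw [Finset.prod_eq_one] at this
  · simp only [one_pow, mul_one] at this
    exact_mod_cast this
  · intro k _
    rw [add_comm]
    exact div_self (by exact_mod_cast Nat.succ_ne_zero k)

/-- Conditioning on `T_n = n` leaves the means of the counts unchanged: size-biasing reduces the sum
to the total mass at `n - j - 1`, which is `1`. -/
theorem sum_weight_mul_apply_eq {n : ℕ} (j : Fin n) :
    ∑ ν ∈ parts n n, weight ν * ν j = 1 / ((j : ℝ) + 1) := by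
  obtain ⟨k, hk⟩ : ∃ k, n = k + ((j : ℕ) + 1) := ⟨n - (j + 1), by omega⟩
  have h := sum_weight_mul_apply k j (fun _ => 1)
  rw [← hk] at h
  have h2 := sum_weight (n := n) (m := k) (by omega)
  simp only [mul_one] at h
  rw [← Complex.ofReal_sum, h2] at h
  have : ((∑ ν ∈ parts n n, weight ν * ν j : ℝ) : ℂ) = ((1 / ((j : ℝ) + 1) : ℝ) : ℂ) := by
    push_cast
    rw [h]
    simp
  exact_mod_cast this

/-! ### Gamma distributions: tilting, size-biasing, moments. -/

section Gamma

variable {a : ℝ}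

theorem gamma_ae_pos : ∀ᵐ x ∂gammaMeasure a 1, 0 < x := by
  rw [gammaMeasure, ae_withDensity_iff (by unfold gammaPDF; fun_prop)]
  have h0 : ∀ᵐ x : ℝ, x ≠ 0 := by simp [ae_iff]
  filter_upwards [h0] with x hx h
  by_contra hneg
  exact h (gammaPDF_of_neg (lt_of_le_of_ne (not_lt.1 hneg) hx))

theorem lintegral_gamma (a : ℝ) (f : ℝ → ENNReal) (hf : Measurable f) :
    ∫⁻ x, f x ∂gammaMeasure a 1 = ∫⁻ x, gammaPDF a 1 x * f x := by
  rw [gammaMeasure, lintegral_withDensity_eq_lintegral_mul _ (by unfold gammaPDF; fun_prop) hf]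
  rfl

/-- The factor `exp ((1 - c) x)` changes `exp (-x)` in the density into `exp (-c x)`, the density of
rate `c` up to normalization, and this is the law of `x / c`. -/
theorem lintegral_gamma_tilt (ha : 0 < a) {c : ℝ} (hc : 0 < c) (f : ℝ → ENNReal)
    (hf : Measurable f) :
    ∫⁻ x, f x * ENNReal.ofReal (Real.exp ((1 - c) * x)) ∂gammaMeasure a 1
      = ENNReal.ofReal (c ^ (-a)) * ∫⁻ x, f (x / c) ∂gammaMeasure a 1 := by
  rw [lintegral_gamma _ _ (by fun_prop), lintegral_gamma _ _ (by fun_prop),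
    ← lintegral_const_mul _ (by unfold gammaPDF; fun_prop)]
  have h1 : ∀ g : ℝ → ENNReal, ∫⁻ x, g x = ENNReal.ofReal c⁻¹ * ∫⁻ x, g (c⁻¹ * x) := by
    intro g
    have hm : MeasurableEmbedding (fun x : ℝ => c⁻¹ * x) :=
      (Homeomorph.mulLeft₀ c⁻¹ (inv_ne_zero hc.ne')).measurableEmbedding
    have := Real.map_volume_mul_left (a := c⁻¹) (inv_ne_zero hc.ne')
    rw [← hm.lintegral_map, this, lintegral_smul_measure, inv_inv, abs_of_pos hc, smul_eq_mul,
      ← mul_assoc, ← ENNReal.ofReal_mul (by positivity), inv_mul_cancel₀ hc.ne',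
      ENNReal.ofReal_one, one_mul]
  rw [h1, ← lintegral_const_mul _ (by unfold gammaPDF; fun_prop)]
  refine lintegral_congr fun x => ?_
  rw [div_eq_inv_mul]
  rcases lt_or_ge x 0 with hx | hx
  · rw [gammaPDF_of_neg hx, gammaPDF_of_neg (by have := inv_pos.2 hc; nlinarith)]
    simp
  · have hx' : 0 ≤ c⁻¹ * x := by positivity
    have r : ∀ p q r t : ENNReal, p * (q * (t * r)) = p * q * r * t := fun _ _ _ _ => by ring
    rw [gammaPDF_of_nonneg hx, gammaPDF_of_nonneg hx', r, ← mul_assoc (ENNReal.ofReal (c ^ (-a)))]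
    congr 1
    have hG := Real.Gamma_pos_of_pos ha
    rw [← ENNReal.ofReal_mul (by positivity), ← ENNReal.ofReal_mul (by positivity),
      ← ENNReal.ofReal_mul (by positivity)]
    congr 1
    rw [Real.mul_rpow (by positivity) hx, Real.inv_rpow hc.le, Real.rpow_sub_one hc.ne',
      Real.rpow_neg hc.le, Real.one_rpow]
    have e : Real.exp (-(1 * x)) = Real.exp (-(1 * (c⁻¹ * x))) * Real.exp ((1 - c) * (c⁻¹ * x)) := by
      rw [← Real.exp_add]
      congr 1
      field_simp
      ring
    rw [e]
    have := Real.rpow_pos_of_pos hc a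
    field_simp

/-- Size-biasing raises the shape by one, since `Γ(a + 1) = a Γ(a)`. Iterating it gives all moments.
-/
theorem lintegral_gamma_mul_id (ha : 0 < a) (f : ℝ → ENNReal) (hf : Measurable f) :
    ∫⁻ x, ENNReal.ofReal x * f x ∂gammaMeasure a 1
      = ENNReal.ofReal a * ∫⁻ x, f x ∂gammaMeasure (a + 1) 1 := by
  rw [lintegral_gamma _ _ (by fun_prop), lintegral_gamma _ _ hf,
    ← lintegral_const_mul _ (by unfold gammaPDF; fun_prop)]
  have h0 : ∀ᵐ x : ℝ, x ≠ 0 := by simp [ae_iff]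
  refine lintegral_congr_ae ?_
  filter_upwards [h0] with x hx0
  rcases lt_or_ge x 0 with hx | hx
  · rw [gammaPDF_of_neg hx, gammaPDF_of_neg hx]
    simp
  · have hx' : 0 < x := lt_of_le_of_ne hx (Ne.symm hx0)
    have hG := Real.Gamma_pos_of_pos ha
    rw [gammaPDF_of_nonneg hx, gammaPDF_of_nonneg hx, ← mul_assoc, ← mul_assoc,
      ← ENNReal.ofReal_mul (by positivity),
      ← ENNReal.ofReal_mul (by positivity)]
    congr 2
    rw [Real.Gamma_add_one ha.ne', Real.rpow_sub_one hx0, add_sub_cancel_right, Real.one_rpow,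
      Real.one_rpow]
    field_simp

theorem lintegral_gamma_pow (ha : 0 < a) (k : ℕ) :
    ∫⁻ x, ENNReal.ofReal x ^ k ∂gammaMeasure a 1
      = ENNReal.ofReal (∏ i ∈ Finset.range k, (a + i)) := by
  induction k generalizing a with
  | zero =>
    have := isProbabilityMeasure_gammaMeasure ha one_pos
    simp
  | succ k ih =>
    simp_rw [pow_succ']
    rw [lintegral_gamma_mul_id ha _ (by fun_prop), ih (by linarith), ← ENNReal.ofReal_mul ha.le,
      Finset.prod_range_succ']
    congr 1
    rw [mul_comm]
    congr 1
    · refine Finset.prod_congr rfl fun i _ => ?_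
      push_cast
      ring
    · simp

theorem integrable_gamma_pow (ha : 0 < a) (k : ℕ) :
    Integrable (fun x => x ^ k) (gammaMeasure a 1) := by
  refine ⟨by fun_prop, ?_⟩
  rw [HasFiniteIntegral]
  have : ∫⁻ x, ‖x ^ k‖ₑ ∂gammaMeasure a 1 = ∫⁻ x, ENNReal.ofReal x ^ k ∂gammaMeasure a 1 := by
    refine lintegral_congr_ae ?_
    filter_upwards [gamma_ae_pos] with x hx
    rw [enorm_pow, Real.enorm_of_nonneg hx.le]
  rw [this, lintegral_gamma_pow ha]
  exact ENNReal.ofReal_lt_top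

theorem integral_gamma_pow (ha : 0 < a) (k : ℕ) :
    ∫ x, x ^ k ∂gammaMeasure a 1 = ∏ i ∈ Finset.range k, (a + i) := by
  rw [integral_eq_lintegral_of_nonneg_ae _ (by fun_prop)]
  · have : ∫⁻ x, ENNReal.ofReal (x ^ k) ∂gammaMeasure a 1
        = ∫⁻ x, ENNReal.ofReal x ^ k ∂gammaMeasure a 1 := by
      refine lintegral_congr_ae ?_
      filter_upwards [gamma_ae_pos] with x hx
      rw [ENNReal.ofReal_pow hx.le]
    rw [this, lintegral_gamma_pow ha, ENNReal.toReal_ofReal]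
    exact Finset.prod_nonneg fun i _ => by positivity
  · filter_upwards [gamma_ae_pos] with x hx
    exact pow_nonneg hx.le k

theorem integrable_gamma_sub_pow (ha : 0 < a) (b : ℝ) (k : ℕ) :
    Integrable (fun x => (x - b) ^ k) (gammaMeasure a 1) := by
  simp_rw [sub_eq_add_neg, add_pow]
  exact integrable_finsetSum _ fun m _ => by
    simpa only [mul_assoc] using (integrable_gamma_pow ha m).mul_const _

theorem integral_gamma_sub_pow (ha : 0 < a) (b : ℝ) (k : ℕ) :
    ∫ x, (x - b) ^ k ∂gammaMeasure a 1 = ∑ m ∈ Finset.range (k + 1),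
      (∏ i ∈ Finset.range m, (a + i)) * (-b) ^ (k - m) * (k.choose m) := by
  simp_rw [sub_eq_add_neg, add_pow]
  rw [integral_finsetSum]
  · refine Finset.sum_congr rfl fun m _ => ?_
    simp_rw [mul_assoc]
    rw [integral_mul_const, integral_gamma_pow ha]
  · intro m _
    simpa only [mul_assoc] using (integrable_gamma_pow ha m).mul_const _

theorem integral_gamma_sub_pow_two (ha : 0 < a) : ∫ x, (x - a) ^ 2 ∂gammaMeasure a 1 = a := by
  rw [integral_gamma_sub_pow ha]
  simp [Finset.sum_range_succ, Finset.prod_range_succ, Nat.choose]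
  ring

theorem integral_gamma_sub_pow_four (ha : 0 < a) :
    ∫ x, (x - a) ^ 4 ∂gammaMeasure a 1 = 3 * a ^ 2 + 6 * a := by
  rw [integral_gamma_sub_pow ha]
  simp [Finset.sum_range_succ, Finset.prod_range_succ, Nat.choose]
  ring

theorem integral_gamma_sub_pow_six (ha : 0 < a) :
    ∫ x, (x - a) ^ 6 ∂gammaMeasure a 1 = 15 * a ^ 3 + 130 * a ^ 2 + 120 * a := by
  rw [integral_gamma_sub_pow ha]
  simp [Finset.sum_range_succ, Finset.prod_range_succ, Nat.choose]
  ring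

theorem gamma_Ioo_pos (ha : 0 < a) {x y : ℝ} (hx : 0 ≤ x) (hxy : x < y) :
    0 < gammaMeasure a 1 (Set.Ioo x y) := by
  rw [pos_iff_ne_zero, gammaMeasure, Ne, withDensity_apply_eq_zero (by unfold gammaPDF; fun_prop)]
  have : {z | gammaPDF a 1 z ≠ 0} ∩ Set.Ioo x y = Set.Ioo x y := by
    refine Set.inter_eq_right.2 fun z hz => ?_
    have := gammaPDFReal_pos ha one_pos (hx.trans_lt hz.1)
    simpa [gammaPDF] using this
  rw [this]
  simpa using hxy

end Gamma

/-! ### Tilting of product measures, and uniqueness for Laplace transforms. -/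

section Product

variable {ι : Type*} [Fintype ι] [DecidableEq ι]

/-- Exponential tilting of independent gamma variables by the sum of a subfamily amounts to a
rescaling of this subfamily. -/
theorem lintegral_pi_gamma_tilt (a : ι → ℝ) (ha : ∀ i, 0 < a i) (A : Finset ι) {c : ℝ} (hc : 0 < c)
    (F : (ι → ℝ) → ENNReal) (hF : Measurable F) :
    ∫⁻ s, F s * ENNReal.ofReal (Real.exp ((1 - c) * ∑ i ∈ A, s i))
        ∂Measure.pi (fun i => gammaMeasure (a i) 1)
      = ENNReal.ofReal (c ^ (-∑ i ∈ A, a i)) *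
        ∫⁻ s, F (fun i => if i ∈ A then s i / c else s i)
          ∂Measure.pi (fun i => gammaMeasure (a i) 1) := by
  have hp : ∀ i, IsProbabilityMeasure (gammaMeasure (a i) 1) :=
    fun i => isProbabilityMeasure_gammaMeasure (ha i) one_pos
  set γ := Measure.pi (fun i => gammaMeasure (a i) 1) with hγ
  let g : ∀ i : ι, ℝ → ℝ := fun i x => if i ∈ A then x / c else x
  let e : ι → ℝ → ENNReal := fun i x => if i ∈ A then ENNReal.ofReal (Real.exp ((1 - c) * x)) else 1
  have hg : ∀ i, Measurable (g i) := fun i => by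
    by_cases hi : i ∈ A <;> simp only [g, hi, if_true, if_false] <;> fun_prop
  have he : ∀ i, Measurable (e i) := fun i => by
    by_cases hi : i ∈ A <;> simp only [e, hi, if_true, if_false] <;> fun_prop
  -- The factors `c ^ a i` normalize the tilted gamma laws to probability measures.
  let k : ι → ENNReal := fun i => if i ∈ A then ENNReal.ofReal (c ^ a i) else 1
  have hk : ∏ i, k i = ENNReal.ofReal (c ^ (∑ i ∈ A, a i)) := by
    simp only [k]
    rw [Finset.prod_ite_mem, Finset.univ_inter, Real.rpow_sum_of_pos hc,
      ENNReal.ofReal_prod_of_nonneg]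
    exact fun i _ => (Real.rpow_pos_of_pos hc _).le
  have hprob : ∀ i, IsProbabilityMeasure ((gammaMeasure (a i) 1).map (g i)) :=
    fun i => Measure.isProbabilityMeasure_map (hg i).aemeasurable
  -- Both sides are compared on boxes, where everything factors into the one-dimensional statement.
  have key : ((∏ i, k i) • γ.withDensity fun s => ∏ i, e i (s i))
      = Measure.pi fun i => (gammaMeasure (a i) 1).map (g i) := by
    refine (Measure.pi_eq fun s hs => ?_).symm
    rw [Measure.smul_apply, withDensity_apply _ (MeasurableSet.univ_pi hs),
      ← lintegral_indicator (MeasurableSet.univ_pi hs)]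
    have h1 : ∀ x : ι → ℝ, (Set.univ.pi s).indicator (fun s => ∏ i, e i (s i)) x
        = ∏ i, (s i).indicator (e i) (x i) := by
      intro x
      by_cases hx : x ∈ Set.univ.pi s
      · rw [Set.indicator_of_mem hx]
        exact Finset.prod_congr rfl fun i _ => (Set.indicator_of_mem (hx i trivial) _).symm
      · rw [Set.indicator_of_notMem hx]
        simp only [Set.mem_pi, Set.mem_univ, true_imp_iff, not_forall] at hx
        obtain ⟨i, hi⟩ := hx
        exact (Finset.prod_eq_zero (Finset.mem_univ i) (Set.indicator_of_notMem hi _)).symm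
    have hind : iIndepFun (fun i (x : ι → ℝ) => (s i).indicator (e i) (x i)) γ :=
      iIndepFun_pi (X := fun i => (s i).indicator (e i))
        fun i => ((he i).indicator (hs i)).aemeasurable
    rw [lintegral_congr h1, lintegral_prod_eq_prod_lintegral_of_indepFun _ _ hind
      (fun i => ((he i).indicator (hs i)).comp (measurable_pi_apply i)), smul_eq_mul,
      ← Finset.prod_mul_distrib]
    refine Finset.prod_congr rfl fun i _ => ?_
    have h2 : ∫⁻ x, (s i).indicator (e i) (x i) ∂γ
        = ∫⁻ x, (s i).indicator (e i) x ∂gammaMeasure (a i) 1 :=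
      (measurePreserving_eval (fun i => gammaMeasure (a i) 1) i).lintegral_comp
        ((he i).indicator (hs i))
    rw [h2, Measure.map_apply (hg i) (hs i)]
    by_cases hi : i ∈ A
    · simp only [k, e, g, hi, if_true]
      have h3 := lintegral_gamma_tilt (ha i) hc ((s i).indicator 1) (measurable_one.indicator (hs i))
      have h4 : ∀ x, (s i).indicator (fun x => ENNReal.ofReal (Real.exp ((1 - c) * x))) x
          = (s i).indicator 1 x * ENNReal.ofReal (Real.exp ((1 - c) * x)) := by
        intro x
        by_cases hx : x ∈ s i <;> simp [hx]
      rw [lintegral_congr h4, h3, ← mul_assoc, ← ENNReal.ofReal_mul (by positivity),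
        ← Real.rpow_add hc, add_neg_cancel, Real.rpow_zero, ENNReal.ofReal_one, one_mul]
      have h5 : ∀ x : ℝ, (s i).indicator (1 : ℝ → ENNReal) (x / c)
          = ((fun x => x / c) ⁻¹' (s i)).indicator 1 x := fun x => rfl
      rw [lintegral_congr h5, lintegral_indicator_one (by measurability)]
    · simp only [k, e, g, hi, if_false, one_mul]
      have : (s i).indicator (fun _ => (1 : ENNReal)) = (s i).indicator 1 := rfl
      rw [this, lintegral_indicator_one (hs i)]
      rfl
  have hmap : γ.map (fun s i => g i (s i)) = Measure.pi fun i => (gammaMeasure (a i) 1).map (g i) := by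
    rw [hγ]
    exact Measure.pi_map_pi (fun i => (hg i).aemeasurable)
  have h6 : ∫⁻ s, F (fun i => if i ∈ A then s i / c else s i) ∂γ
      = ∫⁻ s, F s ∂(γ.map (fun s i => g i (s i))) := by
    have hm : Measurable fun (s : ι → ℝ) i => g i (s i) :=
      measurable_pi_lambda _ fun i => (hg i).comp (measurable_pi_apply i)
    rw [lintegral_map hF hm]
  have hem : Measurable fun s : ι → ℝ => ∏ i, e i (s i) :=
    Finset.measurable_prod _ fun i _ => (he i).comp (measurable_pi_apply i)
  rw [h6, hmap, ← key, lintegral_smul_measure, hk, smul_eq_mul, ← mul_assoc,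
    ← ENNReal.ofReal_mul (by positivity), ← Real.rpow_add hc, neg_add_cancel, Real.rpow_zero,
    ENNReal.ofReal_one, one_mul, lintegral_withDensity_eq_lintegral_mul _ hem hF]
  refine lintegral_congr fun s => ?_
  rw [Pi.mul_apply, mul_comm]
  congr 1
  simp only [e]
  rw [Finset.prod_ite_mem, Finset.univ_inter, Finset.mul_sum, Real.exp_sum,
    ENNReal.ofReal_prod_of_nonneg]
  exact fun i _ => (Real.exp_pos _).le

end Product

/-- Two finite measures on the line whose Laplace transforms are finite and agree near `0` and to
the left of it are equal. -/
theorem ext_of_lintegral_exp {μ ν : Measure ℝ} [IsFiniteMeasure μ] [IsFiniteMeasure ν]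
    (h : ∀ t < 1, ∫⁻ x, ENNReal.ofReal (Real.exp (t * x)) ∂μ
      = ∫⁻ x, ENNReal.ofReal (Real.exp (t * x)) ∂ν)
    (hfin : ∀ t < 1, ∫⁻ x, ENNReal.ofReal (Real.exp (t * x)) ∂μ ≠ ⊤) : μ = ν := by
  have hint : ∀ ρ : Measure ℝ, (∀ t < 1, ∫⁻ x, ENNReal.ofReal (Real.exp (t * x)) ∂ρ ≠ ⊤) →
      {z : ℂ | z.re < 1} ⊆ {z | z.re ∈ interior (integrableExpSet id ρ)} := by
    intro ρ hρ z hz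
    refine interior_maximal ?_ isOpen_Iio hz
    intro t ht
    refine ⟨by fun_prop, ?_⟩
    rw [hasFiniteIntegral_iff_ofReal (ae_of_all _ fun x => (Real.exp_pos _).le)]
    exact (hρ t ht).lt_top
  have hμ := hint μ hfin
  have hν := hint ν fun t ht => by rw [← h t ht]; exact hfin t ht
  -- Both transforms are analytic on `Re z < 1` and agree at the real points near `0`. By the
  -- identity theorem they agree on the imaginary axis as well, where they are the characteristic
  -- functions.
  have hEq : Set.EqOn (complexMGF id μ) (complexMGF id ν) {z | z.re < 1} := by
    refine AnalyticOnNhd.eqOn_of_preconnected_of_frequently_eq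
      (analyticOnNhd_complexMGF.mono hμ) (analyticOnNhd_complexMGF.mono hν)
      (convex_halfSpace_re_lt 1).isPreconnected (z₀ := 0) (by simp) ?_
    have hlt : ∀ᶠ x : ℝ in 𝓝[≠] 0, x < 1 :=
      eventually_nhdsWithin_of_eventually_nhds (eventually_lt_nhds one_pos)
    have hreal : ∃ᶠ x : ℝ in 𝓝[≠] 0, complexMGF id μ x = complexMGF id ν x := by
      refine (hlt.mono fun x hx => ?_).frequently
      rw [complexMGF_ofReal, complexMGF_ofReal]
      congr 1
      simp only [mgf, id]
      rw [integral_eq_lintegral_of_nonneg_ae (ae_of_all _ fun x => (Real.exp_pos _).le)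
        (by fun_prop), integral_eq_lintegral_of_nonneg_ae
        (ae_of_all _ fun x => (Real.exp_pos _).le) (by fun_prop), h x hx]
    have ht : Tendsto (fun x : ℝ => (x : ℂ)) (𝓝[≠] 0) (𝓝[≠] 0) := by
      refine tendsto_nhdsWithin_iff.2 ⟨?_, ?_⟩
      · have := (Complex.continuous_ofReal.tendsto 0).mono_left
          (nhdsWithin_le_nhds (s := {(0 : ℝ)}ᶜ))
        simpa using this
      · filter_upwards [self_mem_nhdsWithin] with x hx
        simpa using hx
    exact ht.frequently hreal
  refine Measure.ext_of_charFun ?_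
  ext t
  rw [← complexMGF_id_mul_I, ← complexMGF_id_mul_I]
  exact hEq (by simp)

/-! ### The model of the sample given `T_n = n`. -/

/-- The law of the block counts: `ν` with `∑ (j + 1) ν_j = n` has probability `weight ν`. -/
noncomputable def cycleLaw (n : ℕ) : Measure (Fin n → ℕ) :=
  ∑ ν ∈ parts n n, ENNReal.ofReal (weight ν) • Measure.dirac ν

/-- An array of independent gamma variables, of shape `j + 1` in row `j`. -/
noncomputable def gammaArray (n : ℕ) : Measure (Fin n × Fin n → ℝ) :=
  Measure.pi fun p => gammaMeasure (((p.1 : ℕ) + 1 : ℕ) : ℝ) 1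

/-- The joint law of the block counts and the gamma variables given `T_n = n`. -/
noncomputable def model (n : ℕ) : Measure ((Fin n → ℕ) × (Fin n × Fin n → ℝ)) :=
  (cycleLaw n).prod (gammaArray n)

instance (n : ℕ) : IsProbabilityMeasure (cycleLaw n) := by
  refine ⟨?_⟩
  simp only [cycleLaw, Measure.coe_finsetSum, Finset.sum_apply, Measure.smul_apply, measure_univ,
    smul_eq_mul, mul_one]
  rw [← ENNReal.ofReal_sum_of_nonneg fun _ _ => weight_nonneg _, sum_weight le_rfl,
    ENNReal.ofReal_one]

instance (j : ℕ) : IsProbabilityMeasure (gammaMeasure ((j + 1 : ℕ) : ℝ) 1) :=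
  isProbabilityMeasure_gammaMeasure (by positivity) one_pos

instance (n : ℕ) : IsProbabilityMeasure (gammaArray n) := by
  unfold gammaArray
  infer_instance

instance (n : ℕ) : IsProbabilityMeasure (model n) := by
  unfold model
  infer_instance

theorem lintegral_model {n : ℕ} {f : (Fin n → ℕ) × (Fin n × Fin n → ℝ) → ENNReal}
    (hf : Measurable f) :
    ∫⁻ x, f x ∂model n
      = ∑ ν ∈ parts n n, ENNReal.ofReal (weight ν) * ∫⁻ s, f (ν, s) ∂gammaArray n := by
  rw [model, lintegral_prod _ hf.aemeasurable, cycleLaw, lintegral_finsetSum_measure]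
  refine Finset.sum_congr rfl fun ν _ => ?_
  rw [lintegral_smul_measure, lintegral_dirac, smul_eq_mul]

theorem integral_model {n : ℕ} {f : (Fin n → ℕ) × (Fin n × Fin n → ℝ) → ℂ}
    (hf : Integrable f (model n)) :
    ∫ x, f x ∂model n = ∑ ν ∈ parts n n, (weight ν : ℂ) * ∫ s, f (ν, s) ∂gammaArray n := by
  rw [model, integral_prod _ hf, cycleLaw, integral_finsetSum_measure]
  · refine Finset.sum_congr rfl fun ν _ => ?_
    rw [integral_smul_measure, integral_dirac, ENNReal.toReal_ofReal (weight_nonneg ν)]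
    simp
  · intro ν _
    refine Integrable.smul_measure ?_ ENNReal.ofReal_ne_top
    exact integrable_dirac (by simp)

theorem ae_model_of_forall {n : ℕ} {p : (Fin n → ℕ) → (Fin n × Fin n → ℝ) → Prop}
    (h : ∀ ν ∈ parts n n, ∀ᵐ s ∂gammaArray n, p ν s) : ∀ᵐ x ∂model n, p x.1 x.2 := by
  have h1 : ∀ᵐ ν ∂cycleLaw n, ν ∈ parts n n := by
    rw [ae_iff]
    simp only [cycleLaw, Measure.coe_finsetSum, Finset.sum_apply, Measure.smul_apply, smul_eq_mul]
    refine Finset.sum_eq_zero fun ν hν => ?_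
    rw [Measure.dirac_apply' _ (Set.to_countable _).measurableSet]
    simp [hν]
  have h2 : ∀ᵐ s ∂gammaArray n, ∀ ν ∈ parts n n, p ν s := by
    exact (ae_ball_iff (parts n n).countable_toSet).2 h
  have h3 : ∀ᵐ x ∂model n, x.1 ∈ parts n n :=
    Measure.quasiMeasurePreserving_fst.ae h1
  have h4 : ∀ᵐ x ∂model n, ∀ ν ∈ parts n n, p ν x.2 :=
    Measure.quasiMeasurePreserving_snd.ae h2
  filter_upwards [h3, h4] with x hx1 hx2 using hx2 _ hx1

theorem ae_model_mem_parts (n : ℕ) : ∀ᵐ x ∂model n, x.1 ∈ parts n n :=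
  ae_model_of_forall (p := fun ν _ => ν ∈ parts n n) fun _ hν => ae_of_all _ fun _ => hν

theorem ae_gammaArray_pos (n : ℕ) : ∀ᵐ s ∂gammaArray n, ∀ p, 0 < s p := by
  rw [ae_all_iff]
  intro p
  exact (Measure.quasiMeasurePreserving_eval _ p).ae (gamma_ae_pos)

theorem ae_model_pos (n : ℕ) : ∀ᵐ x ∂model n, ∀ p, 0 < x.2 p :=
  ae_model_of_forall (p := fun _ s => ∀ p, 0 < s p) fun _ _ => ae_gammaArray_pos n

/-- The positions of the array that are used when there are `ν_j` blocks of size `j + 1`. -/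
def active {n : ℕ} (ν : Fin n → ℕ) : Finset (Fin n × Fin n) :=
  Finset.univ.filter fun p => (p.2 : ℕ) < ν p.1

/-- This is why an `n × n` array suffices: no count exceeds `n`, so no block falls outside the
array. -/
theorem apply_le_of_mem_parts {n : ℕ} {ν : Fin n → ℕ} (hν : ν ∈ parts n n) (j : Fin n) :
    ν j ≤ n := by
  have := le_of_sum_eq (mem_parts.1 hν) j
  nlinarith [Nat.zero_le ((j : ℕ) * ν j)]

theorem prod_active {M : Type*} [CommMonoid M] {n : ℕ} {ν : Fin n → ℕ} (hν : ν ∈ parts n n)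
    (g : Fin n → M) : ∏ p ∈ active ν, g p.1 = ∏ j, g j ^ ν j := by
  rw [active, Finset.prod_filter, Fintype.prod_prod_type]
  refine Finset.prod_congr rfl fun j _ => ?_
  rw [← Finset.prod_filter]
  dsimp only
  rw [Finset.prod_const, Fin.card_filter_val_lt, min_eq_right (apply_le_of_mem_parts hν j)]

theorem sum_active {M : Type*} [AddCommMonoid M] {n : ℕ} {ν : Fin n → ℕ} (hν : ν ∈ parts n n)
    (g : Fin n → M) : ∑ p ∈ active ν, g p.1 = ∑ j, ν j • g j :=
  prod_active (M := Multiplicative M) hν g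

theorem sum_active_shape {n : ℕ} {ν : Fin n → ℕ} (hν : ν ∈ parts n n) :
    ∑ p ∈ active ν, (((p.1 : ℕ) + 1 : ℕ) : ℝ) = n := by
  rw [sum_active hν fun j : Fin n => (((j : ℕ) + 1 : ℕ) : ℝ)]
  have := congrArg (fun x : ℕ => (x : ℝ)) (mem_parts.1 hν)
  rw [← this]
  push_cast
  refine Finset.sum_congr rfl fun j _ => ?_
  rw [nsmul_eq_mul, mul_comm]

/-- The sum of `F (j, S_{ji})` over all blocks. -/
def arraySum {M : Type*} [AddCommMonoid M] {n : ℕ} (F : ℕ → ℝ → M)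
    (x : (Fin n → ℕ) × (Fin n × Fin n → ℝ)) : M :=
  ∑ p ∈ active x.1, F ((p.1 : ℕ) + 1) (x.2 p)

/-- The count vectors form a countable space, so measurability may be checked with the counts fixed,
where the set of active positions does not vary. -/
theorem measurable_of_forall_fst {n : ℕ} {β γ : Type*} [MeasurableSpace β] [MeasurableSpace γ]
    {f : (Fin n → ℕ) × β → γ} (hf : ∀ ν, Measurable fun s => f (ν, s)) : Measurable f :=
  measurable_from_prod_countable_right hf

theorem measurable_arraySum {M : Type*} [AddCommMonoid M] [MeasurableSpace M] [MeasurableAdd₂ M]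
    {n : ℕ} {F : ℕ → ℝ → M} (hF : ∀ j, Measurable (F j)) :
    Measurable (arraySum (n := n) F) := by
  refine measurable_of_forall_fst fun ν => ?_
  exact Finset.measurable_sum (active ν)
    (f := fun p (s : Fin n × Fin n → ℝ) => F ((p.1 : ℕ) + 1) (s p))
    fun p _ => (hF _).comp (measurable_pi_apply p)

theorem lintegral_gammaArray_eval {n : ℕ} (p : Fin n × Fin n) {f : ℝ → ENNReal}
    (hf : Measurable f) :
    ∫⁻ s, f (s p) ∂gammaArray n = ∫⁻ x, f x ∂gammaMeasure (((p.1 : ℕ) + 1 : ℕ) : ℝ) 1 :=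
  (measurePreserving_eval (fun p : Fin n × Fin n => gammaMeasure (((p.1 : ℕ) + 1 : ℕ) : ℝ) 1)
    p).lintegral_comp hf

/-- The mean of a sum over all blocks given `T_n = n`. -/
theorem lintegral_arraySum {n : ℕ} {F : ℕ → ℝ → ENNReal} (hF : ∀ j, Measurable (F j)) :
    ∫⁻ x, arraySum F x ∂model n = ∑ j ∈ Finset.range n, ENNReal.ofReal (1 / ((j : ℝ) + 1)) *
      ∫⁻ x, F (j + 1) x ∂gammaMeasure ((j + 1 : ℕ) : ℝ) 1 := by
  rw [lintegral_model (measurable_arraySum hF), ← Fin.sum_univ_eq_sum_range (fun j =>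
    ENNReal.ofReal (1 / ((j : ℝ) + 1)) * ∫⁻ x, F (j + 1) x ∂gammaMeasure ((j + 1 : ℕ) : ℝ) 1)]
  have h1 : ∀ ν ∈ parts n n, ENNReal.ofReal (weight ν) * ∫⁻ s, arraySum F (ν, s) ∂gammaArray n
      = ∑ j : Fin n, ENNReal.ofReal (weight ν * ν j) *
        ∫⁻ x, F ((j : ℕ) + 1) x ∂gammaMeasure (((j : ℕ) + 1 : ℕ) : ℝ) 1 := by
    intro ν hν
    simp only [arraySum]
    rw [lintegral_finsetSum (active ν) (f := fun p (s : Fin n × Fin n → ℝ) => F ((p.1 : ℕ) + 1) (s p))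
        fun p _ => (hF _).comp (measurable_pi_apply p),
      Finset.sum_congr rfl fun p _ => lintegral_gammaArray_eval p (hF ((p.1 : ℕ) + 1)),
      sum_active hν fun j : Fin n =>
        ∫⁻ x, F ((j : ℕ) + 1) x ∂gammaMeasure (((j : ℕ) + 1 : ℕ) : ℝ) 1, Finset.mul_sum]
    refine Finset.sum_congr rfl fun j _ => ?_
    rw [ENNReal.ofReal_mul (weight_nonneg ν), ENNReal.ofReal_natCast, nsmul_eq_mul, mul_assoc]
  rw [Finset.sum_congr rfl h1, Finset.sum_comm]
  refine Finset.sum_congr rfl fun j _ => ?_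
  rw [← Finset.sum_mul, ← ENNReal.ofReal_sum_of_nonneg, sum_weight_mul_apply_eq]
  exact fun ν _ => mul_nonneg (weight_nonneg ν) (Nat.cast_nonneg _)

/-- The mean of a product over all blocks given `T_n = n`. -/
theorem integral_prod_active {n : ℕ} {e : ℕ → ℝ → ℂ} (he : ∀ j, Measurable (e j))
    (hb : ∀ j x, ‖e j x‖ ≤ 1) :
    ∫ x, ∏ p ∈ active x.1, e ((p.1 : ℕ) + 1) (x.2 p) ∂model n
      = ∑ ν ∈ parts n n, (weight ν : ℂ) *
        ∏ j : Fin n, (∫ x, e ((j : ℕ) + 1) x ∂gammaMeasure (((j : ℕ) + 1 : ℕ) : ℝ) 1) ^ ν j := by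
  rw [integral_model]
  · refine Finset.sum_congr rfl fun ν hν => ?_
    rw [← prod_active hν fun j : Fin n =>
      ∫ x, e ((j : ℕ) + 1) x ∂gammaMeasure (((j : ℕ) + 1 : ℕ) : ℝ) 1]
    congr 1
    have h1 : ∀ s : Fin n × Fin n → ℝ, ∏ p ∈ active ν, e ((p.1 : ℕ) + 1) (s p)
        = ∏ p, (if p ∈ active ν then e ((p.1 : ℕ) + 1) else fun _ => 1) (s p) := by
      intro s
      rw [← Finset.prod_subset (Finset.subset_univ (active ν))]
      · exact Finset.prod_congr rfl fun p hp => by simp [hp]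
      · intro p _ hp
        simp [hp]
    simp only [h1]
    rw [gammaArray, integral_fintype_prod_eq_prod (f := fun p : Fin n × Fin n =>
      if p ∈ active ν then e ((p.1 : ℕ) + 1) else fun _ => 1)]
    symm
    rw [← Finset.prod_subset (Finset.subset_univ (active ν))]
    · exact Finset.prod_congr rfl fun p hp => by simp [hp]
    · intro p _ hp
      simp only [hp, if_false, integral_const, probReal_univ, one_smul]
  · refine Integrable.of_bound (C := 1) ?_ (ae_of_all _ fun x => ?_)
    · refine (measurable_of_forall_fst fun ν => ?_).aestronglyMeasurable
      exact Finset.measurable_prod (active ν)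
        (f := fun p (s : Fin n × Fin n → ℝ) => e ((p.1 : ℕ) + 1) (s p))
        fun p _ => (he _).comp (measurable_pi_apply p)
    · rw [norm_prod]
      exact Finset.prod_le_one (fun _ _ => norm_nonneg _) fun _ _ => hb _ _

/-! ### Independence of the total length and the normalized lengths. -/

/-- The sum of all block lengths. -/
def total {n : ℕ} (x : (Fin n → ℕ) × (Fin n × Fin n → ℝ)) : ℝ :=
  arraySum (fun _ s => s) x

/-- The block counts together with the normalized block lengths. -/
noncomputable def shape {n : ℕ} (x : (Fin n → ℕ) × (Fin n × Fin n → ℝ)) :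
    (Fin n → ℕ) × (Fin n × Fin n → ℝ) :=
  (x.1, fun p => if p ∈ active x.1 then x.2 p / total x else 0)

theorem measurable_total {n : ℕ} : Measurable (total (n := n)) :=
  measurable_arraySum fun _ => measurable_id

theorem measurable_shape {n : ℕ} : Measurable (shape (n := n)) := by
  refine measurable_of_forall_fst fun ν => ?_
  refine measurable_const.prodMk (measurable_pi_lambda _ fun p => ?_)
  have h : Measurable fun s : Fin n × Fin n → ℝ => total (ν, s) :=
    measurable_total.comp measurable_prodMk_left
  dsimp only
  split_ifs
  · exact (measurable_pi_apply p).div h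
  · exact measurable_const

/-- Tilting by the total rescales the active entries by `1 / c`, and `shape` does not notice this.
The active gamma parameters sum to `n`, so on every event for `shape` the total has the Laplace
transform of Gamma(`n`) up to the mass of the event. -/
theorem lintegral_model_tilt {n : ℕ} {B : Set ((Fin n → ℕ) × (Fin n × Fin n → ℝ))}
    (hB : MeasurableSet B) {c : ℝ} (hc : 0 < c) :
    ∫⁻ x, (shape ⁻¹' B).indicator 1 x * ENNReal.ofReal (Real.exp ((1 - c) * total x)) ∂model n
      = ENNReal.ofReal (c ^ (-(n : ℝ))) * model n (shape ⁻¹' B) := by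
  have hS := measurable_shape (n := n) hB
  rw [← lintegral_indicator_one hS, lintegral_model (measurable_one.indicator hS), lintegral_model
    (f := fun x => (shape ⁻¹' B).indicator 1 x * ENNReal.ofReal (Real.exp ((1 - c) * total x)))
    ((measurable_one.indicator hS).mul (by have := measurable_total (n := n); fun_prop)),
    Finset.mul_sum]
  refine Finset.sum_congr rfl fun ν hν => ?_
  rw [mul_left_comm]
  congr 1
  have h := lintegral_pi_gamma_tilt (fun p : Fin n × Fin n => (((p.1 : ℕ) + 1 : ℕ) : ℝ))
    (fun p => by positivity) (active ν) hc
    (fun s => (shape ⁻¹' B).indicator 1 (ν, s))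
    ((measurable_one.indicator hS).comp measurable_prodMk_left)
  rw [sum_active_shape hν] at h
  refine h.trans ?_
  congr 1
  refine lintegral_congr fun s => ?_
  have h2 : shape (ν, fun i => if i ∈ active ν then s i / c else s i) = shape (ν, s) := by
    have ht : total (ν, fun i => if i ∈ active ν then s i / c else s i) = total (ν, s) / c := by
      simp only [total, arraySum]
      rw [Finset.sum_div]
      exact Finset.sum_congr rfl fun p hp => by simp [hp]
    simp only [shape, ht]
    refine Prod.ext rfl ?_
    ext p
    by_cases hp : p ∈ active ν
    · simp only [hp, if_true]
      exact div_div_div_cancel_right₀ hc.ne' _ _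
    · simp [hp]
  have hm : (ν, fun i => if i ∈ active ν then s i / c else s i) ∈ shape ⁻¹' B
      ↔ (ν, s) ∈ shape ⁻¹' B := by
    rw [Set.mem_preimage, Set.mem_preimage, h2]
  by_cases hx : (ν, s) ∈ shape ⁻¹' B
  · rw [Set.indicator_of_mem hx, Set.indicator_of_mem (hm.2 hx)]
    rfl
  · rw [Set.indicator_of_notMem hx, Set.indicator_of_notMem fun h => hx (hm.1 h)]

/-- Given `T_n = n`, the sum of all block lengths has the Gamma(`n`) distribution and is independent
of the block counts and the normalized block lengths. -/
theorem map_total_shape {n : ℕ} (hn : 1 ≤ n) :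
    (model n).map (fun x => (total x, shape x))
      = (gammaMeasure (n : ℝ) 1).prod ((model n).map shape) := by
  have hn' : (0 : ℝ) < n := by exact_mod_cast hn
  have hpr := isProbabilityMeasure_gammaMeasure hn' one_pos
  have : IsProbabilityMeasure ((model n).map shape) :=
    Measure.isProbabilityMeasure_map measurable_shape.aemeasurable
  symm
  refine Measure.prod_eq fun C B hC hB => ?_
  rw [Measure.map_apply (measurable_total.prodMk measurable_shape) (hC.prod hB),
    Measure.map_apply measurable_shape hB]
  have hS := measurable_shape (n := n) hB
  -- Independence amounts to this: restricted to any event for `shape`, the law of the total is a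
  -- multiple of the same gamma law. Laplace transforms decide it.
  have key : ((model n).restrict (shape ⁻¹' B)).map total
      = (model n (shape ⁻¹' B)) • gammaMeasure (n : ℝ) 1 := by
    have hfin : IsFiniteMeasure ((model n (shape ⁻¹' B)) • gammaMeasure (n : ℝ) 1) :=
      Measure.smul_finite _ (measure_ne_top _ _)
    have hL : ∀ t < 1, ∫⁻ x, ENNReal.ofReal (Real.exp (t * x))
        ∂((model n).restrict (shape ⁻¹' B)).map total
        = ENNReal.ofReal ((1 - t) ^ (-(n : ℝ))) * model n (shape ⁻¹' B) := by
      intro t ht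
      rw [lintegral_map (by fun_prop) measurable_total, ← lintegral_indicator hS,
        ← lintegral_model_tilt hB (c := 1 - t) (by linarith)]
      refine lintegral_congr fun x => ?_
      rw [sub_sub_cancel]
      by_cases hx : x ∈ shape ⁻¹' B <;> simp [hx]
    refine ext_of_lintegral_exp (fun t ht => ?_) (fun t ht => ?_)
    · rw [hL t ht, lintegral_smul_measure, smul_eq_mul, mul_comm]
      congr 1
      have := lintegral_gamma_tilt hn' (c := 1 - t) (by linarith) (fun _ => 1) measurable_const
      simpa using this.symm
    · rw [hL t ht]
      exact ENNReal.mul_ne_top ENNReal.ofReal_ne_top (measure_ne_top _ _)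
  have h := congrArg (fun m => m C) key
  simp only [Measure.smul_apply, smul_eq_mul] at h
  rw [Measure.map_apply measurable_total hC, Measure.restrict_apply (measurable_total hC)] at h
  rw [mul_comm, ← h]
  rfl

/-! ### Taylor expansion of the summand. -/

theorem isOpen_rightHalfPlane : IsOpen {z : ℂ | 0 < z.re} :=
  isOpen_lt continuous_const Complex.continuous_re

/-- A function which is complex differentiable on an open set has a second order Taylor expansion
at each point, with a cubic remainder term whose coefficient is continuous. -/
theorem exists_taylor_two {h : ℂ → ℂ} {s : Set ℂ} (hs : IsOpen s) (hh : DifferentiableOn ℂ h s)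
    {c : ℂ} (hc : c ∈ s) : ∃ d : ℂ → ℂ, ContinuousOn d s ∧ ∀ z,
      h z = h c + deriv h c * (z - c) + deriv (deriv h) c / 2 * (z - c) ^ 2 + d z * (z - c) ^ 3 := by
  have hn : s ∈ 𝓝 c := hs.mem_nhds hc
  have h1 : DifferentiableOn ℂ (dslope h c) s := (Complex.differentiableOn_dslope hn).2 hh
  have h2 : DifferentiableOn ℂ (dslope (dslope h c) c) s :=
    (Complex.differentiableOn_dslope hn).2 h1
  have h3 : DifferentiableOn ℂ (dslope (dslope (dslope h c) c) c) s :=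
    (Complex.differentiableOn_dslope hn).2 h2
  have e : ∀ (f : ℂ → ℂ) (z : ℂ), f z = f c + (z - c) * dslope f c z := fun f z => by
    have := sub_smul_dslope f c z
    rw [smul_eq_mul] at this
    rw [this]
    ring
  refine ⟨_, h3.continuousOn, fun z => ?_⟩
  -- Differentiating `h z = h c + (z - c) * dslope h c z` twice at `c` leaves twice the derivative
  -- of `dslope h c`.
  have hd : deriv (deriv h) c = 2 * deriv (dslope h c) c := by
    have hev : deriv h =ᶠ[𝓝 c] fun z => dslope h c z + (z - c) * deriv (dslope h c) z := by
      filter_upwards [hn] with z hz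
      have hz' : HasDerivAt (dslope h c) (deriv (dslope h c) z) z :=
        (h1.differentiableAt (hs.mem_nhds hz)).hasDerivAt
      have : HasDerivAt (fun z => h c + (z - c) * dslope h c z)
          (1 * dslope h c z + (z - c) * deriv (dslope h c) z) z :=
        (((hasDerivAt_id z).sub_const c).mul hz').const_add _
      rw [show h = fun z => h c + (z - c) * dslope h c z from funext (e h)]
      rw [← funext (e h)] at this ⊢
      rw [this.deriv, one_mul]
    rw [hev.deriv_eq]
    have hd1 : HasDerivAt (dslope h c) (deriv (dslope h c) c) c :=
      (h1.differentiableAt hn).hasDerivAt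
    have hd2 : HasDerivAt (deriv (dslope h c)) (deriv (deriv (dslope h c)) c) c :=
      ((h1.deriv hs).differentiableAt hn).hasDerivAt
    have := hd1.add (((hasDerivAt_id c).sub_const c).mul hd2)
    have h4 := this.deriv
    simp only [id, sub_self, zero_mul, add_zero, one_mul] at h4
    rw [two_mul, ← h4]
    rfl
  have e1 := e h z
  have e2 := e (dslope h c) z
  have e3 := e (dslope (dslope h c) c) z
  rw [dslope_same] at e2 e3
  rw [hd, e1, e2, e3]
  ring

/-- The restriction of the real part of `h` to the positive half line, extended by zero. -/
noncomputable def realPart (h : ℂ → ℂ) : ℝ → ℝ :=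
  (Set.Ioi 0).indicator fun x => (h (x : ℂ)).re

theorem realPart_of_pos (h : ℂ → ℂ) {x : ℝ} (hx : 0 < x) : realPart h x = (h (x : ℂ)).re :=
  Set.indicator_of_mem (Set.mem_Ioi.2 hx) _

theorem IsAdmissible.continuousOn_re {h : ℂ → ℂ} (hh : IsAdmissible h) :
    ContinuousOn (fun x : ℝ => (h (x : ℂ)).re) (Set.Ioi 0) :=
  Complex.continuous_re.comp_continuousOn
    (hh.analytic.continuousOn.comp Complex.continuous_ofReal.continuousOn fun x hx => by
      simpa using hx)

theorem IsAdmissible.continuousOn_realPart {h : ℂ → ℂ} (hh : IsAdmissible h) :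
    ContinuousOn (realPart h) (Set.Ioi 0) :=
  hh.continuousOn_re.congr fun _ hx => realPart_of_pos h hx

/-- The extension by zero serves this purpose: off the half plane `h` is arbitrary and need not be
measurable. -/
theorem IsAdmissible.measurable_realPart {h : ℂ → ℂ} (hh : IsAdmissible h) :
    Measurable (realPart h) := by
  classical
  have := hh.continuousOn_re.measurable_piecewise (g := 0) continuous_zero.continuousOn
    measurableSet_Ioi
  rwa [Set.piecewise_eq_indicator] at this

theorem im_deriv_eq_zero {f : ℂ → ℂ} (hf : DifferentiableOn ℂ f {z : ℂ | 0 < z.re})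
    (hreal : ∀ x : ℝ, 0 < x → (f x).im = 0) (x : ℝ) (hx : 0 < x) : (deriv f x).im = 0 := by
  have h1 : HasDerivAt f (deriv f x) (x : ℂ) :=
    (hf.differentiableAt (isOpen_rightHalfPlane.mem_nhds (by simpa using hx))).hasDerivAt
  have h2 := h1.comp_ofReal
  have h3 : HasDerivAt (fun y : ℝ => (f y).im) (deriv f x).im x :=
    Complex.imCLM.hasFDerivAt.comp_hasDerivAt x h2
  have h4 : (fun y : ℝ => (f y).im) =ᶠ[𝓝 x] fun _ => 0 := by
    filter_upwards [lt_mem_nhds hx] with y hy using hreal y hy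
  rw [← h3.deriv, h4.deriv_eq, deriv_const]

theorem IsAdmissible.re_deriv_two_ne_zero {h : ℂ → ℂ} (hh : IsAdmissible h) :
    (deriv (deriv h) 1).re ≠ 0 := by
  have h1 := im_deriv_eq_zero hh.analytic hh.real_on_pos
  have h2 := im_deriv_eq_zero (hh.analytic.deriv isOpen_rightHalfPlane) h1 1 one_pos
  intro h0
  exact hh.deriv_two_ne_zero (Complex.ext h0 (by simpa using h2))

theorem IsAdmissible.im_deriv_one {h : ℂ → ℂ} (hh : IsAdmissible h) : (deriv h 1).im = 0 := by
  simpa using im_deriv_eq_zero hh.analytic hh.real_on_pos 1 one_pos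

theorem IsAdmissible.im_deriv_two {h : ℂ → ℂ} (hh : IsAdmissible h) :
    (deriv (deriv h) 1).im = 0 := by
  simpa using im_deriv_eq_zero (hh.analytic.deriv isOpen_rightHalfPlane)
    (im_deriv_eq_zero hh.analytic hh.real_on_pos) 1 one_pos

theorem IsAdmissible.exists_taylor_bound {h : ℂ → ℂ} (hh : IsAdmissible h) :
    ∃ C, 0 ≤ C ∧ ∀ r ∈ Set.Icc (1 / 2 : ℝ) 2, |realPart h r - (h 1).re - (deriv h 1).re * (r - 1)
      - (deriv (deriv h) 1).re / 2 * (r - 1) ^ 2| ≤ C * |r - 1| ^ 3 := by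
  obtain ⟨d, hd, he⟩ := exists_taylor_two isOpen_rightHalfPlane hh.analytic (c := 1) (by simp)
  have hc : ContinuousOn (fun x : ℝ => d x) (Set.Icc (1 / 2) 2) :=
    hd.comp Complex.continuous_ofReal.continuousOn fun x hx => by
      have := hx.1
      simp only [Set.mem_ofPred_eq, Complex.ofReal_re]
      linarith
  obtain ⟨C, hC⟩ := isCompact_Icc.exists_bound_of_continuousOn hc
  refine ⟨max C 0, le_max_right _ _, fun r hr => ?_⟩
  have hr0 : 0 < r := by have := hr.1; linarith
  have e := congrArg Complex.re (he r)
  have e1 : ((r : ℂ) - 1) = ((r - 1 : ℝ) : ℂ) := by push_cast; ring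
  have e2 : deriv h 1 = (((deriv h 1).re : ℝ) : ℂ) :=
    Complex.ext rfl (by simpa using hh.im_deriv_one)
  have e3 : deriv (deriv h) 1 = (((deriv (deriv h) 1).re : ℝ) : ℂ) :=
    Complex.ext rfl (by simpa using hh.im_deriv_two)
  have hval : realPart h r - (h 1).re - (deriv h 1).re * (r - 1)
      - (deriv (deriv h) 1).re / 2 * (r - 1) ^ 2 = (d r).re * (r - 1) ^ 3 := by
    rw [realPart_of_pos h hr0, e, e1, e2, e3]
    have f2 : (((deriv (deriv h) 1).re : ℝ) : ℂ) / 2 * ((r - 1 : ℝ) : ℂ) ^ 2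
        = (((deriv (deriv h) 1).re / 2 * (r - 1) ^ 2 : ℝ) : ℂ) := by push_cast; ring
    have f3 : ((r - 1 : ℝ) : ℂ) ^ 3 = (((r - 1) ^ 3 : ℝ) : ℂ) := by push_cast; ring
    rw [f2, f3, Complex.add_re, Complex.add_re, Complex.add_re, ← Complex.ofReal_mul,
      Complex.ofReal_re, Complex.ofReal_re, Complex.ofReal_re, Complex.ofReal_re,
      Complex.re_mul_ofReal]
    ring
  rw [hval, abs_mul, abs_pow]
  gcongr
  exact ((Complex.abs_re_le_norm _).trans (hC r hr)).trans (le_max_left _ _)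

/-- The summand `(h(j / s) - h(1)) s + h'(1) (s - j)` of the statistic. -/
noncomputable def blockTerm (h : ℂ → ℂ) (j : ℕ) (s : ℝ) : ℝ :=
  (realPart h (j / s) - (h 1).re) * s + (deriv h 1).re * (s - j)

/-- The difference of the summand and its quadratic approximation. -/
noncomputable def residual (h : ℂ → ℂ) (j : ℕ) (s : ℝ) : ℝ :=
  blockTerm h j s - (deriv (deriv h) 1).re / 2 * ((s - j) ^ 2 / j)

theorem IsAdmissible.measurable_blockTerm {h : ℂ → ℂ} (hh : IsAdmissible h) (j : ℕ) :
    Measurable (blockTerm h j) := by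
  have := hh.measurable_realPart
  unfold blockTerm
  fun_prop

theorem IsAdmissible.continuousOn_blockTerm {h : ℂ → ℂ} (hh : IsAdmissible h) {j : ℕ}
    (hj : 1 ≤ j) : ContinuousOn (blockTerm h j) (Set.Ioi 0) := by
  have hj' : (0 : ℝ) < j := by exact_mod_cast hj
  have h1 : ContinuousOn (fun s : ℝ => (j : ℝ) / s) (Set.Ioi 0) :=
    continuousOn_const.div continuousOn_id fun x hx => (Set.mem_Ioi.1 hx).ne'
  have h2 := hh.continuousOn_realPart.comp h1 fun x hx => Set.mem_Ioi.2 (div_pos hj' hx)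
  exact ((h2.sub continuousOn_const).mul continuousOn_id).add
    (continuousOn_const.mul (continuousOn_id.sub continuousOn_const))

theorem IsAdmissible.continuousOn_residual {h : ℂ → ℂ} (hh : IsAdmissible h) {j : ℕ}
    (hj : 1 ≤ j) : ContinuousOn (residual h j) (Set.Ioi 0) := by
  refine (hh.continuousOn_blockTerm hj).sub (Continuous.continuousOn ?_)
  fun_prop

/-- With `r = j / s`, the linear Taylor term times `s` is `h'(1) (j - s)` and cancels. The quadratic
one is `b / 2 * (s - j)^2 / s`, and replacing `1 / s` by `1 / j` costs a cubic term; the Taylor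
remainder gives `|s - j|^3 / s^2`. As `s` is at least `j / 2`, both have the stated order. -/
theorem IsAdmissible.exists_residual_bound {h : ℂ → ℂ} (hh : IsAdmissible h) :
    ∃ C, 0 ≤ C ∧ ∀ j : ℕ, 1 ≤ j → ∀ s ∈ Set.Icc ((j : ℝ) / 2) (2 * j),
      |residual h j s| ≤ C * (|s - j| ^ 3 / j ^ 2) := by
  obtain ⟨C, hC0, hC⟩ := hh.exists_taylor_bound
  set b := (deriv (deriv h) 1).re with hb
  refine ⟨4 * C + |b|, by positivity, fun j hj s hs => ?_⟩
  have hj' : (0 : ℝ) < j := by exact_mod_cast hj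
  have hs0 : 0 < s := lt_of_lt_of_le (by positivity) hs.1
  have hr : (j : ℝ) / s ∈ Set.Icc (1 / 2 : ℝ) 2 := by
    constructor
    · rw [le_div_iff₀ hs0]
      linarith [hs.2]
    · rw [div_le_iff₀ hs0]
      linarith [hs.1]
  have hT := hC _ hr
  set g := realPart h (j / s) - (h 1).re - (deriv h 1).re * (j / s - 1)
      - b / 2 * (j / s - 1) ^ 2 with hg
  have e : residual h j s = s * g + b / 2 * ((s - j) ^ 2 * (j - s) / (s * j)) := by
    simp only [residual, blockTerm, hg, ← hb]
    field_simp
    ring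
  have h1 : |s * g| ≤ 4 * C * (|s - j| ^ 3 / j ^ 2) := by
    rw [abs_mul, abs_of_pos hs0]
    have h2 : |(j : ℝ) / s - 1| = |s - j| / s := by
      rw [abs_sub_comm s, ← abs_of_pos hs0, ← abs_div, abs_of_pos hs0]
      congr 1
      field_simp
    rw [h2] at hT
    calc s * |g| ≤ s * (C * (|s - j| / s) ^ 3) := by gcongr
      _ = C * |s - j| ^ 3 * (1 / s ^ 2) := by field_simp
      _ ≤ C * |s - j| ^ 3 * (4 / j ^ 2) := by
        refine mul_le_mul_of_nonneg_left ?_ (by positivity)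
        rw [div_le_div_iff₀ (by positivity) (by positivity)]
        nlinarith [hs.1]
      _ = _ := by ring
  have h2 : |b / 2 * ((s - j) ^ 2 * (j - s) / (s * j))| ≤ |b| * (|s - j| ^ 3 / j ^ 2) := by
    rw [abs_mul, abs_div, abs_div, abs_mul, abs_mul, abs_pow, abs_sub_comm (j : ℝ) s,
      abs_of_pos hs0, abs_of_pos hj', abs_two]
    calc |b| / 2 * (|s - j| ^ 2 * |s - j| / (s * j))
        = |b| * |s - j| ^ 3 * (1 / (2 * s * j)) := by field_simp
      _ ≤ |b| * |s - j| ^ 3 * (1 / j ^ 2) := by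
        refine mul_le_mul_of_nonneg_left ?_ (by positivity)
        rw [div_le_div_iff₀ (by positivity) (by positivity)]
        nlinarith [hs.1]
      _ = _ := by ring
  rw [e, add_mul]
  exact (abs_add_le _ _).trans (add_le_add h1 h2)

/-- A function which is continuous on the positive half line is bounded by a measurable function,
also after rescaling of the argument by a factor between `1 / 2` and `2`. -/
theorem exists_measurable_envelope {f : ℝ → ℝ} (hf : ContinuousOn f (Set.Ioi 0)) :
    ∃ Y : ℝ → ℝ, Measurable Y ∧ (∀ s, 0 ≤ Y s) ∧
      ∀ s, 0 < s → ∀ l ∈ Set.Icc (1 / 2 : ℝ) 2, |f (l * s)| ≤ Y s := by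
  have hB : ∀ k : ℕ, ∃ B, ∀ x ∈ Set.Icc (1 / (2 * ((k : ℝ) + 1))) (2 * ((k : ℝ) + 1)), ‖f x‖ ≤ B :=
    fun k => isCompact_Icc.exists_bound_of_continuousOn
      (hf.mono fun x hx => lt_of_lt_of_le (by positivity) hx.1)
  choose B hB using hB
  -- The envelope depends on `s` only through an integer `k`, hence is measurable; `s` lies in `[1 /
  -- k, k]`, so `l * s` lies in the compact interval on which `B k` bounds `f`.
  refine ⟨fun s => |B ⌈max s s⁻¹⌉₊|, ?_, fun s => abs_nonneg _, fun s hs l hl => ?_⟩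
  · exact (measurable_from_nat (f := fun k => |B k|)).comp
      (Nat.measurable_ceil.comp (measurable_id.max measurable_inv))
  · have hk := Nat.le_ceil (max s s⁻¹)
    set k := ⌈max s s⁻¹⌉₊
    have h1 : s ≤ k := (le_max_left _ _).trans hk
    have h2 : s⁻¹ ≤ k := (le_max_right _ _).trans hk
    refine (hB k (l * s) ⟨?_, ?_⟩).trans (le_abs_self _)
    · rw [div_le_iff₀ (by positivity)]
      have h3 : 1 ≤ k * s := by
        have := mul_le_mul_of_nonneg_right h2 hs.le
        rwa [inv_mul_cancel₀ hs.ne'] at this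
      nlinarith [hl.1, mul_nonneg (sub_nonneg.2 hl.1) hs.le]
    · nlinarith [hl.2, mul_nonneg (sub_nonneg.2 hl.2) hs.le]

/-! ### Central limit theorem for the quadratic part. -/

theorem norm_prod_sub_prod_le {ι : Type*} (s : Finset ι) {f g : ι → ℂ} (hf : ∀ i ∈ s, ‖f i‖ ≤ 1)
    (hg : ∀ i ∈ s, ‖g i‖ ≤ 1) : ‖∏ i ∈ s, f i - ∏ i ∈ s, g i‖ ≤ ∑ i ∈ s, ‖f i - g i‖ := by
  induction s using Finset.cons_induction with
  | empty => simp
  | cons a s ha ih =>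
    rw [Finset.prod_cons, Finset.prod_cons, Finset.sum_cons]
    have e : f a * ∏ i ∈ s, f i - g a * ∏ i ∈ s, g i
        = (f a - g a) * ∏ i ∈ s, f i + g a * (∏ i ∈ s, f i - ∏ i ∈ s, g i) := by ring
    have h1 : ‖∏ i ∈ s, f i‖ ≤ 1 := by
      rw [norm_prod]
      exact Finset.prod_le_one (fun _ _ => norm_nonneg _)
        fun i hi => hf i (Finset.mem_cons_of_mem hi)
    have h2 := ih (fun i hi => hf i (Finset.mem_cons_of_mem hi))
      fun i hi => hg i (Finset.mem_cons_of_mem hi)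
    rw [e]
    refine (norm_add_le _ _).trans (add_le_add ?_ ?_)
    · rw [norm_mul]
      exact mul_le_of_le_one_right (norm_nonneg _) h1
    · rw [norm_mul]
      exact (mul_le_of_le_one_left (norm_nonneg _) (hg a (Finset.mem_cons_self a s))).trans h2

theorem norm_pow_sub_pow_le {a b : ℂ} (ha : ‖a‖ ≤ 1) (hb : ‖b‖ ≤ 1) (k : ℕ) :
    ‖a ^ k - b ^ k‖ ≤ k * ‖a - b‖ := by
  have := norm_prod_sub_prod_le (Finset.range k) (f := fun _ => a) (g := fun _ => b)
    (fun _ _ => ha) fun _ _ => hb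
  simpa using this

/-- The bound is global: for `|x| ≤ 1` the exponential series gives the constant `e`, and for `|x| >
1` all terms are dominated by `|x|^3`, with total constant `7 / 2`. -/
theorem norm_exp_I_sub_taylor_le (x : ℝ) :
    ‖Complex.exp (x * Complex.I) - (1 + x * Complex.I - x ^ 2 / 2)‖ ≤ 4 * |x| ^ 3 := by
  have hn : ‖(x : ℂ) * Complex.I‖ = |x| := by simp
  rcases le_or_gt |x| 1 with hx | hx
  · have h := Complex.norm_exp_sub_sum_le_norm_mul_exp ((x : ℂ) * Complex.I) 3
    have e : ∑ m ∈ Finset.range 3, ((x : ℂ) * Complex.I) ^ m / (m.factorial : ℂ)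
        = 1 + x * Complex.I - x ^ 2 / 2 := by
      simp only [Finset.sum_range_succ, Finset.range_zero, Finset.sum_empty, Nat.factorial,
        mul_pow, Complex.I_sq]
      push_cast
      ring
    rw [e, hn] at h
    refine h.trans ?_
    rw [mul_comm]
    gcongr
    have : Real.exp |x| ≤ Real.exp 1 := Real.exp_le_exp.2 hx
    linarith [Real.exp_one_lt_d9]
  · have h1 : ‖Complex.exp (x * Complex.I)‖ = 1 := Complex.norm_exp_ofReal_mul_I x
    have h2 : ‖(1 : ℂ) + x * Complex.I - x ^ 2 / 2‖ ≤ 1 + |x| + |x| ^ 2 / 2 := by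
      refine (norm_sub_le _ _).trans (add_le_add ((norm_add_le _ _).trans ?_) ?_)
      · rw [hn, norm_one]
      · simp
    refine (norm_sub_le _ _).trans ?_
    rw [h1]
    have h3 : |x| ≤ |x| ^ 3 := le_self_pow₀ hx.le (by norm_num)
    have h4 : |x| ^ 2 ≤ |x| ^ 3 := pow_le_pow_right₀ hx.le (by norm_num)
    have h5 : 1 ≤ |x| ^ 3 := one_le_pow₀ hx.le
    linarith

/-- The standardized squared deviation of a block length from its mean. -/
noncomputable def sqDev (j : ℕ) (s : ℝ) : ℝ := (s - j) ^ 2 / j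

theorem measurable_sqDev (j : ℕ) : Measurable (sqDev j) := by
  unfold sqDev
  fun_prop

theorem sqDev_nonneg (j : ℕ) (s : ℝ) : 0 ≤ sqDev j s := by
  unfold sqDev
  positivity

theorem integrable_sqDev_pow {j : ℕ} (hj : 1 ≤ j) (k : ℕ) :
    Integrable (fun s => sqDev j s ^ k) (gammaMeasure j 1) := by
  have hj' : (0 : ℝ) < j := by exact_mod_cast hj
  simp only [sqDev, div_pow, ← pow_mul]
  exact (integrable_gamma_sub_pow hj' _ _).div_const _

theorem integral_sqDev {j : ℕ} (hj : 1 ≤ j) : ∫ s, sqDev j s ∂gammaMeasure j 1 = 1 := by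
  have hj' : (0 : ℝ) < j := by exact_mod_cast hj
  simp only [sqDev]
  rw [integral_div, integral_gamma_sub_pow_two hj', div_self hj'.ne']

theorem integral_sqDev_pow_two {j : ℕ} (hj : 1 ≤ j) :
    ∫ s, sqDev j s ^ 2 ∂gammaMeasure j 1 = 3 + 6 / j := by
  have hj' : (0 : ℝ) < j := by exact_mod_cast hj
  simp only [sqDev, div_pow, ← pow_mul]
  rw [integral_div, integral_gamma_sub_pow_four hj']
  field_simp

theorem integral_sqDev_pow_three_le {j : ℕ} (hj : 1 ≤ j) :
    ∫ s, sqDev j s ^ 3 ∂gammaMeasure j 1 ≤ 265 := by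
  have hj' : (1 : ℝ) ≤ j := by exact_mod_cast hj
  simp only [sqDev, div_pow, ← pow_mul]
  rw [integral_div, integral_gamma_sub_pow_six (by linarith), div_le_iff₀ (by positivity)]
  -- The constant `265 = 15 + 130 + 120` collects the coefficients of the sixth central moment.
  have h1 : (j : ℝ) ^ 2 ≤ j ^ 3 := pow_le_pow_right₀ hj' (by norm_num)
  have h2 : (j : ℝ) ≤ j ^ 3 := le_self_pow₀ hj' (by norm_num)
  linarith

/-- The approximate common characteristic function of the `sqDev j`. -/
noncomputable def approxChar (u : ℝ) : ℂ := 1 + (u * Complex.I - 3 / 2 * u ^ 2)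

/-- This keeps the factors `(θ + k) / (k + 1)` in the unit disc, so that products can be compared by
telescoping. For small `u` the decrease of the real part outweighs the contribution `u^2` of the
imaginary part. -/
theorem norm_approxChar_add_le {u : ℝ} (hu : |u| ≤ 1 / 2) (k : ℕ) :
    ‖approxChar u + k‖ ≤ k + 1 := by
  have e : approxChar u + k = ((1 - 3 / 2 * u ^ 2 + k : ℝ) : ℂ) + (u : ℝ) * Complex.I := by
    simp only [approxChar]
    push_cast
    ring
  rw [e, Complex.norm_add_mul_I]
  refine Real.sqrt_le_iff.2 ⟨by positivity, ?_⟩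
  have h2 : u ^ 2 ≤ 1 / 4 := by
    rw [← sq_abs]
    nlinarith [abs_nonneg u]
  have hk : (0 : ℝ) ≤ k := Nat.cast_nonneg k
  nlinarith [sq_nonneg u, mul_nonneg hk (sq_nonneg u)]

/-- Second order expansion with moments `1` and `3 + 6 / j`: dropping `6 / j` costs `3 u^2 / j`, and
the remainder costs `4 |u|^3` times the third moment, whence `1060 = 4 * 265`. -/
theorem norm_charFun_sqDev_sub_le {j : ℕ} (hj : 1 ≤ j) (u : ℝ) :
    ‖∫ s, Complex.exp ((u * sqDev j s : ℝ) * Complex.I) ∂gammaMeasure j 1 - approxChar u‖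
      ≤ 3 * u ^ 2 / j + 1060 * |u| ^ 3 := by
  have hj' : (0 : ℝ) < j := by exact_mod_cast hj
  have hp := isProbabilityMeasure_gammaMeasure hj' one_pos
  have hq1 : Integrable (fun s => sqDev j s) (gammaMeasure j 1) := by
    simpa using integrable_sqDev_pow hj 1
  have hq2 := integrable_sqDev_pow hj 2
  have hq3 := integrable_sqDev_pow hj 3
  have hm := measurable_sqDev j
  have hexp : Integrable (fun s => Complex.exp ((u * sqDev j s : ℝ) * Complex.I))
      (gammaMeasure j 1) :=
    Integrable.of_bound (C := 1) (by fun_prop)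
      (ae_of_all _ fun s => (Complex.norm_exp_ofReal_mul_I _).le)
  have hc1 : Integrable (fun s => ((u * sqDev j s : ℝ) : ℂ) * Complex.I) (gammaMeasure j 1) :=
    ((hq1.const_mul u).ofReal).mul_const _
  have hc2 : Integrable (fun s => ((u * sqDev j s : ℝ) : ℂ) ^ 2 / 2) (gammaMeasure j 1) := by
    have := ((hq2.const_mul (u ^ 2)).ofReal (𝕜 := ℂ)).div_const 2
    refine this.congr (ae_of_all _ fun s => ?_)
    simp only [RCLike.ofReal_mul, RCLike.ofReal_pow, Complex.ofReal_mul]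
    simp only [Complex.coe_algebraMap]
    ring
  have hc3 : Integrable (fun s => 1 + ((u * sqDev j s : ℝ) : ℂ) * Complex.I) (gammaMeasure j 1) :=
    (integrable_const _).add hc1
  have hc4 : Integrable (fun s => 1 + ((u * sqDev j s : ℝ) : ℂ) * Complex.I
      - ((u * sqDev j s : ℝ) : ℂ) ^ 2 / 2) (gammaMeasure j 1) := hc3.sub hc2
  have hT : ∫ s, (1 + ((u * sqDev j s : ℝ) : ℂ) * Complex.I - ((u * sqDev j s : ℝ) : ℂ) ^ 2 / 2)
      ∂gammaMeasure j 1 = 1 + (u * Complex.I - (3 + 6 / j) / 2 * u ^ 2) := by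
    rw [integral_sub hc3 hc2, integral_add (integrable_const _) hc1,
      integral_mul_const, integral_complex_ofReal, integral_const_mul, integral_sqDev hj,
      integral_div]
    have : ∫ s, ((u * sqDev j s : ℝ) : ℂ) ^ 2 ∂gammaMeasure j 1 = u ^ 2 * (3 + 6 / j) := by
      have e : ∀ s, ((u * sqDev j s : ℝ) : ℂ) ^ 2 = ((u ^ 2 * sqDev j s ^ 2 : ℝ) : ℂ) := by
        intro s
        push_cast
        ring
      simp_rw [e]
      rw [integral_complex_ofReal, integral_const_mul, integral_sqDev_pow_two hj]
      push_cast
      ring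
    rw [this]
    simp
    ring
  have h1 : ‖∫ s, Complex.exp ((u * sqDev j s : ℝ) * Complex.I) ∂gammaMeasure j 1
      - (1 + (u * Complex.I - (3 + 6 / j) / 2 * u ^ 2))‖ ≤ 1060 * |u| ^ 3 := by
    rw [← hT, ← integral_sub hexp hc4]
    calc _ ≤ ∫ s, 4 * |u| ^ 3 * sqDev j s ^ 3 ∂gammaMeasure j 1 := by
          refine norm_integral_le_of_norm_le (hq3.const_mul _) (ae_of_all _ fun s => ?_)
          refine (norm_exp_I_sub_taylor_le _).trans (le_of_eq ?_)
          rw [abs_mul, abs_of_nonneg (sqDev_nonneg j s)]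
          ring
      _ = 4 * |u| ^ 3 * ∫ s, sqDev j s ^ 3 ∂gammaMeasure j 1 := integral_const_mul _ _
      _ ≤ 4 * |u| ^ 3 * 265 := by
          gcongr
          exact integral_sqDev_pow_three_le hj
      _ = _ := by ring
  have h2 : ‖(1 + (u * Complex.I - (3 + 6 / j) / 2 * u ^ 2)) - approxChar u‖ = 3 * u ^ 2 / j := by
    have : (1 + (u * Complex.I - (3 + 6 / j) / 2 * u ^ 2)) - approxChar u
        = ((-(3 * u ^ 2 / j) : ℝ) : ℂ) := by
      simp only [approxChar]
      push_cast
      ring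
    rw [this, Complex.norm_real, norm_neg, Real.norm_of_nonneg (by positivity)]
  calc _ ≤ _ := norm_sub_le_norm_sub_add_norm_sub _ (1 + (u * Complex.I - (3 + 6 / j) / 2 * u ^ 2)) _
    _ ≤ 1060 * |u| ^ 3 + 3 * u ^ 2 / j := add_le_add h1 h2.le
    _ = _ := add_comm _ _

theorem sum_one_div_sq_le (n : ℕ) : ∑ j ∈ Finset.range n, 1 / ((j : ℝ) + 1) ^ 2 ≤ 2 := by
  have h : ∀ n : ℕ, ∑ j ∈ Finset.range (n + 1), 1 / ((j : ℝ) + 1) ^ 2 ≤ 2 - 1 / ((n : ℝ) + 1) := by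
    intro n
    induction n with
    | zero => norm_num
    | succ n ih =>
      rw [Finset.sum_range_succ]
      have : 1 / (((n + 1 : ℕ) : ℝ) + 1) ^ 2 ≤ 1 / ((n : ℝ) + 1) - 1 / (((n + 1 : ℕ) : ℝ) + 1) := by
        push_cast
        rw [div_sub_div _ _ (by positivity) (by positivity), div_le_div_iff₀ (by positivity)
          (by positivity)]
        nlinarith [(Nat.cast_nonneg n : (0 : ℝ) ≤ n)]
      linarith
  refine (Finset.sum_le_sum_of_subset_of_nonneg (Finset.range_subset_range.2 (Nat.le_succ n))
    fun _ _ _ => by positivity).trans ((h n).trans ?_)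
  have : (0 : ℝ) ≤ 1 / ((n : ℝ) + 1) := by positivity
  linarith

theorem sum_one_div_eq_harmonic (n : ℕ) :
    ∑ j ∈ Finset.range n, 1 / ((j : ℝ) + 1) = (harmonic n : ℝ) := by
  rw [harmonic]
  push_cast
  simp

/-- The characteristic function of the sum of the `sqDev j` over all blocks is close to an explicit
product. -/
theorem norm_charFun_arraySum_sub_le (n : ℕ) {u : ℝ} (hu : |u| ≤ 1 / 2) :
    ‖∫ x, Complex.exp ((u * arraySum sqDev x : ℝ) * Complex.I) ∂model n
      - ∏ k ∈ Finset.range n, (approxChar u + k) / (k + 1)‖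
      ≤ 6 * u ^ 2 + 1060 * |u| ^ 3 * harmonic n := by
  have h1 : ∀ x : (Fin n → ℕ) × (Fin n × Fin n → ℝ),
      Complex.exp ((u * arraySum sqDev x : ℝ) * Complex.I)
      = ∏ p ∈ active x.1, Complex.exp ((u * sqDev ((p.1 : ℕ) + 1) (x.2 p) : ℝ) * Complex.I) := by
    intro x
    rw [← Complex.exp_sum, ← Finset.sum_mul, arraySum, Finset.mul_sum]
    push_cast
    rfl
  have hθ : ‖approxChar u‖ ≤ 1 := by simpa using norm_approxChar_add_le hu 0
  set ψ : ℕ → ℂ := fun j => ∫ s, Complex.exp ((u * sqDev j s : ℝ) * Complex.I) ∂gammaMeasure j 1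
    with hψ
  have hψ1 : ∀ j : Fin n, ‖ψ ((j : ℕ) + 1)‖ ≤ 1 := fun j => by
    refine (norm_integral_le_of_norm_le_const (C := 1) (ae_of_all _ fun s =>
      (Complex.norm_exp_ofReal_mul_I _).le)).trans ?_
    simp only [probReal_univ, mul_one, le_refl]
  have h2 := integral_prod_active (n := n)
    (e := fun j s => Complex.exp ((u * sqDev j s : ℝ) * Complex.I))
    (fun j => by have := measurable_sqDev j; fun_prop) fun j s => (Complex.norm_exp_ofReal_mul_I _).le
  simp_rw [h1]
  rw [h2, ← sum_weight_mul_pow le_rfl, ← Finset.sum_sub_distrib]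
  have h3 : ∀ ν ∈ parts n n, ‖(weight ν : ℂ) * ∏ j : Fin n, ψ ((j : ℕ) + 1) ^ ν j
      - (weight ν : ℂ) * approxChar u ^ ∑ j, ν j‖
      ≤ ∑ j : Fin n, weight ν * ν j * ‖ψ ((j : ℕ) + 1) - approxChar u‖ := by
    intro ν _
    rw [← mul_sub, norm_mul, Complex.norm_real, Real.norm_of_nonneg (weight_nonneg ν),
      ← Finset.prod_pow_eq_pow_sum]
    have := norm_prod_sub_prod_le Finset.univ (f := fun j : Fin n => ψ ((j : ℕ) + 1) ^ ν j)
      (g := fun j => approxChar u ^ ν j)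
      (fun j _ => by rw [norm_pow]; exact pow_le_one₀ (norm_nonneg _) (hψ1 j))
      fun j _ => by rw [norm_pow]; exact pow_le_one₀ (norm_nonneg _) hθ
    simp_rw [mul_assoc]
    rw [← Finset.mul_sum]
    refine mul_le_mul_of_nonneg_left (this.trans ?_) (weight_nonneg ν)
    exact Finset.sum_le_sum fun j _ => norm_pow_sub_pow_le (hψ1 j) hθ _
  refine (norm_sum_le _ _).trans ((Finset.sum_le_sum h3).trans ?_)
  rw [Finset.sum_comm]
  simp_rw [← Finset.sum_mul]
  -- After telescoping only the expected counts `1 / (j + 1)` enter. The error `3 u^2 / (j + 1)`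
  -- becomes summable, and the cubic error acquires a harmonic number.
  rw [Finset.sum_congr rfl fun j _ => by rw [sum_weight_mul_apply_eq]]
  rw [Fin.sum_univ_eq_sum_range (fun j => 1 / ((j : ℝ) + 1) * ‖ψ (j + 1) - approxChar u‖)]
  calc ∑ j ∈ Finset.range n, 1 / ((j : ℝ) + 1) * ‖ψ (j + 1) - approxChar u‖
      ≤ ∑ j ∈ Finset.range n, (3 * u ^ 2 * (1 / ((j : ℝ) + 1) ^ 2)
        + 1060 * |u| ^ 3 * (1 / ((j : ℝ) + 1))) := by
        refine Finset.sum_le_sum fun j _ => ?_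
        have := norm_charFun_sqDev_sub_le (Nat.le_add_left 1 j) u
        refine (mul_le_mul_of_nonneg_left this (by positivity)).trans (le_of_eq ?_)
        push_cast
        field_simp
    _ ≤ 3 * u ^ 2 * 2 + 1060 * |u| ^ 3 * harmonic n := by
        rw [Finset.sum_add_distrib, ← Finset.mul_sum, ← Finset.mul_sum, sum_one_div_eq_harmonic]
        gcongr
        exact sum_one_div_sq_le n
    _ = _ := by ring

/-- With `z = θ - 1` each factor is `1 + z / (k + 1)`, within `|z|^2 / (k + 1)^2` of `exp (z / (k +
1))`. Since `Re z ≤ 0`, the exponentials stay in the unit disc too. -/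
theorem norm_prod_sub_exp_le (n : ℕ) {u : ℝ} (hu : |u| ≤ 1 / 2) :
    ‖∏ k ∈ Finset.range n, (approxChar u + k) / (k + 1)
      - Complex.exp ((approxChar u - 1) * (harmonic n : ℝ))‖ ≤ 2 * ‖approxChar u - 1‖ ^ 2 := by
  set z := approxChar u - 1 with hz
  have hzre : z.re ≤ 0 := by
    have : z = ((-(3 / 2 * u ^ 2) : ℝ) : ℂ) + (u : ℝ) * Complex.I := by
      simp only [hz, approxChar]
      push_cast
      ring
    rw [this, Complex.add_re, Complex.ofReal_re, Complex.re_ofReal_mul, Complex.I_re]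
    nlinarith [sq_nonneg u]
  have hz1 : ‖z‖ ≤ 1 := by
    have : z = (u : ℂ) * Complex.I - ((3 / 2 * u ^ 2 : ℝ) : ℂ) := by
      simp only [hz, approxChar]
      push_cast
      ring
    rw [this]
    refine (norm_sub_le _ _).trans ?_
    rw [norm_mul, Complex.norm_I, Complex.norm_real, Complex.norm_real, Real.norm_eq_abs, mul_one,
      Real.norm_of_nonneg (by positivity), ← sq_abs]
    nlinarith [abs_nonneg u]
  have hk : ∀ k : ℕ, ((k : ℂ) + 1) ≠ 0 := fun k => Nat.cast_add_one_ne_zero k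
  have e : Complex.exp (z * (harmonic n : ℝ)) = ∏ k ∈ Finset.range n, Complex.exp (z / (k + 1)) := by
    rw [← Complex.exp_sum, ← sum_one_div_eq_harmonic]
    push_cast
    rw [Finset.mul_sum]
    congr 1
    exact Finset.sum_congr rfl fun k _ => by ring
  have hn : ∀ k : ℕ, ‖((k : ℂ) + 1)‖ = (k : ℝ) + 1 := fun k => by
    have := Complex.norm_natCast (k + 1)
    push_cast at this
    exact this
  rw [e]
  refine (norm_prod_sub_prod_le _ (fun k _ => ?_) fun k _ => ?_).trans ?_
  · rw [norm_div, hn, div_le_one (by positivity)]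
    exact norm_approxChar_add_le hu k
  · rw [Complex.norm_exp]
    refine Real.exp_le_one_iff.2 ?_
    have : z / ((k : ℂ) + 1) = z / ((k + 1 : ℝ) : ℂ) := by push_cast; rfl
    rw [this, Complex.div_ofReal_re]
    exact div_nonpos_of_nonpos_of_nonneg hzre (by positivity)
  · calc _ ≤ ∑ k ∈ Finset.range n, ‖z‖ ^ 2 * (1 / ((k : ℝ) + 1) ^ 2) := by
          refine Finset.sum_le_sum fun k _ => ?_
          have e2 : (approxChar u + k) / (k + 1) = 1 + z / (k + 1) := by
            rw [hz]
            field_simp [hk k]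
            ring
          have hw : ‖z / ((k : ℂ) + 1)‖ = ‖z‖ / ((k : ℝ) + 1) := by rw [norm_div, hn]
          have hle : ‖z / ((k : ℂ) + 1)‖ ≤ 1 := by
            rw [hw, div_le_one (by positivity)]
            have : (0 : ℝ) ≤ k := Nat.cast_nonneg k
            linarith
          rw [e2, norm_sub_rev, ← sub_sub]
          refine (Complex.norm_exp_sub_one_sub_id_le hle).trans (le_of_eq ?_)
          rw [hw, div_pow, mul_one_div]
      _ ≤ _ := by
          rw [← Finset.mul_sum, mul_comm]
          gcongr
          exact sum_one_div_sq_le n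

theorem tendsto_log_natCast_atTop : Tendsto (fun n : ℕ => Real.log n) atTop atTop :=
  Real.tendsto_log_atTop.comp tendsto_natCast_atTop_atTop

theorem tendsto_harmonic_div_log :
    Tendsto (fun n : ℕ => (harmonic n : ℝ) / Real.log n) atTop (𝓝 1) := by
  have h1 := Real.tendsto_harmonic_sub_log.div_atTop tendsto_log_natCast_atTop
  have h2 : Tendsto (fun n : ℕ => ((harmonic n : ℝ) - Real.log n) / Real.log n + 1) atTop (𝓝 1) := by
    simpa using h1.add_const 1
  refine h2.congr' ?_
  filter_upwards [tendsto_log_natCast_atTop.eventually_gt_atTop 0] with n hn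
  field_simp
  ring

/-- The central limit theorem for the sum of the `sqDev j` over all blocks given `T_n = n`. -/
theorem tendsto_charFun_arraySum_sqDev (t : ℝ) :
    Tendsto (fun n : ℕ => ∫ x, Complex.exp
      ((t * ((arraySum sqDev x - Real.log n) / √(3 * Real.log n)) : ℝ) * Complex.I) ∂model n)
      atTop (𝓝 (Complex.exp (-(t ^ 2 / 2 : ℝ)))) := by
  set u : ℕ → ℝ := fun n => t / √(3 * Real.log n) with hu
  have hlog := tendsto_log_natCast_atTop
  have hu0 : Tendsto u atTop (𝓝 0) :=
    tendsto_const_nhds.div_atTop (Real.tendsto_sqrt_atTop.comp (hlog.const_mul_atTop (by norm_num)))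
  have husq : ∀ᶠ n in atTop, u n ^ 2 * Real.log n = t ^ 2 / 3 := by
    filter_upwards [hlog.eventually_gt_atTop 0] with n hn
    simp only [hu]
    rw [div_pow, Real.sq_sqrt (by positivity)]
    field_simp
  have huH : Tendsto (fun n => u n ^ 2 * (harmonic n : ℝ)) atTop (𝓝 (t ^ 2 / 3)) := by
    have := tendsto_harmonic_div_log.const_mul (t ^ 2 / 3)
    rw [mul_one] at this
    refine this.congr' ?_
    filter_upwards [husq, hlog.eventually_gt_atTop 0] with n hn hpos
    rw [← hn]
    field_simp
  have hmain : Tendsto (fun n => Complex.exp (-(u n * Real.log n : ℝ) * Complex.I) *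
      Complex.exp ((approxChar (u n) - 1) * (harmonic n : ℝ))) atTop
      (𝓝 (Complex.exp (-(t ^ 2 / 2 : ℝ)))) := by
    -- Centering at `log n` instead of `H_n` is harmless, as their difference converges to Euler's
    -- constant while `u n` vanishes.
    have h1 : Tendsto (fun n => u n * ((harmonic n : ℝ) - Real.log n)) atTop (𝓝 0) := by
      simpa using hu0.mul Real.tendsto_harmonic_sub_log
    have h2 : Tendsto (fun n => ((u n * ((harmonic n : ℝ) - Real.log n) : ℝ) : ℂ) * Complex.I
        - ((3 / 2 * (u n ^ 2 * (harmonic n : ℝ)) : ℝ) : ℂ)) atTop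
        (𝓝 (((0 : ℝ) : ℂ) * Complex.I - ((3 / 2 * (t ^ 2 / 3) : ℝ) : ℂ))) :=
      (((Complex.continuous_ofReal.tendsto _).comp h1).mul_const _).sub
        ((Complex.continuous_ofReal.tendsto _).comp (huH.const_mul _))
    have h3 := (Complex.continuous_exp.tendsto _).comp h2
    have e : ((0 : ℝ) : ℂ) * Complex.I - ((3 / 2 * (t ^ 2 / 3) : ℝ) : ℂ) = -(t ^ 2 / 2 : ℝ) := by
      push_cast
      ring
    rw [e] at h3
    refine h3.congr fun n => ?_
    rw [Function.comp_apply, ← Complex.exp_add]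
    congr 1
    simp only [approxChar]
    push_cast
    ring
  have herr : Tendsto (fun n => (6 * u n ^ 2 + 1060 * |u n| ^ 3 * harmonic n)
      + 2 * ‖approxChar (u n) - 1‖ ^ 2) atTop (𝓝 0) := by
    have h1 : Tendsto (fun n => 1060 * |u n| ^ 3 * (harmonic n : ℝ)) atTop (𝓝 0) := by
      have := (hu0.abs.mul huH).const_mul 1060
      simp only [abs_zero, zero_mul, mul_zero] at this
      refine this.congr fun n => ?_
      rw [← sq_abs]
      ring
    have h2 : Tendsto (fun n => 6 * u n ^ 2) atTop (𝓝 0) := by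
      simpa using (hu0.pow 2).const_mul 6
    have h3 : Tendsto (fun n => 2 * ‖approxChar (u n) - 1‖ ^ 2) atTop (𝓝 0) := by
      have hc : Continuous fun u : ℝ => 2 * ‖approxChar u - 1‖ ^ 2 := by
        unfold approxChar
        fun_prop
      have := (hc.tendsto 0).comp hu0
      have e0 : 2 * ‖approxChar 0 - 1‖ ^ 2 = 0 := by simp [approxChar]
      rwa [e0] at this
    simpa using (h2.add h1).add h3
  have hdiff : Tendsto (fun n : ℕ => (∫ x, Complex.exp
      ((t * ((arraySum sqDev x - Real.log n) / √(3 * Real.log n)) : ℝ) * Complex.I) ∂model n)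
      - Complex.exp (-(u n * Real.log n : ℝ) * Complex.I) *
      Complex.exp ((approxChar (u n) - 1) * (harmonic n : ℝ))) atTop (𝓝 0) := by
    refine squeeze_zero_norm' ?_ herr
    have hsmall : ∀ᶠ n in atTop, |u n| ≤ 1 / 2 := by
      have := hu0.abs
      rw [abs_zero] at this
      exact this.eventually_le_const (by norm_num)
    filter_upwards [hsmall] with n hn
    have e : ∀ x : (Fin n → ℕ) × (Fin n × Fin n → ℝ), Complex.exp
        ((t * ((arraySum sqDev x - Real.log n) / √(3 * Real.log n)) : ℝ) * Complex.I)
        = Complex.exp (-(u n * Real.log n : ℝ) * Complex.I) *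
          Complex.exp ((u n * arraySum sqDev x : ℝ) * Complex.I) := by
      intro x
      rw [← Complex.exp_add]
      congr 1
      simp only [hu]
      push_cast
      ring
    simp_rw [e]
    rw [integral_const_mul, ← mul_sub, norm_mul]
    have hone : ‖Complex.exp (-(u n * Real.log n : ℝ) * Complex.I)‖ = 1 := by
      rw [← Complex.ofReal_neg]
      exact Complex.norm_exp_ofReal_mul_I _
    rw [hone, one_mul]
    exact (norm_sub_le_norm_sub_add_norm_sub _ _ _).trans
      (add_le_add (norm_charFun_arraySum_sub_le n hn) (norm_prod_sub_exp_le n hn))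
  simpa using hdiff.add hmain

/-! ### Negligibility of the residuals. -/

theorem integrable_arraySum {n : ℕ} {F : ℕ → ℝ → ℝ} (hF : ∀ j, Measurable (F j))
    (h0 : ∀ j s, 0 ≤ F j s) (hi : ∀ j, 1 ≤ j → Integrable (F j) (gammaMeasure j 1)) :
    Integrable (arraySum (n := n) F) (model n) ∧ ∫ x, arraySum F x ∂model n
      = ∑ j ∈ Finset.range n, 1 / ((j : ℝ) + 1) * ∫ s, F (j + 1) s ∂gammaMeasure ((j + 1 : ℕ) : ℝ) 1 := by
  have hm := measurable_arraySum (n := n) hF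
  have hnn : ∀ x : (Fin n → ℕ) × (Fin n × Fin n → ℝ), 0 ≤ arraySum F x :=
    fun x => Finset.sum_nonneg fun _ _ => h0 _ _
  have hL : ∫⁻ x, ENNReal.ofReal (arraySum F x) ∂model n = ENNReal.ofReal
      (∑ j ∈ Finset.range n, 1 / ((j : ℝ) + 1) *
        ∫ s, F (j + 1) s ∂gammaMeasure ((j + 1 : ℕ) : ℝ) 1) := by
    have h1 : ∀ x : (Fin n → ℕ) × (Fin n × Fin n → ℝ), ENNReal.ofReal (arraySum F x)
        = arraySum (fun j s => ENNReal.ofReal (F j s)) x := fun x =>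
      ENNReal.ofReal_sum_of_nonneg fun _ _ => h0 _ _
    simp_rw [h1]
    rw [lintegral_arraySum fun j => (hF j).ennreal_ofReal, ENNReal.ofReal_sum_of_nonneg
      fun j _ => mul_nonneg (by positivity) (integral_nonneg fun s => h0 _ s)]
    refine Finset.sum_congr rfl fun j _ => ?_
    rw [ENNReal.ofReal_mul (by positivity), ofReal_integral_eq_lintegral_ofReal
      (hi (j + 1) (Nat.le_add_left 1 j)) (ae_of_all _ fun s => h0 _ s)]
  refine ⟨⟨hm.aestronglyMeasurable, ?_⟩, ?_⟩
  · rw [hasFiniteIntegral_iff_ofReal (ae_of_all _ hnn), hL]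
    exact ENNReal.ofReal_lt_top
  · rw [integral_eq_lintegral_of_nonneg_ae (ae_of_all _ hnn) hm.aestronglyMeasurable, hL,
      ENNReal.toReal_ofReal]
    exact Finset.sum_nonneg fun j _ => mul_nonneg (by positivity) (integral_nonneg fun s => h0 _ s)

theorem map_total {n : ℕ} (hn : 1 ≤ n) : (model n).map total = gammaMeasure (n : ℝ) 1 := by
  have hn' : (0 : ℝ) < n := by exact_mod_cast hn
  have hpr := isProbabilityMeasure_gammaMeasure hn' one_pos
  have : IsProbabilityMeasure ((model n).map shape) :=
    Measure.isProbabilityMeasure_map measurable_shape.aemeasurable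
  have h := congrArg (Measure.map Prod.fst) (map_total_shape hn)
  rw [Measure.map_map measurable_fst (measurable_total.prodMk measurable_shape),
    Measure.map_fst_prod, measure_univ, one_smul] at h
  exact h

theorem integral_total_sub_sq {n : ℕ} (hn : 1 ≤ n) :
    Integrable (fun x => (total x - n) ^ 2) (model n) ∧
      ∫ x, (total x - n) ^ 2 ∂model n = n := by
  have hn' : (0 : ℝ) < n := by exact_mod_cast hn
  have h1 := integrable_gamma_sub_pow hn' n 2
  have h2 := integral_gamma_sub_pow_two hn'
  rw [← map_total hn] at h1 h2
  refine ⟨h1.comp_measurable measurable_total, ?_⟩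
  rw [integral_map measurable_total.aemeasurable (by fun_prop)] at h2
  exact h2

theorem integral_arraySum_sqDev (n : ℕ) :
    Integrable (arraySum (n := n) sqDev) (model n) ∧
      ∫ x, arraySum sqDev x ∂model n = harmonic n := by
  have h := integrable_arraySum (n := n) measurable_sqDev sqDev_nonneg
    fun j hj => by simpa using integrable_sqDev_pow hj 1
  refine ⟨h.1, ?_⟩
  rw [h.2, ← sum_one_div_eq_harmonic]
  refine Finset.sum_congr rfl fun j _ => ?_
  rw [integral_sqDev (Nat.le_add_left 1 j), mul_one]

/-- Truncation at `1` moves inside the sum, so that only truncated means of single residuals are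
needed and no moments of them. -/
theorem min_one_sum_add_le {ι : Type*} (s : Finset ι) {z : ι → ℝ} (hz : ∀ i ∈ s, 0 ≤ z i) {c : ℝ}
    (hc : 0 ≤ c) : min 1 (∑ i ∈ s, z i + c) ≤ ∑ i ∈ s, min 1 (z i) + c := by
  by_cases h : ∃ i ∈ s, 1 ≤ z i
  · obtain ⟨i, hi, h1⟩ := h
    have h2 : min 1 (z i) ≤ ∑ i ∈ s, min 1 (z i) :=
      Finset.single_le_sum (f := fun i => min 1 (z i)) (fun j hj => le_min zero_le_one (hz j hj)) hi
    rw [min_eq_left h1] at h2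
    exact (min_le_left _ _).trans (by linarith)
  · push Not at h
    rw [Finset.sum_congr rfl fun i hi => min_eq_right (h i hi).le]
    exact min_le_right _ _

/-- Moments of order three of the gamma distribution. -/
theorem integral_gamma_abs_sub_pow_three_le {j : ℕ} (hj : 1 ≤ j) :
    Integrable (fun s : ℝ => |s - j| ^ 3) (gammaMeasure j 1) ∧
      ∫ s, |s - j| ^ 3 ∂gammaMeasure j 1 ≤ 5 * (j * √j) := by
  have hj' : (1 : ℝ) ≤ j := by exact_mod_cast hj
  have hj0 : (0 : ℝ) < j := by linarith
  have hsq : 0 < √(j : ℝ) := Real.sqrt_pos.2 hj0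
  have hss : √(j : ℝ) * √(j : ℝ) = j := Real.mul_self_sqrt hj0.le
  have hi2 := integrable_gamma_sub_pow hj0 (j : ℝ) 2
  have hi4 := integrable_gamma_sub_pow hj0 (j : ℝ) 4
  -- Arithmetic-geometric mean inequality between second and fourth powers; the weight `√j` balances
  -- moments of orders `j` and `j^2`.
  have hb : ∀ s : ℝ, |s - j| ^ 3 ≤ √j / 2 * (s - j) ^ 2 + 1 / (2 * √j) * (s - j) ^ 4 := by
    intro s
    have e : √j / 2 * (s - j) ^ 2 + 1 / (2 * √j) * (s - j) ^ 4 - |s - j| ^ 3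
        = |s - j| ^ 2 * (√j - |s - j|) ^ 2 / (2 * √j) := by
      rw [← sq_abs (s - j), show (s - (j : ℝ)) ^ 4 = |s - j| ^ 4 by
        rw [← Even.pow_abs (by decide : Even 4)]]
      field_simp
      ring
    have : 0 ≤ |s - j| ^ 2 * (√j - |s - j|) ^ 2 / (2 * √j) := by positivity
    linarith
  have hI := (hi2.const_mul (√j / 2)).add (hi4.const_mul (1 / (2 * √j)))
  have hint : Integrable (fun s : ℝ => |s - j| ^ 3) (gammaMeasure j 1) := by
    refine hI.mono' (by fun_prop) (ae_of_all _ fun s => ?_)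
    rw [Real.norm_of_nonneg (by positivity)]
    exact hb s
  refine ⟨hint, (integral_mono hint hI hb).trans ?_⟩
  have e : ∫ s, ((fun s : ℝ => √j / 2 * (s - j) ^ 2) + fun s : ℝ => 1 / (2 * √j) * (s - j) ^ 4 :
      ℝ → ℝ) s
      ∂gammaMeasure j 1 = √j / 2 * j + 1 / (2 * √j) * (3 * j ^ 2 + 6 * j) := by
    rw [integral_add' (hi2.const_mul _) (hi4.const_mul _), integral_const_mul, integral_const_mul,
      integral_gamma_sub_pow_two hj0, integral_gamma_sub_pow_four hj0]
  rw [e]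
  have h2 : 1 / (2 * √j) * (3 * (j : ℝ) ^ 2 + 6 * j) = √j * (3 * j + 6) / 2 := by
    field_simp
    rw [Real.sq_sqrt hj0.le]
  rw [h2]
  nlinarith

/-- Truncated means of functions which are small near the mean of the gamma distribution. -/
theorem integral_min_one_le {j : ℕ} (hj : 1 ≤ j) {C L : ℝ} (hC : 0 ≤ C) (hL : 1 ≤ L)
    {Z : ℝ → ℝ} (hZm : Measurable Z) (hZ0 : ∀ s, 0 ≤ Z s)
    (hZ : ∀ s : ℝ, |s - j| ≤ (j : ℝ) / 4 → Z s ≤ C * (|s - j| ^ 3 / j ^ 2)) :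
    ∫ s, min 1 (Z s / L) ∂gammaMeasure j 1 ≤ (5 * C + 16) / √j := by
  have hj' : (1 : ℝ) ≤ j := by exact_mod_cast hj
  have hj0 : (0 : ℝ) < j := by linarith
  have hp := isProbabilityMeasure_gammaMeasure hj0 one_pos
  obtain ⟨hi3, h3⟩ := integral_gamma_abs_sub_pow_three_le hj
  have hi2 := integrable_gamma_sub_pow hj0 (j : ℝ) 2
  -- Near the mean the cubic bound applies; beyond distance `j / 4` the minimum is at most `1 ≤ 16
  -- (s - j)^2 / j^2`, as in Chebyshev's inequality.
  have hb : ∀ s, min 1 (Z s / L) ≤ C / j ^ 2 * |s - j| ^ 3 + 16 / j ^ 2 * (s - j) ^ 2 := by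
    intro s
    rcases le_or_gt |s - j| ((j : ℝ) / 4) with hs | hs
    · have h1 : Z s / L ≤ Z s := div_le_self (hZ0 s) hL
      have h2 : C * (|s - j| ^ 3 / j ^ 2) = C / j ^ 2 * |s - j| ^ 3 := by ring
      have h3 : 0 ≤ 16 / (j : ℝ) ^ 2 * (s - j) ^ 2 := by positivity
      have := hZ s hs
      exact (min_le_right _ _).trans (by linarith)
    · have h1 : 1 ≤ 16 / (j : ℝ) ^ 2 * (s - j) ^ 2 := by
        rw [← sq_abs (s - j), div_mul_eq_mul_div, le_div_iff₀ (by positivity)]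
        nlinarith
      have h2 : 0 ≤ C / (j : ℝ) ^ 2 * |s - j| ^ 3 := by positivity
      exact (min_le_left _ _).trans (by linarith)
  have hI := (hi3.const_mul (C / j ^ 2)).add (hi2.const_mul (16 / (j : ℝ) ^ 2))
  have hint : Integrable (fun s => min 1 (Z s / L)) (gammaMeasure j 1) := by
    refine Integrable.of_bound (C := 1) (by fun_prop) (ae_of_all _ fun s => ?_)
    rw [Real.norm_of_nonneg (le_min zero_le_one (div_nonneg (hZ0 s) (by linarith)))]
    exact min_le_left _ _
  refine (integral_mono hint hI hb).trans ?_
  rw [integral_add' (hi3.const_mul _) (hi2.const_mul _), integral_const_mul, integral_const_mul,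
    integral_gamma_sub_pow_two hj0]
  have hsq : 0 < √(j : ℝ) := Real.sqrt_pos.2 hj0
  have hss : √(j : ℝ) * √(j : ℝ) = j := Real.mul_self_sqrt hj0.le
  have hs1 : 1 ≤ √(j : ℝ) := Real.one_le_sqrt.2 hj'
  have e1 : C / (j : ℝ) ^ 2 * ∫ s, |s - j| ^ 3 ∂gammaMeasure j 1 ≤ 5 * C / √j := by
    refine (mul_le_mul_of_nonneg_left h3 (by positivity)).trans (le_of_eq ?_)
    rw [← hss]
    field_simp
    rw [Real.sqrt_sq hsq.le]
  have e2 : 16 / (j : ℝ) ^ 2 * j ≤ 16 / √j := by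
    have : 16 / (j : ℝ) ^ 2 * j = 16 / j := by field_simp
    rw [this]
    refine div_le_div_of_nonneg_left (by norm_num) hsq ?_
    nlinarith
  rw [add_div]
  exact add_le_add e1 e2

theorem summable_one_div_mul_sqrt (D : ℝ) :
    Summable fun j : ℕ => 1 / ((j : ℝ) + 1) * (D / √((j + 1 : ℕ) : ℝ)) := by
  have h := (summable_nat_add_iff 1).2 (Real.summable_one_div_nat_rpow.2 (by norm_num : (1 : ℝ) < 3 / 2))
  refine (h.mul_left D).congr fun j => ?_
  have : (((j + 1 : ℕ) : ℝ)) ^ (3 / 2 : ℝ) = ((j + 1 : ℕ) : ℝ) * √((j + 1 : ℕ) : ℝ) := by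
    rw [Real.sqrt_eq_rpow, ← Real.rpow_one_add' (by positivity) (by norm_num)]
    norm_num
  rw [this]
  push_cast
  field_simp

/-- The truncated sum over all blocks of functions which are small near the mean of the gamma
distribution is negligible. -/
theorem tendsto_sum_integral_min_one {C : ℝ} (hC : 0 ≤ C) {Z : ℕ → ℝ → ℝ}
    (hZm : ∀ j, Measurable (Z j)) (hZ0 : ∀ j s, 0 ≤ Z j s)
    (hZ : ∀ j : ℕ, 1 ≤ j → ∀ s : ℝ, |s - j| ≤ (j : ℝ) / 4 → Z j s ≤ C * (|s - j| ^ 3 / j ^ 2))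
    {L : ℕ → ℝ} (hL : Tendsto L atTop atTop) :
    Tendsto (fun n : ℕ => ∑ j ∈ Finset.range n, 1 / ((j : ℝ) + 1) *
      ∫ s, min 1 (Z (j + 1) s / L n) ∂gammaMeasure ((j + 1 : ℕ) : ℝ) 1) atTop (𝓝 0) := by
  -- Extended by zero, the sums become series over all `j`. Each term vanishes as `L n` grows, and
  -- the majorant of order `j^{-3/2}` does not depend on `n`.
  let f : ℕ → ℕ → ℝ := fun n j => if j < n then 1 / ((j : ℝ) + 1) *
      ∫ s, min 1 (Z (j + 1) s / L n) ∂gammaMeasure ((j + 1 : ℕ) : ℝ) 1 else 0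
  have hsum : ∀ n, ∑' j, f n j = ∑ j ∈ Finset.range n, 1 / ((j : ℝ) + 1) *
      ∫ s, min 1 (Z (j + 1) s / L n) ∂gammaMeasure ((j + 1 : ℕ) : ℝ) 1 := by
    intro n
    rw [tsum_eq_sum (s := Finset.range n)]
    · exact Finset.sum_congr rfl fun j hj => if_pos (Finset.mem_range.1 hj)
    · intro j hj
      exact if_neg fun h => hj (Finset.mem_range.2 h)
  have hnn : ∀ᶠ n in atTop, ∀ j s, 0 ≤ min 1 (Z j s / L n) := by
    filter_upwards [hL.eventually_ge_atTop 1] with n hn j s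
    exact le_min zero_le_one (div_nonneg (hZ0 j s) (by linarith))
  have hlim : ∀ j, Tendsto (fun n => f n j) atTop (𝓝 0) := by
    intro j
    have h1 : Tendsto (fun n => ∫ s, min 1 (Z (j + 1) s / L n) ∂gammaMeasure ((j + 1 : ℕ) : ℝ) 1)
        atTop (𝓝 (∫ _, (0 : ℝ) ∂gammaMeasure ((j + 1 : ℕ) : ℝ) 1)) := by
      refine tendsto_integral_filter_of_dominated_convergence (fun _ => 1) (.of_forall fun n => ?_)
        ?_ (integrable_const _) (ae_of_all _ fun s => ?_)
      · have := hZm (j + 1)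
        fun_prop
      · filter_upwards [hnn] with n hn
        refine ae_of_all _ fun s => ?_
        rw [Real.norm_of_nonneg (hn _ s)]
        exact min_le_left _ _
      · have : Tendsto (fun n => Z (j + 1) s / L n) atTop (𝓝 0) := tendsto_const_nhds.div_atTop hL
        have h2 := (tendsto_const_nhds (x := (1 : ℝ))).min this
        simpa using h2
    rw [integral_zero] at h1
    have h2 := h1.const_mul (1 / ((j : ℝ) + 1))
    rw [mul_zero] at h2
    refine h2.congr' ?_
    filter_upwards [eventually_gt_atTop j] with n hn
    simp only [f, hn, if_true]
  have := tendsto_tsum_of_dominated_convergence (f := f) (g := fun _ => 0)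
    (summable_one_div_mul_sqrt (5 * C + 16)) hlim ?_
  · simpa only [hsum, tsum_zero] using this
  · filter_upwards [hL.eventually_ge_atTop 1, hnn] with n hn hn0 j
    simp only [f]
    split_ifs
    · rw [Real.norm_of_nonneg (mul_nonneg (by positivity) (integral_nonneg fun s => hn0 _ s))]
      refine mul_le_mul_of_nonneg_left ?_ (by positivity)
      exact integral_min_one_le (Nat.le_add_left 1 j) hC hn (hZm _) (hZ0 _)
        (hZ (j + 1) (Nat.le_add_left 1 j))
    · rw [norm_zero]
      positivity

/-! ### The rescaled statistic and its quadratic approximation. -/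

theorem arraySum_add {M : Type*} [AddCommMonoid M] {n : ℕ} (F G : ℕ → ℝ → M)
    (x : (Fin n → ℕ) × (Fin n × Fin n → ℝ)) :
    arraySum (fun j s => F j s + G j s) x = arraySum F x + arraySum G x :=
  Finset.sum_add_distrib

theorem arraySum_const_mul {n : ℕ} (c : ℝ) (F : ℕ → ℝ → ℝ)
    (x : (Fin n → ℕ) × (Fin n × Fin n → ℝ)) :
    arraySum (fun j s => c * F j s) x = c * arraySum F x :=
  (Finset.mul_sum _ _ _).symm

theorem arraySum_size {n : ℕ} {x : (Fin n → ℕ) × (Fin n × Fin n → ℝ)} (hx : x.1 ∈ parts n n) :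
    arraySum (fun j _ => (j : ℝ)) x = n :=
  sum_active_shape hx

/-- The statistic, before centering, when all block lengths are rescaled so that their sum is
`c`. -/
noncomputable def scaledStat (h : ℂ → ℂ) (c : ℝ) {n : ℕ} (x : (Fin n → ℕ) × (Fin n × Fin n → ℝ)) :
    ℝ :=
  arraySum (fun j s => blockTerm h j (c / total x * s)) x

/-- The bound for the residual of a rescaled block length, up to terms due to the rescaling. -/
theorem IsAdmissible.exists_residual_majorant {h : ℂ → ℂ} (hh : IsAdmissible h) :
    ∃ C, 0 ≤ C ∧ ∃ Z : ℕ → ℝ → ℝ, (∀ j, Measurable (Z j)) ∧ (∀ j s, 0 ≤ Z j s) ∧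
      (∀ j : ℕ, 1 ≤ j → ∀ s : ℝ, |s - j| ≤ (j : ℝ) / 4 → Z j s ≤ C * (|s - j| ^ 3 / j ^ 2)) ∧
      ∀ j : ℕ, 1 ≤ j → ∀ s : ℝ, 0 < s → ∀ l ∈ Set.Icc (4 / 5 : ℝ) (4 / 3),
        |residual h j (l * s)| ≤ Z j s + C * |l - 1| ^ 3 * j := by
  obtain ⟨C, hC0, hC⟩ := hh.exists_residual_bound
  have hY : ∀ j : ℕ, ∃ Y : ℝ → ℝ, Measurable Y ∧ (∀ s, 0 ≤ Y s) ∧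
      (1 ≤ j → ∀ s, 0 < s → ∀ l ∈ Set.Icc (1 / 2 : ℝ) 2, |residual h j (l * s)| ≤ Y s) := by
    intro j
    by_cases hj : 1 ≤ j
    · obtain ⟨Y, h1, h2, h3⟩ := exists_measurable_envelope (hh.continuousOn_residual hj)
      exact ⟨Y, h1, h2, fun _ => h3⟩
    · exact ⟨fun _ => 0, measurable_const, fun _ => le_rfl, fun h => absurd h hj⟩
  choose Y hYm hY0 hY using hY
  -- Far from the mean any measurable envelope will do, because only truncated means are used. The
  -- factor `10` exceeds `4 * (4 / 3)^3`, from `(a + b)^3 ≤ 4 (a^3 + b^3)` and `l ≤ 4 / 3`.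
  refine ⟨10 * C, by positivity, fun j s => if |s - j| ≤ (j : ℝ) / 4 then
    10 * C * (|s - j| ^ 3 / j ^ 2) else Y j s, fun j => ?_, fun j s => ?_, fun j _ s hs => ?_,
    fun j hj s hs l hl => ?_⟩
  · have := hYm j
    exact Measurable.ite (measurableSet_le (by fun_prop) measurable_const) (by fun_prop) (hYm j)
  · dsimp only
    split_ifs
    · positivity
    · exact hY0 j s
  · dsimp only
    rw [if_pos hs]
  · have hj' : (0 : ℝ) < j := by exact_mod_cast hj
    have h0 : 0 ≤ 10 * C * |l - 1| ^ 3 * j := by positivity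
    dsimp only
    split_ifs with hn
    · have hab := abs_le.1 hn
      have hmem : l * s ∈ Set.Icc ((j : ℝ) / 2) (2 * j) := by
        constructor <;> nlinarith [hl.1, hl.2]
      refine (hC j hj _ hmem).trans ?_
      have h1 : |l * s - j| ≤ 4 / 3 * |s - j| + |l - 1| * j := by
        have e : l * s - j = l * (s - j) + (l - 1) * j := by ring
        rw [e]
        refine (abs_add_le _ _).trans ?_
        rw [abs_mul, abs_mul, abs_of_pos hj', abs_of_nonneg (by linarith [hl.1] : 0 ≤ l)]
        gcongr
        exact hl.2
      have h2 : |l * s - j| ^ 3 ≤ 10 * |s - j| ^ 3 + 10 * (|l - 1| * j) ^ 3 := by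
        refine (pow_le_pow_left₀ (abs_nonneg _) h1 3).trans ?_
        refine (add_pow_le (by positivity) (by positivity) 3).trans ?_
        have ha : 0 ≤ |s - j| ^ 3 := by positivity
        have hb : 0 ≤ (|l - 1| * j) ^ 3 := by positivity
        rw [mul_pow]
        norm_num
        linarith
      calc C * (|l * s - j| ^ 3 / j ^ 2)
          ≤ C * ((10 * |s - j| ^ 3 + 10 * (|l - 1| * j) ^ 3) / j ^ 2) := by gcongr
        _ = _ := by field_simp
    · have := hY j hj s hs l ⟨by linarith [hl.1], by linarith [hl.2]⟩
      linarith

/-- The distance between the rescaled statistic and its quadratic approximation. -/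
theorem abs_scaledStat_sub_le {h : ℂ → ℂ} {C : ℝ} (hC : 0 ≤ C) {Z : ℕ → ℝ → ℝ}
    (hZ : ∀ j : ℕ, 1 ≤ j → ∀ s : ℝ, 0 < s → ∀ l ∈ Set.Icc (4 / 5 : ℝ) (4 / 3),
        |residual h j (l * s)| ≤ Z j s + C * |l - 1| ^ 3 * j)
    {n : ℕ} (hn : 1 ≤ n) {M : ℝ} (hM1 : 1 ≤ M) (hM : M ≤ √n / 4)
    {x : (Fin n → ℕ) × (Fin n × Fin n → ℝ)} (hx : x.1 ∈ parts n n) (hpos : ∀ p, 0 < x.2 p)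
    (hG : |total x - n| ≤ M * √n) :
    |scaledStat h n x - (deriv (deriv h) 1).re / 2 * arraySum sqDev x| ≤ arraySum Z x +
      (8 * C + 10 * |(deriv (deriv h) 1).re|) * (M ^ 2 + M * arraySum sqDev x / √n) := by
  set b := (deriv (deriv h) 1).re with hb
  set Q := arraySum sqDev x with hQ
  set l := (n : ℝ) / total x with hl
  have hn0 : (0 : ℝ) < n := by exact_mod_cast hn
  have hr : 0 < √(n : ℝ) := Real.sqrt_pos.2 hn0
  have hrr : √(n : ℝ) * √n = n := Real.mul_self_sqrt hn0.le
  have hMn : M * √n ≤ n / 4 := by nlinarith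
  have hG1 := abs_le.1 hG
  have hGpos : 0 < total x := by linarith
  -- The bounds `4 / 5` and `4 / 3` reflect that the total lies within `n / 4` of `n`.
  have hl1 : 4 / 5 ≤ l := by
    rw [hl, le_div_iff₀ hGpos]
    linarith
  have hl2 : l ≤ 4 / 3 := by
    rw [hl, div_le_iff₀ hGpos]
    linarith
  have hQ0 : 0 ≤ Q := Finset.sum_nonneg fun _ _ => sqDev_nonneg _ _
  have hlG : l * total x = n := by rw [hl]; field_simp
  have hlabs : |l - 1| ≤ 4 / 3 * (M / √n) := by
    have e : l - 1 = (n - total x) / total x := by rw [hl]; field_simp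
    rw [e, abs_div, abs_of_pos hGpos, abs_sub_comm, div_le_iff₀ hGpos]
    refine hG.trans ?_
    have : M * √n = M / √n * n := by
      field_simp
      rw [Real.sq_sqrt hn0.le]
    rw [this, mul_comm (4 / 3 : ℝ), mul_assoc]
    refine mul_le_mul_of_nonneg_left (by linarith) (by positivity)
  set m := M / √n with hm
  have hm0 : 0 ≤ m := by positivity
  have hm4 : m ≤ 1 / 4 := by
    rw [hm, div_le_iff₀ hr]
    linarith
  have hmM : m ^ 2 * n = M ^ 2 := by
    rw [hm, div_pow, Real.sq_sqrt hn0.le]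
    field_simp
  have hterm : ∀ (j : ℕ) (s : ℝ), 1 ≤ j → blockTerm h j (l * s) = residual h j (l * s) + (b / 2 * (l ^ 2 * sqDev j s)
      + (b / 2 * (2 * l * (l - 1) * s) + b / 2 * (-(l ^ 2 - 1) * j))) := by
    intro j s hj
    have hj' : (j : ℝ) ≠ 0 := by positivity
    simp only [residual, sqDev, ← hb]
    field_simp
    ring
  have hsum : scaledStat h n x = arraySum (fun j s => residual h j (l * s)) x
      + (b / 2 * (l ^ 2 * Q) + (b / 2 * (2 * l * (l - 1) * total x)
        + b / 2 * (-(l ^ 2 - 1) * n))) := by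
    have e1 : scaledStat h n x = arraySum (fun j s => residual h j (l * s) + (b / 2 * (l ^ 2 * sqDev j s)
      + (b / 2 * (2 * l * (l - 1) * s) + b / 2 * (-(l ^ 2 - 1) * j)))) x :=
      Finset.sum_congr rfl fun p _ => hterm _ _ (Nat.le_add_left 1 _)
    rw [e1, arraySum_add, arraySum_add, arraySum_add, arraySum_const_mul, arraySum_const_mul,
      arraySum_const_mul, arraySum_const_mul, arraySum_const_mul, arraySum_const_mul,
      arraySum_size hx]
    rfl
  -- The block sizes sum to `n` and the rescaled lengths sum to `l * total x = n`. Apart from the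
  -- term with `Q`, the effects of first order in `l - 1` therefore cancel and leave `-(l - 1)^2 n`,
  -- of order `M^2`.
  have e2 : scaledStat h n x - b / 2 * Q = arraySum (fun j s => residual h j (l * s)) x
      + b / 2 * ((l - 1) * (l + 1) * Q - (l - 1) ^ 2 * n) := by
    rw [hsum]
    linear_combination b / 2 * (2 * (l - 1)) * hlG
  have hres : |arraySum (fun j s => residual h j (l * s)) x|
      ≤ arraySum Z x + C * |l - 1| ^ 3 * n := by
    refine (Finset.abs_sum_le_sum_abs _ _).trans ?_
    have e3 : arraySum Z x + C * |l - 1| ^ 3 * n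
        = arraySum (fun j s => Z j s + C * |l - 1| ^ 3 * j) x := by
      rw [arraySum_add, arraySum_const_mul, arraySum_size hx]
    rw [e3]
    exact Finset.sum_le_sum fun p _ => hZ _ (Nat.le_add_left 1 _) _ (hpos p) l ⟨hl1, hl2⟩
  have h3 : C * |l - 1| ^ 3 * n ≤ 8 * C * M ^ 2 := by
    have : |l - 1| ^ 3 ≤ (4 / 3 * m) ^ 3 := pow_le_pow_left₀ (abs_nonneg _) hlabs 3
    calc C * |l - 1| ^ 3 * n ≤ C * (4 / 3 * m) ^ 3 * n := by gcongr
      _ = C * (64 / 27 * m) * (m ^ 2 * n) := by ring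
      _ = C * (64 / 27 * m) * M ^ 2 := by rw [hmM]
      _ ≤ C * 8 * M ^ 2 := by gcongr; linarith
      _ = _ := by ring
  have h4 : |b / 2 * ((l - 1) * (l + 1) * Q - (l - 1) ^ 2 * n)| ≤ 10 * |b| * (M ^ 2 + m * Q) := by
    rw [abs_mul, abs_div, abs_two]
    have h5 : |(l - 1) * (l + 1) * Q - (l - 1) ^ 2 * n| ≤ 4 * (m * Q) + 2 * M ^ 2 := by
      refine (abs_sub _ _).trans (add_le_add ?_ ?_)
      · rw [abs_mul, abs_mul, abs_of_nonneg hQ0, abs_of_nonneg (by linarith : 0 ≤ l + 1), ← mul_assoc]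
        refine mul_le_mul_of_nonneg_right ?_ hQ0
        nlinarith [abs_nonneg (l - 1)]
      · rw [abs_of_nonneg (by positivity), ← sq_abs, ← hmM, ← mul_assoc]
        refine mul_le_mul_of_nonneg_right ?_ hn0.le
        have := pow_le_pow_left₀ (abs_nonneg _) hlabs 2
        nlinarith [sq_nonneg m]
    have h6 : 0 ≤ m * Q := by positivity
    calc |b| / 2 * |(l - 1) * (l + 1) * Q - (l - 1) ^ 2 * n|
        ≤ |b| / 2 * (4 * (m * Q) + 2 * M ^ 2) := by gcongr
      _ ≤ |b| / 2 * (20 * (M ^ 2 + m * Q)) := by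
        gcongr
        nlinarith [sq_nonneg M]
      _ = _ := by ring
  have h7 : M * Q / √n = m * Q := by rw [hm]; ring
  rw [e2, h7]
  have h8 : 0 ≤ 8 * C * (m * Q) := by positivity
  refine (abs_add_le _ _).trans ?_
  linarith

/-- The statistic, before centering, for block lengths which are `c` times the entries of the
array. -/
noncomputable def shapeStat (h : ℂ → ℂ) (c : ℝ) {n : ℕ} (y : (Fin n → ℕ) × (Fin n × Fin n → ℝ)) :
    ℝ :=
  arraySum (fun j d => blockTerm h j (c * d)) y

/-- For fixed `c` the rescaled statistic is a function of `shape` alone, hence independent of the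
total. -/
theorem scaledStat_eq_shapeStat (h : ℂ → ℂ) (c : ℝ) {n : ℕ}
    (x : (Fin n → ℕ) × (Fin n × Fin n → ℝ)) : scaledStat h c x = shapeStat h c (shape x) := by
  refine Finset.sum_congr rfl fun p hp => ?_
  have hp' : p ∈ active x.1 := hp
  simp only [shape, hp', if_true]
  rw [div_mul_eq_mul_div, mul_div_assoc]

theorem IsAdmissible.measurable_shapeStat {h : ℂ → ℂ} (hh : IsAdmissible h) (n : ℕ) :
    Measurable fun q : ℝ × ((Fin n → ℕ) × (Fin n × Fin n → ℝ)) => shapeStat h q.1 q.2 := by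
  have hg : Measurable fun q : (Fin n → ℕ) × (ℝ × (Fin n × Fin n → ℝ)) =>
      shapeStat h q.2.1 (q.1, q.2.2) := by
    refine measurable_of_forall_fst fun ν => ?_
    simp only [shapeStat, arraySum]
    refine Finset.measurable_fun_sum _ fun p _ => ?_
    have h2 : Measurable fun a : ℝ × (Fin n × Fin n → ℝ) => a.1 * a.2 p :=
      measurable_fst.mul ((measurable_pi_apply p).comp measurable_snd)
    exact (hh.measurable_blockTerm ((p.1 : ℕ) + 1)).comp h2
  have hφ : Measurable fun q : ℝ × ((Fin n → ℕ) × (Fin n × Fin n → ℝ)) =>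
      (q.2.1, (q.1, q.2.2)) :=
    (measurable_fst.comp measurable_snd).prodMk
      (measurable_fst.prodMk (measurable_snd.comp measurable_snd))
  have e : (fun q : ℝ × ((Fin n → ℕ) × (Fin n × Fin n → ℝ)) => shapeStat h q.1 q.2)
      = (fun q : (Fin n → ℕ) × (ℝ × (Fin n × Fin n → ℝ)) => shapeStat h q.2.1 (q.1, q.2.2)) ∘
        fun q : ℝ × ((Fin n → ℕ) × (Fin n × Fin n → ℝ)) => (q.2.1, (q.1, q.2.2)) := by
    funext q
    rfl
  rw [e]
  exact hg.comp hφ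

theorem IsAdmissible.measurable_scaledStat {h : ℂ → ℂ} (hh : IsAdmissible h) (c : ℝ) (n : ℕ) :
    Measurable fun x : (Fin n → ℕ) × (Fin n × Fin n → ℝ) => scaledStat h c x := by
  have hφ : Measurable fun x : (Fin n → ℕ) × (Fin n × Fin n → ℝ) => (c, shape x) :=
    measurable_const.prodMk measurable_shape
  have e : (fun x : (Fin n → ℕ) × (Fin n × Fin n → ℝ) => scaledStat h c x)
      = (fun q : ℝ × ((Fin n → ℕ) × (Fin n × Fin n → ℝ)) => shapeStat h q.1 q.2) ∘
        fun x => (c, shape x) := by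
    funext x
    exact scaledStat_eq_shapeStat h c x
  rw [e]
  exact (hh.measurable_shapeStat n).comp hφ

theorem harmonic_le_three_mul_sqrt {n : ℕ} (hn : 1 ≤ n) : (harmonic n : ℝ) ≤ 3 * √n := by
  have h1 := harmonic_le_one_add_log n
  have h2 : Real.log n ≤ 2 * √n := by
    have := Real.log_le_rpow_div (Nat.cast_nonneg n : (0 : ℝ) ≤ n) (by norm_num : (0 : ℝ) < 1 / 2)
    rw [← Real.sqrt_eq_rpow] at this
    linarith
  have h3 : 1 ≤ √(n : ℝ) := Real.one_le_sqrt.2 (by exact_mod_cast hn)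
  linarith

/-- Off the event `|total - n| ≤ M √n` Chebyshev's inequality costs `1 / M^2`. On it the truncated
residuals vanish in mean, and the rescaling contributes a multiple of `M^2 + M H_n / √n`, which
after division by `√(log n)` is `O(M^{-2})`. -/
theorem tendsto_integral_min_one_scaledStat {h : ℂ → ℂ} (hh : IsAdmissible h) :
    Tendsto (fun n : ℕ => ∫ x, min 1 (|scaledStat h n x - (deriv (deriv h) 1).re / 2 *
      arraySum sqDev x| / √(Real.log n)) ∂model n) atTop (𝓝 0) := by
  obtain ⟨C, hC, Z, hZm, hZ0, hZ, hZr⟩ := hh.exists_residual_majorant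
  set b := (deriv (deriv h) 1).re with hb
  set K := 8 * C + 10 * |b| with hK
  have hK0 : 0 ≤ K := by positivity
  have hlog := tendsto_log_natCast_atTop
  -- The exponent makes `√(log n) = M^4`, so that `M` tends to infinity while `M^2` is negligible on
  -- the scale `√(log n)`.
  set M : ℕ → ℝ := fun n => Real.log n ^ (1 / 8 : ℝ) with hM
  have hMt : Tendsto M atTop atTop := (tendsto_rpow_atTop (by norm_num)).comp hlog
  have hLt : Tendsto (fun n : ℕ => √(Real.log n)) atTop atTop := Real.tendsto_sqrt_atTop.comp hlog
  have hS := tendsto_sum_integral_min_one hC hZm hZ0 hZ hLt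
  have hsmall : ∀ᶠ n : ℕ in atTop, Real.log n ≤ √n / 4 := by
    have h1 := (isLittleO_log_rpow_atTop (by norm_num : (0 : ℝ) < 1 / 2)).bound
      (by norm_num : (0 : ℝ) < 1 / 4)
    filter_upwards [tendsto_natCast_atTop_atTop.eventually h1, hlog.eventually_ge_atTop 0]
      with n hn hn0
    rw [Real.norm_of_nonneg hn0, Real.norm_of_nonneg (by positivity), ← Real.sqrt_eq_rpow] at hn
    linarith
  have hlim : Tendsto (fun n : ℕ => (1 + 4 * K) / M n ^ 2 + ∑ j ∈ Finset.range n, 1 / ((j : ℝ) + 1) *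
      ∫ s, min 1 (Z (j + 1) s / √(Real.log n)) ∂gammaMeasure ((j + 1 : ℕ) : ℝ) 1) atTop (𝓝 0) := by
    have h1 : Tendsto (fun n => (1 + 4 * K) / M n ^ 2) atTop (𝓝 0) :=
      tendsto_const_nhds.div_atTop ((tendsto_pow_atTop (by norm_num)).comp hMt)
    simpa using h1.add hS
  refine squeeze_zero' (.of_forall fun n => integral_nonneg fun x => ?_) ?_ hlim
  · exact le_min zero_le_one (by positivity)
  filter_upwards [hsmall, hMt.eventually_ge_atTop 1, eventually_ge_atTop 1,
    hlog.eventually_ge_atTop 1] with n hn1 hM1 hn hlog1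
  have hn0 : (0 : ℝ) < n := by exact_mod_cast hn
  have hr : 0 < √(n : ℝ) := Real.sqrt_pos.2 hn0
  have hM0 : 0 < M n := by linarith
  have hM8 : M n ^ 8 = Real.log n := by
    rw [hM, ← Real.rpow_natCast, ← Real.rpow_mul (by linarith)]
    norm_num
  have hL : √(Real.log n) = M n ^ 4 := by
    rw [← hM8, show M n ^ 8 = (M n ^ 4) ^ 2 by ring, Real.sqrt_sq (by positivity)]
  have hMle : M n ≤ √n / 4 := by
    refine le_trans ?_ hn1
    rw [← hM8]
    exact le_self_pow₀ hM1 (by norm_num)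
  set L := √(Real.log n) with hLdef
  have hL1 : 1 ≤ L := by rw [hL]; exact one_le_pow₀ hM1
  have hL0 : 0 < L := by linarith
  obtain ⟨hGi, hGv⟩ := integral_total_sub_sq hn
  obtain ⟨hQi, hQv⟩ := integral_arraySum_sqDev n
  have hmin0 : ∀ j s, 0 ≤ min 1 (Z j s / L) := fun j s =>
    le_min zero_le_one (div_nonneg (hZ0 j s) hL0.le)
  obtain ⟨hAi, hAv⟩ := integrable_arraySum (n := n) (F := fun j s => min 1 (Z j s / L))
    (fun j => by have := hZm j; fun_prop) hmin0 (fun j hj => by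
      have hj' : (0 : ℝ) < j := by exact_mod_cast hj
      have hp := isProbabilityMeasure_gammaMeasure hj' one_pos
      refine Integrable.of_bound (C := 1) (by have := hZm j; fun_prop) (ae_of_all _ fun s => ?_)
      rw [Real.norm_of_nonneg (hmin0 j s)]
      exact min_le_left _ _)
  have hI1 := hGi.div_const (M n ^ 2 * n)
  have hI3 := ((integrable_const (μ := model n) (M n ^ 2)).add
    ((hQi.const_mul (M n)).div_const (√n))).const_mul (K / L)
  have hbound : ∀ᵐ x ∂model n, min 1 (|scaledStat h n x - b / 2 * arraySum sqDev x| / L)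
      ≤ ((fun x => (total x - n) ^ 2 / (M n ^ 2 * n)) + arraySum (fun j s => min 1 (Z j s / L))
        + (fun x => K / L * (M n ^ 2 + M n * arraySum sqDev x / √n)) :
        (Fin n → ℕ) × (Fin n × Fin n → ℝ) → ℝ) x := by
    filter_upwards [ae_model_mem_parts n, ae_model_pos n] with x hx hpos
    simp only [Pi.add_apply]
    have hQ0 : 0 ≤ arraySum sqDev x := Finset.sum_nonneg fun _ _ => sqDev_nonneg _ _
    have h1 : 0 ≤ (total x - n) ^ 2 / (M n ^ 2 * n) := by positivity
    have h2 : 0 ≤ arraySum (fun j s => min 1 (Z j s / L)) x :=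
      Finset.sum_nonneg fun _ _ => hmin0 _ _
    have h3 : 0 ≤ K / L * (M n ^ 2 + M n * arraySum sqDev x / √n) := by positivity
    rcases le_or_gt |total x - n| (M n * √n) with hG | hG
    · have h4 := abs_scaledStat_sub_le hC hZr hn hM1 hMle hx hpos hG
      rw [← hb, ← hK] at h4
      have h5 : |scaledStat h n x - b / 2 * arraySum sqDev x| / L
          ≤ ∑ p ∈ active x.1, Z ((p.1 : ℕ) + 1) (x.2 p) / L
            + K / L * (M n ^ 2 + M n * arraySum sqDev x / √n) := by
        rw [← Finset.sum_div, div_le_iff₀ hL0, add_mul, div_mul_cancel₀ _ hL0.ne']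
        refine h4.trans (le_of_eq ?_)
        rw [mul_right_comm, div_mul_cancel₀ _ hL0.ne']
        rfl
      have h6 := min_one_sum_add_le (active x.1)
        (z := fun p => Z ((p.1 : ℕ) + 1) (x.2 p) / L)
        (fun p _ => div_nonneg (hZ0 _ _) hL0.le) h3
      have h7 := (min_le_min_left 1 h5).trans h6
      have h8 : arraySum (fun j s => min 1 (Z j s / L)) x
          = ∑ p ∈ active x.1, min 1 (Z ((p.1 : ℕ) + 1) (x.2 p) / L) := rfl
      linarith
    · have h4 : 1 ≤ (total x - n) ^ 2 / (M n ^ 2 * n) := by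
        rw [le_div_iff₀ (by positivity), one_mul, ← sq_abs (total x - n)]
        have := pow_le_pow_left₀ (by positivity) hG.le 2
        rwa [mul_pow, Real.sq_sqrt hn0.le] at this
      exact (min_le_left _ _).trans (by linarith)
  have hI12 := hI1.add hAi
  refine (integral_mono_of_nonneg (ae_of_all _ fun x => le_min zero_le_one (by positivity))
    (hI12.add hI3) hbound).trans ?_
  rw [integral_add' hI12 hI3, integral_add' hI1 hAi, hAv, integral_div, hGv, integral_const_mul,
    integral_add' (integrable_const _) ((hQi.const_mul (M n)).div_const (√n)), integral_div,
    integral_const_mul, hQv]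
  simp only [integral_const, probReal_univ, one_smul]
  have h9 : (n : ℝ) / (M n ^ 2 * n) = 1 / M n ^ 2 := by field_simp
  have h10 : K / L * (M n ^ 2 + M n * (harmonic n : ℝ) / √n) ≤ 4 * K / M n ^ 2 := by
    have h11 : M n * (harmonic n : ℝ) / √n ≤ 3 * M n ^ 2 := by
      rw [div_le_iff₀ hr]
      have := harmonic_le_three_mul_sqrt hn
      have h12 : M n ≤ M n ^ 2 := le_self_pow₀ hM1 (by norm_num)
      calc M n * (harmonic n : ℝ) ≤ M n * (3 * √n) := by gcongr
        _ ≤ M n ^ 2 * (3 * √n) := by gcongr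
        _ = _ := by ring
    calc K / L * (M n ^ 2 + M n * (harmonic n : ℝ) / √n) ≤ K / L * (M n ^ 2 + 3 * M n ^ 2) := by
          gcongr
      _ = _ := by
          rw [hL]
          field_simp
          ring
  rw [h9, add_div 1]
  linarith

/-- The standardized statistic when all block lengths are rescaled so that their sum is `c`. -/
noncomputable def standardStat (h : ℂ → ℂ) (c : ℝ) {n : ℕ}
    (x : (Fin n → ℕ) × (Fin n × Fin n → ℝ)) : ℝ :=
  (scaledStat h c x - 1 / 2 * (deriv (deriv h) 1).re * Real.log (n : ℝ))
    / √(3 / 4 * (deriv (deriv h) 1).re ^ 2 * Real.log (n : ℝ))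

theorem norm_exp_I_sub_exp_I_le (a b : ℝ) :
    ‖Complex.exp (a * Complex.I) - Complex.exp (b * Complex.I)‖ ≤ 2 * min 1 |a - b| := by
  have h1 : ‖Complex.exp (a * Complex.I) - Complex.exp (b * Complex.I)‖ ≤ |a - b| := by
    have e : Complex.exp (a * Complex.I) - Complex.exp (b * Complex.I)
        = Complex.exp (b * Complex.I) * (Complex.exp (Complex.I * (a - b : ℝ)) - 1) := by
      rw [mul_sub, ← Complex.exp_add, mul_one]
      congr 2
      push_cast
      ring
    rw [e, norm_mul, Complex.norm_exp_ofReal_mul_I, one_mul]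
    exact (Real.norm_exp_I_mul_ofReal_sub_one_le).trans (le_of_eq (Real.norm_eq_abs _))
  have h2 : ‖Complex.exp (a * Complex.I) - Complex.exp (b * Complex.I)‖ ≤ 2 := by
    refine (norm_sub_le _ _).trans ?_
    rw [Complex.norm_exp_ofReal_mul_I, Complex.norm_exp_ofReal_mul_I]
    norm_num
  rcases le_total 1 |a - b| with h | h
  · rw [min_eq_left h]
    linarith
  · rw [min_eq_right h]
    linarith [abs_nonneg (a - b)]

theorem min_one_mul_le {k y : ℝ} (hk : 0 ≤ k) (hy : 0 ≤ y) :
    min 1 (k * y) ≤ (1 + k) * min 1 y := by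
  rcases le_total 1 y with h | h
  · rw [min_eq_left h]
    exact (min_le_left _ _).trans (by linarith)
  · rw [min_eq_right h]
    exact (min_le_right _ _).trans (by nlinarith)

/-- The central limit theorem for the standardized statistic given `S_n = T_n = n`. -/
theorem tendsto_charFun_standardStat {h : ℂ → ℂ} (hh : IsAdmissible h) (t : ℝ) :
    Tendsto (fun n : ℕ => ∫ x, Complex.exp ((t * standardStat h n x : ℝ) * Complex.I) ∂model n)
      atTop (𝓝 (Complex.exp (-(t ^ 2 / 2 : ℝ)))) := by
  set b := (deriv (deriv h) 1).re with hb
  have hb0 : b ≠ 0 := hh.re_deriv_two_ne_zero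
  have hlog := tendsto_log_natCast_atTop
  -- The normalization contains `|b|`, so the approximation carries the sign of `b`. The limit
  -- depends on `t^2` only.
  set ε := b / |b| with hε
  have hε2 : (ε * t) ^ 2 = t ^ 2 := by
    have : ε ^ 2 = 1 := by rw [hε, div_pow, sq_abs, div_self (pow_ne_zero 2 hb0)]
    rw [mul_pow, this, one_mul]
  have hmain := tendsto_charFun_arraySum_sqDev (ε * t)
  rw [hε2] at hmain
  set κ := |t| * (2 / (√3 * |b|)) with hκ
  have hκ0 : 0 ≤ κ := by positivity
  have herr := (tendsto_integral_min_one_scaledStat hh).const_mul (2 * (1 + κ))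
  rw [mul_zero] at herr
  have hdiff : Tendsto (fun n : ℕ => ∫ x, Complex.exp ((t * standardStat h n x : ℝ) * Complex.I) ∂model n
      - ∫ x, Complex.exp ((ε * t * ((arraySum sqDev x - Real.log n) / √(3 * Real.log n)) : ℝ)
        * Complex.I) ∂model n) atTop (𝓝 0) := by
    refine squeeze_zero_norm' ?_ herr
    filter_upwards [hlog.eventually_gt_atTop 0] with n hn
    have hm1 := hh.measurable_scaledStat n n
    have hm2 := measurable_arraySum (n := n) measurable_sqDev
    have hi : ∀ f : (Fin n → ℕ) × (Fin n × Fin n → ℝ) → ℝ, Measurable f →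
        Integrable (fun x => Complex.exp ((f x : ℝ) * Complex.I)) (model n) := fun f hf =>
      Integrable.of_bound (C := 1) (by fun_prop)
        (ae_of_all _ fun x => (Complex.norm_exp_ofReal_mul_I _).le)
    have hsq : √(3 / 4 * b ^ 2 * Real.log n) = √3 * |b| / 2 * √(Real.log n) := by
      rw [show 3 / 4 * b ^ 2 * Real.log n = 3 * (b / 2) ^ 2 * Real.log n by ring,
        Real.sqrt_mul (by positivity), Real.sqrt_mul (by norm_num), Real.sqrt_sq_eq_abs, abs_div,
        abs_two]
      ring
    have hL0 : 0 < √(Real.log n) := Real.sqrt_pos.2 hn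
    have hb1 : 0 < |b| := abs_pos.2 hb0
    have hs3 : 0 < √(3 : ℝ) := by positivity
    rw [← integral_sub (hi _ (by unfold standardStat; fun_prop)) (hi _ (by fun_prop)),
      ← integral_const_mul]
    refine norm_integral_le_of_norm_le (Integrable.const_mul ?_ _) (ae_of_all _ fun x => ?_)
    · refine Integrable.of_bound (C := 1) (by fun_prop) (ae_of_all _ fun x => ?_)
      have h0 : 0 ≤ |scaledStat h n x - b / 2 * arraySum sqDev x| / √(Real.log n) := by positivity
      rw [← hb, Real.norm_of_nonneg (le_min zero_le_one h0)]
      exact min_le_left _ _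
    · refine (norm_exp_I_sub_exp_I_le _ _).trans ?_
      rw [mul_assoc 2 (1 + κ)]
      refine mul_le_mul_of_nonneg_left ?_ zero_le_two
      have e : t * standardStat h n x - ε * t * ((arraySum sqDev x - Real.log n) / √(3 * Real.log n))
          = t * (2 / (√3 * |b|)) * ((scaledStat h n x - b / 2 * arraySum sqDev x)
            / √(Real.log n)) := by
        rw [standardStat, ← hb, hsq, Real.sqrt_mul (by norm_num), hε]
        field_simp
        ring
      rw [e, abs_mul, abs_mul, abs_of_pos (by positivity : 0 < 2 / (√3 * |b|)), abs_div,
        abs_of_pos hL0]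
      refine min_one_mul_le hκ0 ?_
      positivity
  simpa using hdiff.add hmain

/-! ### From the Poisson and gamma variables to the model. -/

section Sample

variable {Ω : Type*} (N : ℕ → Ω → ℕ) (S : ℕ → ℕ → Ω → ℝ)

/-- The block counts, and the part of the array of gamma variables which is used when `T_n = n`. -/
def sample (n : ℕ) (ω : Ω) : (Fin n → ℕ) × (Fin n × Fin n → ℝ) :=
  (fun j => N ((j : ℕ) + 1) ω, fun p => S ((p.1 : ℕ) + 1) ((p.2 : ℕ) + 1) ω)

theorem sum_Icc_one_eq_sum_fin {M : Type*} [AddCommMonoid M] (n : ℕ) (f : ℕ → M) :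
    ∑ j ∈ Finset.Icc 1 n, f j = ∑ j : Fin n, f ((j : ℕ) + 1) := by
  rw [Fin.sum_univ_eq_sum_range fun j => f (j + 1), Finset.range_eq_Ico,
    Finset.sum_Ico_add' f 0 n 1, zero_add]
  rfl

theorem sample_mem_parts (n : ℕ) (ω : Ω) : (sample N S n ω).1 ∈ parts n n ↔ sumT N n ω = n := by
  rw [mem_parts, sumT, sum_Icc_one_eq_sum_fin]
  rfl

theorem sum_active_eq_sum_range {M : Type*} [AddCommMonoid M] {n : ℕ} {ν : Fin n → ℕ}
    (hν : ν ∈ parts n n) (g : Fin n → ℕ → M) :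
    ∑ p ∈ active ν, g p.1 p.2 = ∑ j, ∑ i ∈ Finset.range (ν j), g j i := by
  rw [active, Finset.sum_filter, Fintype.sum_prod_type]
  refine Finset.sum_congr rfl fun j _ => ?_
  have hj := apply_le_of_mem_parts hν j
  rw [← Finset.sum_filter]
  dsimp only
  rw [Finset.sum_filter, Fin.sum_univ_eq_sum_range fun i => if i < ν j then g j i else 0,
    ← Finset.sum_filter]
  refine Finset.sum_congr ?_ fun _ _ => rfl
  ext i
  simp only [Finset.mem_range, Finset.mem_filter]
  omega

theorem sum_eq_arraySum {M : Type*} [AddCommMonoid M] {n : ℕ} {ω : Ω} (hω : sumT N n ω = n)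
    (F : ℕ → ℝ → M) :
    ∑ j ∈ Finset.Icc 1 n, ∑ i ∈ Finset.Icc 1 (N j ω), F j (S j i ω)
      = arraySum F (sample N S n ω) := by
  have hp := (sample_mem_parts N S n ω).2 hω
  refine Eq.trans ?_ (sum_active_eq_sum_range hp fun j i =>
    F ((j : ℕ) + 1) (S ((j : ℕ) + 1) (i + 1) ω)).symm
  rw [sum_Icc_one_eq_sum_fin]
  refine Finset.sum_congr rfl fun j _ => ?_
  rw [sum_Icc_one_eq_sum_fin, Fin.sum_univ_eq_sum_range fun i =>
    F ((j : ℕ) + 1) (S ((j : ℕ) + 1) (i + 1) ω)]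
  rfl

variable {N S}

theorem U_eq (h : ℂ → ℂ) {n : ℕ} {ω : Ω} (hω : ∀ j, 1 ≤ j → ∀ i, 1 ≤ i → 0 < S j i ω) :
    U N S h n ω = (∑ j ∈ Finset.Icc 1 n, ∑ i ∈ Finset.Icc 1 (N j ω), blockTerm h j (S j i ω)
      - 1 / 2 * (deriv (deriv h) 1).re * Real.log n)
      / √(3 / 4 * (deriv (deriv h) 1).re ^ 2 * Real.log n) := by
  rw [U]
  congr 2
  refine Finset.sum_congr rfl fun j hj => Finset.sum_congr rfl fun i hi => ?_
  have hj' := (Finset.mem_Icc.1 hj).1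
  have hS := hω j hj' i (Finset.mem_Icc.1 hi).1
  rw [blockTerm, realPart_of_pos]
  have : (0 : ℝ) < j := by exact_mod_cast hj'
  positivity

theorem sumS_eq_total {n : ℕ} {ω : Ω} (hT : sumT N n ω = n) :
    sumS N S n ω = total (sample N S n ω) :=
  sum_eq_arraySum N S hT fun _ s => s

theorem V_eq {n : ℕ} {ω : Ω} (hT : sumT N n ω = n) :
    V N S n ω = (total (sample N S n ω) - n) / √n := by
  rw [V, sumS_eq_total hT, hT]

theorem W_eq_one_iff {n : ℕ} (hn : 1 ≤ n) {ω : Ω} : W N n ω = 1 ↔ sumT N n ω = n := by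
  have : (n : ℝ) ≠ 0 := by exact_mod_cast (by omega : n ≠ 0)
  rw [W, div_eq_one_iff_eq this]
  exact_mod_cast Iff.rfl

theorem total_pos {n : ℕ} (hn : 1 ≤ n) {x : (Fin n → ℕ) × (Fin n × Fin n → ℝ)}
    (hx : x.1 ∈ parts n n) (hpos : ∀ p, 0 < x.2 p) : 0 < total x := by
  refine Finset.sum_pos (fun p _ => hpos p) ?_
  rw [Finset.nonempty_iff_ne_empty]
  intro he
  have h1 := sum_active_shape hx
  rw [he, Finset.sum_empty] at h1
  have : (0 : ℝ) < n := by exact_mod_cast hn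
  linarith

/-- At `c` equal to the actual total the rescaling factor is `1`; this presents `U_n` as a function
of the total and of `shape`. -/
theorem U_eq_standardStat (h : ℂ → ℂ) {n : ℕ} (hn : 1 ≤ n) {ω : Ω} (hT : sumT N n ω = n)
    (hω : ∀ j, 1 ≤ j → ∀ i, 1 ≤ i → 0 < S j i ω) :
    U N S h n ω = standardStat h (total (sample N S n ω)) (sample N S n ω) := by
  have hpos : ∀ p, 0 < (sample N S n ω).2 p := fun p => hω _ (by omega) _ (by omega)
  have ht := total_pos hn ((sample_mem_parts N S n ω).2 hT) hpos
  rw [U_eq h hω, sum_eq_arraySum N S hT, standardStat, scaledStat, div_self ht.ne']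
  simp only [one_mul]

variable [MeasurableSpace Ω] {P : Measure Ω}

theorem IsPoissonGamma.measurable_sample (hNS : IsPoissonGamma P N S) (n : ℕ) :
    Measurable (sample N S n) :=
  (measurable_pi_lambda _ fun _ => hNS.measurable_N _ (by omega)).prodMk
    (measurable_pi_lambda _ fun _ => hNS.measurable_S _ _ (by omega) (by omega))

theorem IsPoissonGamma.measurable_sum (hNS : IsPoissonGamma P N S) {F : ℕ → ℝ → ℝ}
    (hF : ∀ j, Measurable (F j)) (n : ℕ) :
    Measurable fun ω => ∑ j ∈ Finset.Icc 1 n, ∑ i ∈ Finset.Icc 1 (N j ω), F j (S j i ω) := by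
  refine Finset.measurable_fun_sum _ fun j hj => ?_
  have hj' := (Finset.mem_Icc.1 hj).1
  have h1 : Measurable fun q : ℕ × Ω => ∑ i ∈ Finset.Icc 1 q.1, F j (S j i q.2) := by
    refine measurable_from_prod_countable_right fun m => ?_
    have h2 : ∀ i ∈ Finset.Icc 1 m, Measurable fun ω => F j (S j i ω) := fun i hi =>
      (hF j).comp (hNS.measurable_S _ _ hj' (Finset.mem_Icc.1 hi).1)
    exact Finset.measurable_fun_sum _ h2
  exact h1.comp ((hNS.measurable_N j hj').prodMk measurable_id)

theorem IsPoissonGamma.measurable_sumT (hNS : IsPoissonGamma P N S) (n : ℕ) :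
    Measurable (sumT N n) := by
  unfold sumT
  exact Finset.measurable_fun_sum _ fun j hj =>
    (hNS.measurable_N j (Finset.mem_Icc.1 hj).1).const_mul j

theorem IsPoissonGamma.measurable_V (hNS : IsPoissonGamma P N S) (n : ℕ) :
    Measurable (V N S n) := by
  have h1 : Measurable (sumS N S n) := hNS.measurable_sum (F := fun _ s => s)
    (fun _ => measurable_id) n
  have h2 : Measurable fun ω => (sumT N n ω : ℝ) := measurable_from_nat.comp (hNS.measurable_sumT n)
  exact (h1.sub h2).div_const _

theorem IsPoissonGamma.measurable_W (hNS : IsPoissonGamma P N S) (n : ℕ) :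
    Measurable (W N n) := by
  have h2 : Measurable fun ω => (sumT N n ω : ℝ) := measurable_from_nat.comp (hNS.measurable_sumT n)
  exact h2.div_const _

theorem IsPoissonGamma.ae_pos (hNS : IsPoissonGamma P N S) :
    ∀ᵐ ω ∂P, ∀ j, 1 ≤ j → ∀ i, 1 ≤ i → 0 < S j i ω := by
  rw [ae_all_iff]
  intro j
  rw [eventually_imp_distrib_left]
  intro hj
  rw [ae_all_iff]
  intro i
  rw [eventually_imp_distrib_left]
  intro hi
  have h := gamma_ae_pos (a := (j : ℝ))
  rw [← hNS.law_S j i hj hi] at h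
  exact ae_of_ae_map (hNS.measurable_S j i hj hi).aemeasurable h

/-- Only almost everywhere: `h` may be non-measurable off the half plane, but almost surely it is
evaluated at positive reals. -/
theorem IsPoissonGamma.aemeasurable_U (hNS : IsPoissonGamma P N S) {h : ℂ → ℂ}
    (hh : IsAdmissible h) (n : ℕ) : AEMeasurable (U N S h n) P := by
  have hm := ((hNS.measurable_sum hh.measurable_blockTerm n).sub_const
    (1 / 2 * (deriv (deriv h) 1).re * Real.log n)).div_const
    √(3 / 4 * (deriv (deriv h) 1).re ^ 2 * Real.log n)
  refine hm.aemeasurable.congr ?_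
  filter_upwards [hNS.ae_pos] with ω hω using (U_eq h hω).symm

/-- The law of the sample without conditioning. -/
theorem IsPoissonGamma.map_sample [IsProbabilityMeasure P] (hNS : IsPoissonGamma P N S) (n : ℕ) :
    P.map (sample N S n)
      = (Measure.pi fun j : Fin n => poissonMeasure (1 / (((j : ℕ) + 1 : ℕ) : NNReal))).prod
          (gammaArray n) := by
  have hN : ∀ j : Fin n, Measurable (N ((j : ℕ) + 1)) := fun j => hNS.measurable_N _ (by omega)
  have hS : ∀ p : Fin n × Fin n, Measurable (S ((p.1 : ℕ) + 1) ((p.2 : ℕ) + 1)) :=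
    fun p => hNS.measurable_S _ _ (by omega) (by omega)
  have h1 : P.map (fun ω (j : Fin n) => N ((j : ℕ) + 1) ω)
      = Measure.pi fun j : Fin n => poissonMeasure (1 / (((j : ℕ) + 1 : ℕ) : NNReal)) := by
    have hi : iIndepFun (fun j : Fin n => N ((j : ℕ) + 1)) P :=
      hNS.indep_N.precomp (g := fun j : Fin n => (j : ℕ)) Fin.val_injective
    rw [(iIndepFun_iff_map_fun_eq_pi_map fun j => (hN j).aemeasurable).1 hi]
    congr 1
    funext j
    exact hNS.law_N _ (by omega)
  have h2 : P.map (fun ω (p : Fin n × Fin n) => S ((p.1 : ℕ) + 1) ((p.2 : ℕ) + 1) ω)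
      = gammaArray n := by
    have hi : iIndepFun (fun p : Fin n × Fin n => S ((p.1 : ℕ) + 1) ((p.2 : ℕ) + 1)) P :=
      hNS.indep_S.precomp (g := fun p : Fin n × Fin n => ((p.1 : ℕ), (p.2 : ℕ))) (by
        intro p q hpq
        simp only [Prod.mk.injEq] at hpq
        exact Prod.ext (Fin.ext hpq.1) (Fin.ext hpq.2))
    rw [(iIndepFun_iff_map_fun_eq_pi_map fun p => (hS p).aemeasurable).1 hi, gammaArray]
    congr 1
    funext p
    exact hNS.law_S _ _ (by omega) (by omega)
  rw [← h1, ← h2, ← (indepFun_iff_map_prod_eq_prod_map_map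
    (measurable_pi_lambda _ hN).aemeasurable (measurable_pi_lambda _ hS).aemeasurable).1]
  · rfl
  · exact hNS.indep_N_S.comp (φ := fun (x : ℕ → ℕ) (j : Fin n) => x j)
      (ψ := fun (x : ℕ × ℕ → ℝ) (p : Fin n × Fin n) => x (p.1, p.2))
      (measurable_pi_lambda _ fun _ => measurable_pi_apply _)
      (measurable_pi_lambda _ fun _ => measurable_pi_apply _)

/-- The Poisson factors `exp (-1 / j)` multiply to a constant independent of `ν`, and what remains
is `weight ν`. -/
theorem pi_poisson_restrict_parts (n : ℕ) :
    (Measure.pi fun j : Fin n => poissonMeasure (1 / (((j : ℕ) + 1 : ℕ) : NNReal))).restrict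
        (parts n n : Set (Fin n → ℕ))
      = ENNReal.ofReal (Real.exp (-∑ j : Fin n, 1 / ((j : ℝ) + 1))) • cycleLaw n := by
  refine Measure.ext_of_singleton fun ν => ?_
  have hd : ∀ (μ : Fin n → ℕ), Measure.dirac μ {ν} = if μ = ν then (1 : ENNReal) else 0 := by
    intro μ
    rw [Measure.dirac_apply' _ (measurableSet_singleton _)]
    by_cases h : μ = ν <;> simp [h]
  rw [Measure.restrict_apply (measurableSet_singleton _), Measure.smul_apply, smul_eq_mul,
    cycleLaw]
  simp only [Measure.coe_finsetSum, Finset.sum_apply, Measure.smul_apply, smul_eq_mul, hd,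
    mul_ite, mul_one, mul_zero]
  rw [Finset.sum_ite_eq']
  by_cases hν : ν ∈ parts n n
  · rw [if_pos hν, Set.inter_eq_left.2 (by simpa using hν), Measure.pi_singleton,
      ← ENNReal.ofReal_mul (Real.exp_pos _).le, ← Finset.sum_neg_distrib, Real.exp_sum, weight,
      ← Finset.prod_mul_distrib, ENNReal.ofReal_prod_of_nonneg fun _ _ => by positivity]
    refine Finset.prod_congr rfl fun j _ => ?_
    rw [poissonMeasure_singleton]
    congr 1
    push_cast
    ring
  · rw [if_neg hν, mul_zero, Set.singleton_inter_eq_empty.2 (by simpa using hν), measure_empty]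

/-- Given `T_n = n`, the sample has the law `model n`. -/
theorem IsPoissonGamma.map_sample_restrict [IsProbabilityMeasure P] (hNS : IsPoissonGamma P N S)
    (n : ℕ) : ∃ a : ENNReal, a ≠ 0 ∧ a ≠ ⊤ ∧
      (P.restrict {ω | sumT N n ω = n}).map (sample N S n) = a • model n := by
  refine ⟨ENNReal.ofReal (Real.exp (-∑ j : Fin n, 1 / ((j : ℝ) + 1))),
    (ENNReal.ofReal_pos.2 (Real.exp_pos _)).ne',
    ENNReal.ofReal_ne_top, ?_⟩
  have hset : {ω | sumT N n ω = n}
      = sample N S n ⁻¹' ((parts n n : Set (Fin n → ℕ)) ×ˢ Set.univ) := by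
    ext ω
    simp [← sample_mem_parts N S n ω]
  have hm : MeasurableSet ((parts n n : Set (Fin n → ℕ)) ×ˢ
      (Set.univ : Set (Fin n × Fin n → ℝ))) :=
    (Set.to_countable _).measurableSet.prod MeasurableSet.univ
  rw [hset, ← Measure.restrict_map (hNS.measurable_sample n) hm, hNS.map_sample,
    ← Measure.prod_restrict, pi_poisson_restrict_parts, Measure.restrict_univ, model,
    Measure.prod_smul_left]

end Sample

/-! ### The canonical kernel and its continuity. -/

theorem IsAdmissible.measurable_standardized_shapeStat {h : ℂ → ℂ} (hh : IsAdmissible h) (n : ℕ) :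
    Measurable fun q : ℝ × ((Fin n → ℕ) × (Fin n × Fin n → ℝ)) =>
      (shapeStat h q.1 q.2 - 1 / 2 * (deriv (deriv h) 1).re * Real.log (n : ℝ))
        / √(3 / 4 * (deriv (deriv h) 1).re ^ 2 * Real.log (n : ℝ)) :=
  ((hh.measurable_shapeStat n).sub_const _).div_const _

theorem IsAdmissible.measurable_standardStat {h : ℂ → ℂ} (hh : IsAdmissible h) (c : ℝ) (n : ℕ) :
    Measurable fun x : (Fin n → ℕ) × (Fin n × Fin n → ℝ) => standardStat h c x :=
  ((hh.measurable_scaledStat c n).sub_const _).div_const _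

instance (n : ℕ) : IsProbabilityMeasure ((model n).map shape) :=
  Measure.isProbabilityMeasure_map measurable_shape.aemeasurable

/-- The conditional law of the standardized statistic given `T_n = n` and the value of `S_n`. -/
noncomputable def shapeKernel (h : ℂ → ℂ) (n : ℕ) : Kernel ℝ ℝ :=
  (Kernel.id ×ₖ Kernel.const ℝ ((model n).map shape)).map
    fun q : ℝ × ((Fin n → ℕ) × (Fin n × Fin n → ℝ)) =>
      (shapeStat h q.1 q.2 - 1 / 2 * (deriv (deriv h) 1).re * Real.log (n : ℝ))
        / √(3 / 4 * (deriv (deriv h) 1).re ^ 2 * Real.log (n : ℝ))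

theorem IsAdmissible.isMarkovKernel_shapeKernel {h : ℂ → ℂ} (hh : IsAdmissible h) (n : ℕ) :
    IsMarkovKernel (shapeKernel h n) :=
  Kernel.IsMarkovKernel.map _ (hh.measurable_standardized_shapeStat n)

theorem standardStat_eq (h : ℂ → ℂ) (c : ℝ) {n : ℕ} (x : (Fin n → ℕ) × (Fin n × Fin n → ℝ)) :
    standardStat h c x
      = (shapeStat h c (shape x) - 1 / 2 * (deriv (deriv h) 1).re * Real.log (n : ℝ))
        / √(3 / 4 * (deriv (deriv h) 1).re ^ 2 * Real.log (n : ℝ)) := by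
  rw [standardStat, scaledStat_eq_shapeStat]

theorem IsAdmissible.shapeKernel_apply {h : ℂ → ℂ} (hh : IsAdmissible h) (n : ℕ) (c : ℝ) :
    shapeKernel h n c = (model n).map fun x => standardStat h c x := by
  have hm := hh.measurable_standardized_shapeStat n
  rw [shapeKernel, Kernel.map_apply _ hm, Kernel.prod_apply, Kernel.id_apply, Kernel.const_apply,
    Measure.dirac_prod, Measure.map_map hm measurable_prodMk_left,
    Measure.map_map (hm.comp measurable_prodMk_left) measurable_shape]
  congr 1
  funext x
  exact (standardStat_eq h c x).symm

theorem IsAdmissible.measurable_total_standardStat {h : ℂ → ℂ} (hh : IsAdmissible h) (n : ℕ) :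
    Measurable fun x : (Fin n → ℕ) × (Fin n × Fin n → ℝ) =>
      (total x, standardStat h (total x) x) := by
  have e : (fun x : (Fin n → ℕ) × (Fin n × Fin n → ℝ) => (total x, standardStat h (total x) x))
      = (fun q : ℝ × ((Fin n → ℕ) × (Fin n × Fin n → ℝ)) => (q.1,
        (shapeStat h q.1 q.2 - 1 / 2 * (deriv (deriv h) 1).re * Real.log (n : ℝ))
        / √(3 / 4 * (deriv (deriv h) 1).re ^ 2 * Real.log (n : ℝ)))) ∘
        fun x => (total x, shape x) := by
    funext x
    exact Prod.ext rfl (standardStat_eq h _ x)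
  rw [e]
  exact (measurable_fst.prodMk (hh.measurable_standardized_shapeStat n)).comp
    (measurable_total.prodMk measurable_shape)

/-- By independence of the total and `shape`, conditioning on the total just freezes its value in
the statistic. -/
theorem IsAdmissible.map_total_standardStat {h : ℂ → ℂ} (hh : IsAdmissible h) {n : ℕ}
    (hn : 1 ≤ n) :
    (model n).map (fun x => (total x, standardStat h (total x) x))
      = gammaMeasure (n : ℝ) 1 ⊗ₘ shapeKernel h n := by
  have hm := hh.measurable_standardized_shapeStat n
  have hk := hh.isMarkovKernel_shapeKernel n
  have hpr := isProbabilityMeasure_gammaMeasure (a := (n : ℝ)) (by exact_mod_cast hn) one_pos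
  have hm' := measurable_fst.prodMk hm
  have e : (fun x : (Fin n → ℕ) × (Fin n × Fin n → ℝ) => (total x, standardStat h (total x) x))
      = (fun q : ℝ × ((Fin n → ℕ) × (Fin n × Fin n → ℝ)) => (q.1,
        (shapeStat h q.1 q.2 - 1 / 2 * (deriv (deriv h) 1).re * Real.log (n : ℝ))
        / √(3 / 4 * (deriv (deriv h) 1).re ^ 2 * Real.log (n : ℝ)))) ∘
        fun x => (total x, shape x) := by
    funext x
    exact Prod.ext rfl (standardStat_eq h _ x)
  rw [e, ← Measure.map_map hm' (measurable_total.prodMk measurable_shape), map_total_shape hn]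
  ext s hs
  rw [Measure.map_apply hm' hs, Measure.prod_apply (hm' hs), Measure.compProd_apply hs]
  refine lintegral_congr fun t => ?_
  rw [shapeKernel, Kernel.map_apply _ hm, Kernel.prod_apply, Kernel.id_apply, Kernel.const_apply,
    Measure.dirac_prod, Measure.map_map hm measurable_prodMk_left,
    Measure.map_apply (hm.comp measurable_prodMk_left) (measurable_prodMk_left hs)]
  rfl

theorem IsAdmissible.continuousAt_standardStat {h : ℂ → ℂ} (hh : IsAdmissible h) {n : ℕ}
    (hn : 1 ≤ n) {x : (Fin n → ℕ) × (Fin n × Fin n → ℝ)} (hx : x.1 ∈ parts n n)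
    (hpos : ∀ p, 0 < x.2 p) {c : ℝ} (hc : 0 < c) :
    ContinuousAt (fun t => standardStat h t x) c := by
  have ht := total_pos hn hx hpos
  refine ContinuousAt.div_const (ContinuousAt.sub ?_ continuousAt_const) _
  refine tendsto_finsetSum _ fun p _ => ?_
  have h1 : ContinuousAt (blockTerm h ((p.1 : ℕ) + 1)) (c / total x * x.2 p) :=
    (hh.continuousOn_blockTerm (by omega)).continuousAt
      (Ioi_mem_nhds (mul_pos (div_pos hc ht) (hpos p)))
  have h2 : ContinuousAt (fun t => t / total x * x.2 p) c := by fun_prop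
  exact ContinuousAt.comp (f := fun t => t / total x * x.2 p) h1 h2

/-- The law of the standardized statistic given `S_n = c` and `T_n = n`. -/
noncomputable def condLaw {h : ℂ → ℂ} (hh : IsAdmissible h) (n : ℕ) (c : ℝ) :
    ProbabilityMeasure ℝ :=
  ⟨shapeKernel h n c, have := hh.isMarkovKernel_shapeKernel n; inferInstance⟩

/-- One model carries the statistics for all `c`, and almost surely they are continuous in `c > 0`;
dominated convergence gives weak continuity of the laws. -/
theorem IsAdmissible.continuousAt_condLaw {h : ℂ → ℂ} (hh : IsAdmissible h) {n : ℕ} (hn : 1 ≤ n)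
    {c : ℝ} (hc : 0 < c) : ContinuousAt (condLaw hh n) c := by
  refine ProbabilityMeasure.tendsto_iff_forall_integral_tendsto.2 fun f => ?_
  have e : ∀ t, ∫ u, f u ∂(condLaw hh n t : Measure ℝ) = ∫ x, f (standardStat h t x) ∂model n := by
    intro t
    rw [condLaw, ProbabilityMeasure.coe_mk, hh.shapeKernel_apply,
      integral_map (hh.measurable_standardStat t n).aemeasurable
        f.continuous.aestronglyMeasurable]
  simp only [e]
  refine tendsto_integral_filter_of_dominated_convergence (fun _ => ‖f‖) ?_ ?_
    (integrable_const _) ?_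
  · exact Eventually.of_forall fun t => (f.continuous.measurable.comp
      (hh.measurable_standardStat t n)).aestronglyMeasurable
  · exact Eventually.of_forall fun t => ae_of_all _ fun x => f.norm_coe_le_norm _
  · filter_upwards [ae_model_mem_parts n, ae_model_pos n] with x hx hpos
    exact f.continuous.continuousAt.tendsto.comp
      (hh.continuousAt_standardStat hn hx hpos hc)

/-- A null set contains no interval `(x, x + ε)`, the gamma density being positive there. -/
theorem frequently_of_ae_gamma {a : ℝ} (ha : 0 < a) {p : ℝ → Prop}
    (hp : ∀ᵐ t ∂gammaMeasure a 1, p t) {x : ℝ} (hx : 0 ≤ x) : ∃ᶠ t in 𝓝 x, p t := by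
  intro hf
  obtain ⟨ε, hε, hb⟩ := Metric.eventually_nhds_iff.1 hf
  refine (gamma_Ioo_pos ha hx (show x < x + ε by linarith)).ne' (measure_mono_null ?_ (ae_iff.1 hp))
  intro t ht
  refine hb ?_
  rw [Real.dist_eq, abs_lt]
  constructor <;> linarith [ht.1, ht.2]

/-! ### Existence and uniqueness of the conditional law. -/

section Conditioning

variable {Ω : Type*} [MeasurableSpace Ω] {P : Measure Ω} [IsProbabilityMeasure P]
  {N : ℕ → Ω → ℕ} {S : ℕ → ℕ → Ω → ℝ} {h : ℂ → ℂ} {n : ℕ}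

/-- Any regular conditional distribution of `U_n` given `(V_n, W_n)` agrees almost everywhere on
`W_n = 1` with the kernel obtained from the canonical model. -/
theorem ae_eq_shapeKernel (hNS : IsPoissonGamma P N S) (hh : IsAdmissible h) (hn : 1 ≤ n)
    (κ : Kernel (ℝ × ℝ) ℝ) [IsMarkovKernel κ]
    (hκ : P.map (fun ω => ((V N S n ω, W N n ω), U N S h n ω))
      = (P.map fun ω => (V N S n ω, W N n ω)) ⊗ₘ κ) :
    ∀ᵐ t ∂gammaMeasure (n : ℝ) 1, κ ((t - n) / √n, 1) = shapeKernel h n t := by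
  have hn0 : (0 : ℝ) < n := by exact_mod_cast hn
  have hr : √(n : ℝ) ≠ 0 := (Real.sqrt_pos.2 hn0).ne'
  have hk := hh.isMarkovKernel_shapeKernel n
  have hpr := isProbabilityMeasure_gammaMeasure hn0 one_pos
  obtain ⟨a, ha0, hat, ha⟩ := hNS.map_sample_restrict n
  set A := {ω | sumT N n ω = n} with hA
  have hAm : MeasurableSet A := hNS.measurable_sumT n (measurableSet_singleton n)
  have hsm := hNS.measurable_sample n
  have hVW : Measurable fun ω => (V N S n ω, W N n ω) :=
    (hNS.measurable_V n).prodMk (hNS.measurable_W n)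
  have hTm : Measurable fun ω => total (sample N S n ω) := measurable_total.comp hsm
  have hT : (P.restrict A).map (fun ω => total (sample N S n ω))
      = a • gammaMeasure (n : ℝ) 1 := by
    rw [← map_total hn, ← Measure.map_smul, ← ha, Measure.map_map measurable_total hsm]
    rfl
  have hst := hh.measurable_total_standardStat n
  have hTU : (P.restrict A).map (fun ω => (total (sample N S n ω), U N S h n ω))
      = a • (gammaMeasure (n : ℝ) 1 ⊗ₘ shapeKernel h n) := by
    rw [← hh.map_total_standardStat hn, ← Measure.map_smul, ← ha, Measure.map_map hst hsm]
    refine Measure.map_congr ?_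
    filter_upwards [ae_restrict_mem hAm, ae_restrict_of_ae hNS.ae_pos] with ω hω hpos
    exact Prod.ext rfl (U_eq_standardStat h hn hω hpos)
  have hτ : Measurable fun t : ℝ => ((t - n) / √(n : ℝ), (1 : ℝ)) := by fun_prop
  have key : gammaMeasure (n : ℝ) 1 ⊗ₘ κ.comap _ hτ = gammaMeasure (n : ℝ) 1 ⊗ₘ shapeKernel h n := by
    ext s hs
    refine (ENNReal.mul_right_inj ha0 hat).1 ?_
    -- On `W_n = 1` the total is `n + √n V_n`, so `B` is the set `s` in the coordinates `(V_n,
    -- W_n)`. Computing its probability through the model and through `κ` gives the same factor `a`,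
    -- which cancels.
    set B : Set ((ℝ × ℝ) × ℝ) := {q | q.1.2 = 1 ∧ (n + √n * q.1.1, q.2) ∈ s} with hB
    have hBm : MeasurableSet B := by
      refine MeasurableSet.inter ?_ ?_
      · exact (measurable_snd.comp measurable_fst) (measurableSet_singleton (1 : ℝ))
      · have : Measurable fun q : (ℝ × ℝ) × ℝ => ((n : ℝ) + √n * q.1.1, q.2) := by fun_prop
        exact this hs
    have hback : ∀ t : ℝ, (n : ℝ) + √n * ((t - n) / √n) = t := fun t => by
      field_simp
      ring
    have e1 : P.map (fun ω => ((V N S n ω, W N n ω), U N S h n ω)) B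
        = a * (gammaMeasure (n : ℝ) 1 ⊗ₘ shapeKernel h n) s := by
      rw [← smul_eq_mul, ← Measure.smul_apply, ← hTU,
        Measure.map_apply_of_aemeasurable (hVW.aemeasurable.prodMk (hNS.aemeasurable_U hh n)) hBm,
        Measure.map_apply_of_aemeasurable
          (hTm.aemeasurable.prodMk (hNS.aemeasurable_U hh n).restrict) hs,
        Measure.restrict_apply' hAm]
      congr 1
      ext ω
      simp only [hB, Set.mem_preimage, Set.mem_ofPred_eq, Set.mem_inter_iff, W_eq_one_iff hn, hA]
      rw [and_comm]
      refine and_congr_left fun hω => ?_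
      rw [V_eq hω, hback]
    have e2 : P.map (fun ω => ((V N S n ω, W N n ω), U N S h n ω)) B
        = a * (gammaMeasure (n : ℝ) 1 ⊗ₘ κ.comap _ hτ) s := by
      have hg : Measurable fun q : ℝ × ℝ => κ q (Prod.mk q ⁻¹' B) :=
        Kernel.measurable_kernel_prodMk_left hBm
      rw [hκ, Measure.compProd_apply hBm, lintegral_map hg hVW, Measure.compProd_apply hs,
        ← smul_eq_mul, ← lintegral_smul_measure, ← hT,
        lintegral_map (Kernel.measurable_kernel_prodMk_left hs) hTm, ← lintegral_indicator hAm]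
      refine lintegral_congr fun ω => ?_
      by_cases hω : ω ∈ A
      · rw [Set.indicator_of_mem hω, Kernel.comap_apply, V_eq hω, (W_eq_one_iff hn).2 hω]
        congr 1
        ext u
        simp only [hB, Set.mem_preimage, Set.mem_ofPred_eq, true_and, hback]
      · rw [Set.indicator_of_notMem hω]
        have : Prod.mk (V N S n ω, W N n ω) ⁻¹' B = ∅ := by
          ext u
          simp only [hB, Set.mem_preimage, Set.mem_ofPred_eq, Set.mem_empty_iff_false, iff_false]
          exact fun hu => hω ((W_eq_one_iff hn).1 hu.1)
        rw [this, measure_empty]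
    rw [← e1, ← e2]
  exact Kernel.ae_eq_of_compProd_eq key

theorem isCondLawAt_condLaw (hNS : IsPoissonGamma P N S) (hh : IsAdmissible h) (hn : 1 ≤ n) :
    IsCondLawAt P (U N S h n) (V N S n) (W N n) 0 1 (condLaw hh n n) := by
  have hn0 : (0 : ℝ) < n := by exact_mod_cast hn
  have hr : √(n : ℝ) ≠ 0 := (Real.sqrt_pos.2 hn0).ne'
  have hk := hh.isMarkovKernel_shapeKernel n
  have hVW : Measurable fun ω => (V N S n ω, W N n ω) :=
    (hNS.measurable_V n).prodMk (hNS.measurable_W n)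
  have hD : MeasurableSet {q : ℝ × ℝ | q.2 = 1} := measurable_snd (measurableSet_singleton (1 : ℝ))
  have hφ : Measurable fun q : ℝ × ℝ => (n : ℝ) + √n * q.1 := by fun_prop
  set κ₀ := condDistrib (U N S h n) (fun ω => (V N S n ω, W N n ω)) P with hκ₀
  have h0 : P.map (fun ω => ((V N S n ω, W N n ω), U N S h n ω))
      = (P.map fun ω => (V N S n ω, W N n ω)) ⊗ₘ κ₀ :=
    (compProd_map_condDistrib (hNS.aemeasurable_U hh n)).symm
  classical
  -- An arbitrary regular conditional distribution is overwritten on the line `W_n = 1` by the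
  -- continuous canonical kernel, which changes it only on a null set.
  set κ : Kernel (ℝ × ℝ) ℝ := Kernel.piecewise hD ((shapeKernel h n).comap _ hφ) κ₀ with hκ
  have hκ1 : ∀ v, κ (v, 1) = shapeKernel h n (n + √n * v) := fun v => by
    rw [hκ, Kernel.piecewise_apply, if_pos (show (v, (1 : ℝ)) ∈ {q : ℝ × ℝ | q.2 = 1} from rfl),
      Kernel.comap_apply]
  refine ⟨κ, inferInstance, ?_, ?_, ?_⟩
  · rw [h0]
    ext s hs
    rw [Measure.compProd_apply hs, Measure.compProd_apply hs,
      lintegral_map (Kernel.measurable_kernel_prodMk_left hs) hVW,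
      lintegral_map (Kernel.measurable_kernel_prodMk_left hs) hVW]
    obtain ⟨a, ha0, hat, ha⟩ := hNS.map_sample_restrict n
    have hAm : MeasurableSet {ω | sumT N n ω = n} :=
      hNS.measurable_sumT n (measurableSet_singleton n)
    have hae : ∀ᵐ ω ∂P, sumT N n ω = n → κ₀ ((total (sample N S n ω) - n) / √n, 1)
        = shapeKernel h n (total (sample N S n ω)) := by
      refine (ae_restrict_iff' hAm).1 ?_
      have h1 := ae_eq_shapeKernel hNS hh hn κ₀ h0
      rw [← map_total hn] at h1
      have h2 := ae_of_ae_map measurable_total.aemeasurable h1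
      have h3 := Measure.ae_smul_measure h2 a
      rw [← ha] at h3
      exact ae_of_ae_map (hNS.measurable_sample n).aemeasurable h3
    refine lintegral_congr_ae ?_
    filter_upwards [hae] with ω hω
    by_cases hT : sumT N n ω = n
    · rw [V_eq hT, (W_eq_one_iff hn).2 hT, hω hT, hκ1]
      congr 2
      field_simp
      ring
    · have : (V N S n ω, W N n ω) ∉ {q : ℝ × ℝ | q.2 = 1} := fun hq =>
        hT ((W_eq_one_iff hn).1 hq)
      rw [hκ, Kernel.piecewise_apply, if_neg this]
  · have e : (fun v : ℝ => (⟨κ (v, 1), inferInstance⟩ : ProbabilityMeasure ℝ))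
        = fun v => condLaw hh n (n + √n * v) := by
      funext v
      exact Subtype.ext (hκ1 v)
    have h1 : ContinuousAt (condLaw hh n) (n + √n * 0) :=
      hh.continuousAt_condLaw hn (by simpa using hn0)
    have h2 : ContinuousAt (fun v : ℝ => (n : ℝ) + √n * v) 0 := by fun_prop
    rw [e]
    exact ContinuousAt.comp (f := fun v : ℝ => (n : ℝ) + √n * v) h1 h2
  · rw [hκ1, mul_zero, add_zero]
    rfl

/-- The kernel at hand and the canonical one agree at points arbitrarily close to total `n`, and
both are continuous there; limits in the Hausdorff space of probability measures are unique. -/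
theorem IsCondLawAt.eq_condLaw (hNS : IsPoissonGamma P N S) (hh : IsAdmissible h) (hn : 1 ≤ n)
    {ν : ProbabilityMeasure ℝ}
    (hν : IsCondLawAt P (U N S h n) (V N S n) (W N n) 0 1 ν) : ν = condLaw hh n n := by
  obtain ⟨κ, hκM, hκ, hc, hκν⟩ := hν
  have hn0 : (0 : ℝ) < n := by exact_mod_cast hn
  have hf := frequently_of_ae_gamma hn0 (ae_eq_shapeKernel hNS hh hn κ hκ) hn0.le
  have h1 : Tendsto (β := ProbabilityMeasure ℝ) (fun t : ℝ =>
      ⟨κ ((t - n) / √n, 1), inferInstance⟩) (𝓝 (n : ℝ)) (𝓝 ν) := by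
    have h2 : Tendsto (fun t : ℝ => (t - n) / √(n : ℝ)) (𝓝 (n : ℝ)) (𝓝 0) := by
      have : ContinuousAt (fun t : ℝ => (t - n) / √(n : ℝ)) n := by fun_prop
      simpa [ContinuousAt] using this
    have e : (⟨κ (0, 1), inferInstance⟩ : ProbabilityMeasure ℝ) = ν := Subtype.ext hκν.symm
    have hc' := hc.tendsto
    rw [e] at hc'
    exact hc'.comp h2
  exact tendsto_nhds_unique_of_frequently_eq h1 (hh.continuousAt_condLaw hn hn0)
    (hf.mono fun t ht => Subtype.ext ht)

end Conditioning

/-! ### Convergence to the normal law. -/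

/-- The laws given `S_n = T_n = n` converge to the standard normal distribution. -/
theorem IsAdmissible.tendsto_condLaw {h : ℂ → ℂ} (hh : IsAdmissible h) :
    Tendsto (fun n : ℕ => condLaw hh n n) atTop
      (𝓝 (⟨gaussianReal 0 1, inferInstance⟩ : ProbabilityMeasure ℝ)) := by
  refine ProbabilityMeasure.tendsto_of_tendsto_charFun fun t => ?_
  have e : ∀ n : ℕ, charFun (condLaw hh n n : Measure ℝ) t
      = ∫ x, Complex.exp ((t * standardStat h n x : ℝ) * Complex.I) ∂model n := by
    intro n
    rw [condLaw, ProbabilityMeasure.coe_mk, hh.shapeKernel_apply, charFun_apply_real,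
      integral_map (hh.measurable_standardStat n n).aemeasurable (by fun_prop)]
    simp
  simp only [e]
  refine (tendsto_charFun_standardStat hh t).trans_eq ?_
  rw [ProbabilityMeasure.coe_mk, charFun_gaussianReal]
  congr 2
  push_cast
  simp

end Grenander

theorem mainTheorem2 {Ω : Type*} [MeasurableSpace Ω] (P : Measure Ω) [IsProbabilityMeasure P]
    (N : ℕ → Ω → ℕ) (S : ℕ → ℕ → Ω → ℝ) (hNS : Grenander.IsPoissonGamma P N S)
    (h : ℂ → ℂ) (hh : Grenander.IsAdmissible h) :
    (∀ n : ℕ, 2 ≤ n → ∃! ν : ProbabilityMeasure ℝ,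
      Grenander.IsCondLawAt P (Grenander.U N S h n) (Grenander.V N S n) (Grenander.W N n) 0 1 ν) ∧
    (∀ ν : ℕ → ProbabilityMeasure ℝ,
      (∀ n : ℕ, 2 ≤ n → Grenander.IsCondLawAt P (Grenander.U N S h n) (Grenander.V N S n)
        (Grenander.W N n) 0 1 (ν n)) →
      Tendsto ν atTop (𝓝 (⟨gaussianReal 0 1, inferInstance⟩ : ProbabilityMeasure ℝ))) := by
  refine ⟨fun n hn => ⟨Grenander.condLaw hh n n,
    Grenander.isCondLawAt_condLaw hNS hh (by omega), fun ν hν =>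
    hν.eq_condLaw hNS hh (by omega)⟩, fun ν hν => ?_⟩
  refine hh.tendsto_condLaw.congr' ?_
  filter_upwards [eventually_ge_atTop 2] with n hn
  exact ((hν n hn).eq_condLaw hNS hh (by omega)).symm
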